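/- Let $\theta>0$ and $\lambda\in\mathbb R$ be real numbers, put $k:=\frac{\theta+2}{\theta}$, let $\mathcal H_\lambda:=L^2(\mathbb R,e^{2\lambda a}\,da)$, let $\mathbb D=\{z=p+iq\in\mathbb C: q>0\}$, and let $$\mathcal D_k:=\Big\{h:\mathbb D\to\mathbb C\ \text{holomorphic}\ \Big|\ \int_{\mathbb D}|h(z)|^2\,q^{2k-2}\,dp\,dq<\infty\Big\},\qquad \langle h_1,h_2\rangle:=\int_{\mathbb D}\overline{h_1}\,h_2\,q^{2k-2}\,dp\,dq .$$ For $g\in SL(2,\mathbb R)$ with $g^{-1}=\begin{pmatrix}a&b\\c&d\end{pmatrix}$ let $(V_\theta(g)h)(z):=(cz+d)^{-2k}\,h\big(\frac{az+b}{cz+d}\big)$ (principal power) be the projective holomorphic discrete series on $\mathcal D_k$. Let $\mathbb S=AN\subset SL(2,\mathbb R)$ be the subgroup of the elements $(a,n)=\begin{pmatrix}e^{a}&e^{a}n\\0&e^{-a}\end{pmatrix}$, $a,n\in\mathbb R$, and for real $\tau\neq0$ put $$(U_{\tau,\lambda}(a,n)\varphi)(a_0):=e^{-\lambda a+\frac i\tau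 e^{2(a-a_0)}n}\,\varphi(a_0-a).$$ (i) For every $\tilde u\in\mathcal H_\lambda$ and $z_0\in\mathbb D$ the integral $$T_{\theta,\lambda}\tilde u(z_0):=\int_{\mathbb R}e^{(\lambda-2k)q_0}\,e^{\frac i\theta e^{-2q_0}z_0}\,\tilde u(q_0)\,dq_0$$ converges absolutely; $T_{\theta,\lambda}$ is a linear bijection of $\mathcal H_\lambda$ onto $\mathcal D_k$, and it is unitary up to a constant: $$\langle T_{\theta,\lambda}u,T_{\theta,\lambda}v\rangle=2\pi\,\Gamma(2k-1)\,(\theta/2)^{2k}\,\langle u,v\rangle_{\mathcal H_\lambda}.$$ The operators $V_\theta(g)$ preserve $\mathcal D_k$, the operators ${\bf U}_{\theta,\lambda}(g):=T_{\theta,\lambda}^{-1}V_\theta(g)T_{\theta,\lambda}$, $g\in SL(2,\mathbb R)$, are unitary on $\mathcal H_\lambda$, and $T_{\theta,\lambda}$ intertwines the $AN$-actions: ${\bf U}_{\theta,\lambda}(a,n)=U_{-\theta,\lambda}(a,n)$ for all $(a,n)\in\mathbb S$. (ii) Let $J_\mu$ be the Bessel function of the first kind. There is a unitary involution $\vartheta_{\theta,\lambda}$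 of $\mathcal H_\lambda$ ($\vartheta_{\theta,\lambda}^2=1$) given by $$\vartheta_{\theta,\lambda}\varphi(a_0)=\frac4\theta\,e^{-2\lambda a_0}\int_{-\infty}^{\infty}J_{2k-1}\Big(\frac2\theta e^{-2a}\Big)\,e^{2(\lambda-1)a}\,\varphi(2a-a_0)\,da\qquad\text{for a.e. }a_0,$$ for every $\varphi\in\mathcal H_\lambda$ for which this integral converges absolutely for almost every $a_0$; if $\varphi\in\mathcal H_\lambda$ has compact support, then it converges absolutely for every $a_0$. (So $\vartheta_{\theta,\lambda}$ is the unique continuous extension of the integral formula from the compactly supported elements.) (iii) The triple $(\mathcal H_\lambda,{\bf U}_{\theta,\lambda},\vartheta_{\theta,\lambda})$ is a square integrable irreducible (projective) unitary representation of the hyperbolic plane $SL(2,\mathbb R)/K$, $K=SO(2)$, as a symmetric space of group type on $\mathbb S$. Explicitly: $\mathcal H_\lambda$ is a separable Hilbert space; ${\bf U}_{\theta,\lambda}$ is a strongly continuous projective unitary representation of $SL(2,\mathbb R)$, i.e. it is multiplicative up to phases and all functions $g\mapsto|\langle w,{\bf U}_{\theta,\lambda}(g)v\rangle|$ are continuous;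 for every $g$, ${\bf U}_{\theta,\lambda}((g^{T})^{-1})=\vartheta_{\theta,\lambda}{\bf U}_{\theta,\lambda}(g)\vartheta_{\theta,\lambda}$ up to a phase; the map $\mathbb S\to SL(2,\mathbb R)/K$, $x\mapsto xK$, is a homeomorphism; $\vartheta_{\theta,\lambda}$ commutes with ${\bf U}_{\theta,\lambda}(K)$; the map $gK\mapsto{\bf U}_{\theta,\lambda}(g)\,\vartheta_{\theta,\lambda}\,{\bf U}_{\theta,\lambda}(g)^{-1}$ from $SL(2,\mathbb R)/K$ to the automorphisms of $\mathcal H_\lambda$ is well defined, strongly continuous and injective; the restriction of ${\bf U}_{\theta,\lambda}$ to $\mathbb S$ is irreducible, and it is square integrable: for some $\psi\neq0$ all the functions $x\mapsto\langle\varphi,{\bf U}_{\theta,\lambda}(x)\psi\rangle$, $\varphi\in\mathcal H_\lambda$, are square integrable for the left Haar measure of $\mathbb S$. -/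

import Mathlib

open MeasureTheory
open scoped MatrixGroups UpperHalfPlane Manifold InnerProductSpace

noncomputable section

/-! ### Projective unitary representations and representations of symmetric spaces -/

/-- A (strongly continuous) projective unitary representation of the topological group `G` on the
Hilbert space `H`: a choice of unitary operators `U g`, multiplicative up to complex phases, such
that the induced map into the projective unitary group is continuous, i.e. such that all the
functions `g ↦ |⟨w, U g v⟩|` are continuous. -/
structure IsProjectiveUnitaryRep {G H : Type*} [Group G] [TopologicalSpace G]
    [NormedAddCommGroup H] [InnerProductSpace ℂ H] (U : G → (H ≃ₗᵢ[ℂ] H)) : Prop where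
  map_mul : ∀ g h : G, ∃ c : ℂ, ‖c‖ = 1 ∧ ∀ v : H, U (g * h) v = c • U g (U h v)
  continuous_abs_coeff : ∀ v w : H, Continuous fun g : G => ‖⟪w, U g v⟫_ℂ‖

/-- A (projective) unitary representation `(H, U, Θ)` of the symmetric space attached to the
involutive group `(G, σ)`: `H` is a separable Hilbert space, `U` is a (projective) unitary
representation of `G` on `H`, and `Θ` is a unitary involution of `H` implementing `σ`, i.e.
`U (σ g) = Θ U g Θ` (up to a phase, as `U g` is only determined up to a phase). -/
structure IsUnitaryRepOfSymmetricSpace {G H : Type*} [Group G] [TopologicalSpace G]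
    [NormedAddCommGroup H] [InnerProductSpace ℂ H] (σ : G →* G)
    (U : G → (H ≃ₗᵢ[ℂ] H)) (Θ : H ≃ₗᵢ[ℂ] H) : Prop where
  complete : CompleteSpace H
  separable : TopologicalSpace.SeparableSpace H
  isRep : IsProjectiveUnitaryRep U
  involutive : ∀ v : H, Θ (Θ v) = v
  intertwines : ∀ g : G, ∃ c : ℂ, ‖c‖ = 1 ∧ ∀ v : H, U (σ g) v = c • Θ (U g (Θ v))

/-- `(H, U, Θ)` is a square integrable irreducible (projective) unitary representation of the
group type symmetric space `G ⧸ K` on the group `S`, where `S` is mapped into `G` by `j`.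

The automorphism `Θ` lives on a dense `G`-invariant Fréchet subspace of `H`, presented as a
Fréchet space `E` with a continuous dense injection `ι : E → H`. -/
structure IsSquareIntegrableIrreducibleRep {G S H E : Type*}
    [Group G] [TopologicalSpace G]
    [Group S] [TopologicalSpace S] [MeasurableSpace S]
    [NormedAddCommGroup H] [InnerProductSpace ℂ H]
    [AddCommGroup E] [Module ℂ E] [UniformSpace E] [IsUniformAddGroup E] [ContinuousSMul ℂ E]
    [PolynormableSpace ℂ E]
    (K : Subgroup G) (j : S →* G) (U : G → (H ≃ₗᵢ[ℂ] H))
    (ι : E →L[ℂ] H) (Θ : E ≃L[ℂ] E) : Prop where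
  /-- `G ⧸ K` is of group type: `S → G ⧸ K`, `x ↦ x K`, is a homeomorphism. -/
  continuous_j : Continuous j
  groupType : IsHomeomorph fun x : S => (QuotientGroup.mk (j x) : G ⧸ K)
  /-- `H` is a separable Hilbert space with a projective unitary representation of `G`. -/
  complete : CompleteSpace H
  separable : TopologicalSpace.SeparableSpace H
  isRep : IsProjectiveUnitaryRep U
  /-- `E` is a Fréchet space, continuously and densely embedded in `H`. -/
  frechet_complete : CompleteSpace E
  frechet_t2 : T2Space E
  frechet_countable : (uniformity E).IsCountablyGenerated
  dense : DenseRange ι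
  injective : Function.Injective ι
  /-- `E` is `G`-invariant, `Θ` commutes with the action of `K`, and the map
  `Ω : G ⧸ K → Aut E`, `g K ↦ U g ∘ Θ ∘ (U g)⁻¹`, is well defined, (strongly) continuous and
  injective. -/
  exists_Omega : ∃ UE : G → (E ≃L[ℂ] E),
    (∀ g v, ι (UE g v) = U g (ι v)) ∧
    (∀ k ∈ K, ∀ v, Θ (UE k v) = UE k (Θ v)) ∧
    ∃ Ω : G ⧸ K → (E ≃L[ℂ] E),
      (∀ g v, Ω (QuotientGroup.mk g) v = UE g (Θ ((UE g).symm v))) ∧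
      (∀ v, Continuous fun m => Ω m v) ∧
      Function.Injective Ω
  /-- The restriction of `U` to `S` is irreducible. -/
  nontrivial : Nontrivial H
  irreducible : ∀ W : Submodule ℂ H, IsClosed (W : Set H) →
    (∀ x : S, ∀ v ∈ W, U (j x) v ∈ W) → W = ⊥ ∨ W = ⊤
  /-- The restriction of `U` to `S` is square integrable: for some nonzero `ψ`, all the
  coefficients `x ↦ ⟨φ, U x ψ⟩` are square integrable for the left Haar measure of `S`. -/
  squareIntegrable : ∃ μ : Measure S, μ.IsHaarMeasure ∧ ∃ ψ : H, ψ ≠ 0 ∧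
    ∀ φ : H, MemLp (fun x : S => ‖⟪φ, U (j x) ψ⟫_ℂ‖) 2 μ

/-! ### The group `S = AN` (the `ax + b` group) -/

/-- The group `S = AN`, in the global coordinates `(a, n) = exp(aH) exp(nE)`, `[H, E] = 2E`. -/
@[ext]
structure AN where
  a : ℝ
  n : ℝ

namespace AN

instance : Mul AN := ⟨fun x y => ⟨x.a + y.a, Real.exp (-2 * y.a) * x.n + y.n⟩⟩
instance : One AN := ⟨⟨0, 0⟩⟩
instance : Inv AN := ⟨fun x => ⟨-x.a, -(Real.exp (2 * x.a) * x.n)⟩⟩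

@[simp] theorem mul_a (x y : AN) : (x * y).a = x.a + y.a := rfl
@[simp] theorem mul_n (x y : AN) : (x * y).n = Real.exp (-2 * y.a) * x.n + y.n := rfl
@[simp] theorem one_a : (1 : AN).a = 0 := rfl
@[simp] theorem one_n : (1 : AN).n = 0 := rfl
@[simp] theorem inv_a (x : AN) : (x⁻¹).a = -x.a := rfl
@[simp] theorem inv_n (x : AN) : (x⁻¹).n = -(Real.exp (2 * x.a) * x.n) := rfl

instance : Group AN :=
  Group.ofLeftAxioms
    (by
      intro x y z
      ext
      · simp [add_assoc]
      · simp only [mul_n, mul_a, mul_add, Real.exp_add]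
        ring)
    (by intro x; ext <;> simp)
    (by
      intro x
      ext
      · simp
      · simp only [mul_n, inv_n, one_n]
        rw [mul_neg, ← mul_assoc, ← Real.exp_add]
        simp)

instance : TopologicalSpace AN :=
  TopologicalSpace.induced (fun x : AN => (x.a, x.n)) inferInstance

instance : MeasurableSpace AN := borel AN

instance : BorelSpace AN := ⟨rfl⟩

/-- The matrix `exp(aH) exp(nE)` in `SL(2, ℝ)`. -/
def toSLFun (x : AN) : SL(2, ℝ) :=
  ⟨!![Real.exp x.a, Real.exp x.a * x.n; 0, Real.exp (-x.a)], by
    simp [Matrix.det_fin_two_of, ← Real.exp_add]⟩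

theorem coe_toSLFun (x : AN) : (toSLFun x : Matrix (Fin 2) (Fin 2) ℝ) =
    !![Real.exp x.a, Real.exp x.a * x.n; 0, Real.exp (-x.a)] := rfl

/-- The embedding `(a, n) ↦ exp(aH) exp(nE)` of `AN` into `SL(2, ℝ)`. -/
def toSL : AN →* SL(2, ℝ) where
  toFun := toSLFun
  map_one' := by
    apply Subtype.ext
    rw [coe_toSLFun]
    ext i k
    fin_cases i <;> fin_cases k <;> simp
  map_mul' x y := by
    have h : Real.exp (x.a + y.a) * Real.exp (-(2 * y.a)) = Real.exp x.a * Real.exp (-y.a) := by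
      rw [← Real.exp_add, ← Real.exp_add]
      congr 1
      ring
    apply Subtype.ext
    rw [Matrix.SpecialLinearGroup.coe_mul]
    simp only [coe_toSLFun, Matrix.mul_fin_two, mul_a, mul_n]
    ext i k
    fin_cases i <;> fin_cases k
    · simp [Real.exp_add]
    · simp [mul_add, ← mul_assoc, h]
      rw [Real.exp_add]
      ring
    · simp
    · simp [Real.exp_add, mul_comm]

end AN

/-- The Cartan involution `g ↦ (gᵀ)⁻¹` of `SL(2, ℝ)`. -/
def cartanInvolution : SL(2, ℝ) →* SL(2, ℝ) where
  toFun g := (g.transpose)⁻¹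
  map_one' := by
    rw [inv_eq_one]
    apply Subtype.ext
    simp
  map_mul' g h := by
    rw [← mul_inv_rev]
    congr 1
    apply Subtype.ext
    simp [Matrix.transpose_mul]

/-! ### The representation spaces -/

/-- The Hilbert space `H_l = L²(A, e^{2la} da)`, `A ≃ ℝ`. -/
abbrev WeightedL2 (l : ℝ) : Type :=
  Lp ℂ 2 ((volume : Measure ℝ).withDensity fun a => ENNReal.ofReal (Real.exp (2 * l * a)))

/-- The number `(θ + 2) / θ`. -/
def dsParam (θ : ℝ) : ℝ := (θ + 2) / θ

/-- The measure `q^{2s-2} dp dq` on the upper half-plane `{p + iq : q > 0}`. -/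
def bergmanMeasure (s : ℝ) : Measure ℍ :=
  ((volume : Measure ℂ).comap UpperHalfPlane.coe).withDensity
    fun z => ENNReal.ofReal (z.im ^ (2 * s - 2))

/-- The weighted Bergman space `D_s`: the holomorphic functions `h` on the upper half-plane with
`∫ |h(p + iq)|² q^{2s-2} dp dq < ∞`. -/
def bergmanSpace (s : ℝ) : Submodule ℂ (ℍ → ℂ) where
  carrier := {h | MDifferentiable 𝓘(ℂ) 𝓘(ℂ) h ∧ MemLp h 2 (bergmanMeasure s)}
  add_mem' hf hg := ⟨hf.1.add hg.1, hf.2.add hg.2⟩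
  zero_mem' := ⟨fun _ => mdifferentiableAt_const, MemLp.zero⟩
  smul_mem' c _ hf := ⟨hf.1.const_smul c, hf.2.const_smul c⟩

/-- The inner product `∫ conj (h₁ z) h₂ z q^{2s-2} dp dq` of `D_s`. -/
def bergmanInner (s : ℝ) (h₁ h₂ : ℍ → ℂ) : ℂ :=
  ∫ z, (starRingEnd ℂ) (h₁ z) * h₂ z ∂(bergmanMeasure s)

/-- The operators of the projective holomorphic discrete series of `SL(2, ℝ)` on `D_s`:
`(V(g) h)(z) = (c z + d)^{-2s} h (g⁻¹ z)`, where `(c, d)` is the second row of `g⁻¹` and the power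
is the principal one. -/
def discreteSeries (s : ℝ) (g : SL(2, ℝ)) (h : ℍ → ℂ) (z : ℍ) : ℂ :=
  ((((g⁻¹ : SL(2, ℝ)) 1 0 : ℝ) : ℂ) * (z : ℂ) + (((g⁻¹ : SL(2, ℝ)) 1 1 : ℝ) : ℂ))
    ^ (((-2 * s : ℝ)) : ℂ) * h (g⁻¹ • z)

/-- The operators
`(U_{θ,l}(a, n) φ)(a₀) = exp(-l a + (i/θ) e^{2(a - a₀)} n) φ(a₀ - a)` of `AN`. -/
def anOperator (θ l : ℝ) (x : AN) (φ : ℝ → ℂ) (a₀ : ℝ) : ℂ :=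
  Complex.exp (-((l * x.a : ℝ) : ℂ)
    + Complex.I / (θ : ℂ) * ((Real.exp (2 * (x.a - a₀)) * x.n : ℝ) : ℂ)) * φ (a₀ - x.a)

/-! ### The explicit integral operators -/

/-- The integrand `e^{(l - 2s) q₀} e^{(i/θ) e^{-2q₀} z₀} u(q₀)`, `s = (θ + 2)/θ`, of the
Laplace-type map at `z₀`. -/
def laplaceIntegrand (θ l : ℝ) (u : ℝ → ℂ) (z₀ : ℍ) (q₀ : ℝ) : ℂ :=
  (Real.exp ((l - 2 * dsParam θ) * q₀) : ℂ)
    * Complex.exp (Complex.I / (θ : ℂ) * (Real.exp (-2 * q₀) : ℂ) * (z₀ : ℂ)) * u q₀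

/-- The Bessel function of the first kind `J_μ`, on positive arguments. -/
def besselJ (μ x : ℝ) : ℝ :=
  ∑' m : ℕ, (-1 : ℝ) ^ m / ((m.factorial : ℝ) * Real.Gamma ((m : ℝ) + μ + 1))
    * (x / 2) ^ (2 * (m : ℝ) + μ)

/-- The integrand `J_{2s-1}((2/θ) e^{-2a}) e^{2(l-1)a} φ(2a - a₀)`, `s = (θ + 2)/θ`. -/
def besselIntegrand (θ l : ℝ) (φ : ℝ → ℂ) (a₀ a : ℝ) : ℂ :=
  (besselJ (2 * dsParam θ - 1) (2 / θ * Real.exp (-2 * a)) : ℂ)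
    * (Real.exp (2 * (l - 1) * a) : ℂ) * φ (2 * a - a₀)

/-- The Bessel-kernel expression
`(4/θ) e^{-2 l a₀} ∫ J_{2s-1}((2/θ) e^{-2a}) e^{2(l-1)a} φ(2a - a₀) da`, `s = (θ + 2)/θ`. -/
def besselTransform (θ l : ℝ) (φ : ℝ → ℂ) (a₀ : ℝ) : ℂ :=
  ((4 / θ * Real.exp (-2 * l * a₀) : ℝ) : ℂ) * ∫ a : ℝ, besselIntegrand θ l φ a₀ a

end

noncomputable section

/-! ### Fourier transform of integrable functions -/

section Fourier

open FourierTransform Real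
open scoped ContDiff

/-! At fixed height Im z, the Laplace-type integral is a Fourier integral in p = Re z for the
variable `e^{-2r}/θ`. Plancherel on each horizontal line, Tonelli, and a Gamma integral over the
height show that T multiplies squared norms by a constant (`lintegral_laplaceTransform`).
Polarization gives the inner product formula and the norm identity gives injectivity.

Surjectivity rests on a reproducing kernel. Evaluation of Tu at w is pairing with an explicit vector
`evalKernel`, whose transform K is a power of `-i(z - conj w)` by the complex Gamma integral. For w
= i, the weight `(Im z)^{2s} |K|²` is invariant under rotations about i. For h in the Bergman space
h/K is holomorphic, so averaging over rotations and the mean value property give that the pairing of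
K with h is a nonzero multiple of h(i) (`bergmanInner_baseKernel`). Hence a function orthogonal to
the image of T vanishes at i. The image is stable under AN, which is transitive on the half-plane,
so the function vanishes everywhere.

The operators V(g) are isometries because `(Im z)^{2s} |h|²` integrated against the invariant
measure is unchanged by the action. They multiply up to a phase, because the logarithms of a cocycle
add up to a constant in `2πiℤ`. Strong continuity is checked on the dense span of the evaluation
vectors.

The involution is the Weyl element `z ↦ -1/z`, corrected by the phase `e^{iπs}` so that its square
is exactly 1; conjugation by this element is the Cartan involution. Its Bessel form comes from
integrating the Bessel series termwise: the Laplace transform of the kernel is `(1/w)^{ν+1}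
e^{-t/w}` (`integral_besselSeries`), which is the action of `z ↦ -1/z` on the Laplace exponential.
Equality of the two expressions is tested on one high horizontal line, first for compactly supported
elements, then in general by truncation.

Finally, a matrix coefficient on AN is, for fixed a, a Fourier integral in n. Fourier injectivity
gives irreducibility, and Plancherel gives square integrability. -/

theorem integral_fourier_mul_eq {f g : ℝ → ℂ} (hf : Integrable f) (hg : Integrable g) :
    ∫ ξ, 𝓕 f ξ * g ξ = ∫ x, f x * 𝓕 g x := by
  have h := VectorFourier.integral_fourierIntegral_smul_eq_flip (μ := volume) (ν := volume)
    (L := innerₗ ℝ) Real.continuous_fourierChar continuous_inner hf hg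
  rw [flip_innerₗ] at h
  exact h

theorem continuous_fourier_of_integrable {f : ℝ → ℂ} (hf : Integrable f) : Continuous (𝓕 f) :=
  VectorFourier.fourierIntegral_continuous Real.continuous_fourierChar continuous_inner hf

/-- Real smooth compactly supported functions become Schwartz functions after complexification, and
they already separate locally integrable functions. -/
theorem ae_eq_of_integral_schwartz_mul_eq {f g : ℝ → ℂ} (hf : LocallyIntegrable f)
    (hg : LocallyIntegrable g)
    (h : ∀ φ : SchwartzMap ℝ ℂ, ∫ x, φ x * f x = ∫ x, φ x * g x) : f =ᵐ[volume] g := by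
  refine ae_eq_of_integral_contDiff_smul_eq hf hg fun φ hφ hc => ?_
  have hg₁ : HasCompactSupport (Complex.ofRealCLM ∘ φ) := hc.comp_left rfl
  have hg₂ : ContDiff ℝ ∞ (Complex.ofRealCLM ∘ φ) := by fun_prop
  simpa using! h (hg₁.toSchwartzMap hg₂)

/-- Plancherel's theorem for functions which are integrable and square integrable. -/
theorem eLpNorm_fourier_eq {f : ℝ → ℂ} (hf : Integrable f) (hf2 : MemLp f 2) :
    eLpNorm (𝓕 f) 2 = eLpNorm f 2 := by
  -- The Fourier integral and the `L²` Fourier transform are identified by testing both, as tempered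
  -- distributions, against Schwartz functions.
  have key : 𝓕 f =ᵐ[volume] (𝓕 (hf2.toLp f) : Lp ℂ 2 (volume : Measure ℝ)) := by
    refine ae_eq_of_integral_schwartz_mul_eq
      (continuous_fourier_of_integrable hf).locallyIntegrable
      ((Lp.memLp _).locallyIntegrable (by norm_num)) fun φ => ?_
    have h := congrArg (fun F => F φ) (Lp.fourier_toTemperedDistribution_eq (hf2.toLp f))
    simp only [TemperedDistribution.fourier_apply, Lp.toTemperedDistribution_apply] at h
    refine Eq.trans ?_ h
    rw [← integral_fourier_mul_eq φ.integrable hf]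
    refine integral_congr_ae ?_
    filter_upwards [hf2.coeFn_toLp] with x hx
    rw [hx, SchwartzMap.fourier_coe, smul_eq_mul]
  rw [eLpNorm_congr_ae key, ← eLpNorm_congr_ae hf2.coeFn_toLp]
  have h := Lp.norm_fourier_eq (hf2.toLp f)
  rw [Lp.norm_def, Lp.norm_def] at h
  exact (ENNReal.toReal_eq_toReal_iff' (Lp.eLpNorm_ne_top _) (Lp.eLpNorm_ne_top _)).1 h

/-- Every Schwartz function is the Fourier transform of a Schwartz function, so its pairing with `f`
can be moved onto `𝓕 f`. -/
theorem ae_eq_zero_of_fourier_eq_zero {f : ℝ → ℂ} (hf : Integrable f) (h : ∀ x, 𝓕 f x = 0) :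
    f =ᵐ[volume] 0 := by
  refine ae_eq_of_integral_schwartz_mul_eq hf.locallyIntegrable
    (locallyIntegrable_zero) fun φ => ?_
  have h1 := integral_fourier_mul_eq (𝓕⁻ φ).integrable hf
  simp only [h, mul_zero, integral_zero] at h1
  rw [← SchwartzMap.fourier_coe] at h1
  simpa using h1

theorem eLpNorm_two_sq {α E : Type*} [MeasurableSpace α] [NormedAddCommGroup E] (f : α → E)
    (μ : Measure α) : eLpNorm f 2 μ ^ 2 = ∫⁻ x, ‖f x‖ₑ ^ 2 ∂μ := by
  rw [eLpNorm_eq_lintegral_rpow_enorm_toReal (by norm_num) (by norm_num)]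
  rw [← ENNReal.rpow_natCast, ← ENNReal.rpow_mul]
  simp

theorem memLp_two_iff_lintegral {α E : Type*} [MeasurableSpace α] [NormedAddCommGroup E]
    {f : α → E} {μ : Measure α} (hf : AEStronglyMeasurable f μ) :
    MemLp f 2 μ ↔ ∫⁻ x, ‖f x‖ₑ ^ 2 ∂μ < ⊤ := by
  rw [← eLpNorm_two_sq, MemLp]
  simp [hf, ENNReal.pow_lt_top_iff]

/-! ### The exponential substitution -/

/-- The substitution `y = c e^{-2r}`. -/
def expSubst (c r : ℝ) : ℝ := c * exp (-2 * r)

theorem expSubst_pos {c : ℝ} (hc : 0 < c) (r : ℝ) : 0 < expSubst c r := by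
  unfold expSubst; positivity

theorem image_expSubst {c : ℝ} (hc : 0 < c) : expSubst c '' Set.univ = Set.Ioi 0 := by
  ext y
  simp only [Set.image_univ, Set.mem_range, Set.mem_Ioi]
  constructor
  · rintro ⟨r, rfl⟩
    exact expSubst_pos hc r
  · intro hy
    refine ⟨-(log (y / c) / 2), ?_⟩
    rw [expSubst, show -2 * -(log (y / c) / 2) = log (y / c) by ring, exp_log (by positivity)]
    field_simp

theorem injective_expSubst {c : ℝ} (hc : 0 < c) : Function.Injective (expSubst c) := by
  intro x y h
  have := exp_injective (mul_left_cancel₀ hc.ne' h)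
  linarith

theorem hasDerivAt_expSubst (c r : ℝ) : HasDerivAt (expSubst c) (-2 * expSubst c r) r := by
  have h := ((hasDerivAt_id r).const_mul (-2)).exp.const_mul c
  refine h.congr_deriv ?_
  simp only [expSubst, id]
  ring

theorem abs_deriv_expSubst {c : ℝ} (hc : 0 < c) (r : ℝ) :
    |-2 * expSubst c r| = 2 * expSubst c r := by
  have := expSubst_pos hc r
  rw [abs_of_neg (by linarith)]
  ring

theorem integral_Ioi_eq_expSubst {c : ℝ} (hc : 0 < c) (g : ℝ → ℂ) :
    ∫ y in Set.Ioi 0, g y = ∫ r, (2 * expSubst c r) • g (expSubst c r) := by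
  rw [← image_expSubst hc, integral_image_eq_integral_abs_deriv_smul MeasurableSet.univ
    (fun r _ => (hasDerivAt_expSubst c r).hasDerivWithinAt) (injective_expSubst hc).injOn]
  simp only [abs_deriv_expSubst hc, Measure.restrict_univ]

theorem integrableOn_Ioi_iff_expSubst {c : ℝ} (hc : 0 < c) (g : ℝ → ℂ) :
    IntegrableOn g (Set.Ioi 0) ↔ Integrable fun r => (2 * expSubst c r) • g (expSubst c r) := by
  rw [← image_expSubst hc, integrableOn_image_iff_integrableOn_abs_deriv_smul MeasurableSet.univ
    (fun r _ => (hasDerivAt_expSubst c r).hasDerivWithinAt) (injective_expSubst hc).injOn]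
  simp only [abs_deriv_expSubst hc, integrableOn_univ]

theorem lintegral_Ioi_eq_expSubst {c : ℝ} (hc : 0 < c) (g : ℝ → ENNReal) :
    ∫⁻ y in Set.Ioi 0, g y = ∫⁻ r, ENNReal.ofReal (2 * expSubst c r) * g (expSubst c r) := by
  rw [← image_expSubst hc, lintegral_image_eq_lintegral_abs_deriv_mul MeasurableSet.univ
    (fun r _ => (hasDerivAt_expSubst c r).hasDerivWithinAt) (injective_expSubst hc).injOn]
  simp only [abs_deriv_expSubst hc, Measure.restrict_univ]

/-- The inverse of the exponential substitution, applied to a density. -/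
def expPull (c : ℝ) (F : ℝ → ℂ) : ℝ → ℂ :=
  (Set.Ioi 0).indicator fun y => ((2 * y)⁻¹ : ℝ) • F (-(log (y / c) / 2))

theorem expPull_expSubst {c : ℝ} (hc : 0 < c) (F : ℝ → ℂ) (r : ℝ) :
    expPull c F (expSubst c r) = ((2 * expSubst c r)⁻¹ : ℝ) • F r := by
  rw [expPull, Set.indicator_of_mem (Set.mem_Ioi.2 (expSubst_pos hc r))]
  congr 2
  rw [expSubst, mul_div_cancel_left₀ _ hc.ne', log_exp]
  ring

theorem smul_expPull_expSubst {c : ℝ} (hc : 0 < c) (F : ℝ → ℂ) (r : ℝ) :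
    (2 * expSubst c r) • expPull c F (expSubst c r) = F r := by
  have := expSubst_pos hc r
  rw [expPull_expSubst hc, smul_smul, mul_inv_cancel₀ (by positivity), one_smul]

theorem integrable_expPull {c : ℝ} (hc : 0 < c) {F : ℝ → ℂ} (hF : Integrable F) :
    Integrable (expPull c F) := by
  have : IntegrableOn (expPull c F) (Set.Ioi 0) := by
    rw [integrableOn_Ioi_iff_expSubst hc]
    simpa only [smul_expPull_expSubst hc] using hF
  rw [← integrable_indicator_iff measurableSet_Ioi] at this
  rwa [expPull, Set.indicator_indicator, Set.inter_self] at this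

/-- The scale `c / (2π)` absorbs the factor `2π` in the Fourier kernel. -/
theorem fourier_expPull {c : ℝ} (hc : 0 < c) (F : ℝ → ℂ) (p : ℝ) :
    𝓕 (expPull (c / (2 * π)) F) p =
      ∫ r, F r * Complex.exp (Complex.I * ((-p : ℝ) : ℂ) * (expSubst c r : ℂ)) := by
  have hc' : 0 < c / (2 * π) := by positivity
  rw [Real.fourier_real_eq_integral_exp_smul]
  have h1 : (fun v : ℝ => Complex.exp (((-2 * π * v * p : ℝ) : ℂ) * Complex.I) •
      expPull (c / (2 * π)) F v) = (Set.Ioi 0).indicator (fun v : ℝ =>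
        Complex.exp (((-2 * π * v * p : ℝ) : ℂ) * Complex.I) • expPull (c / (2 * π)) F v) := by
    ext v
    by_cases hv : v ∈ Set.Ioi (0 : ℝ)
    · rw [Set.indicator_of_mem hv]
    · rw [Set.indicator_of_notMem hv, expPull, Set.indicator_of_notMem hv, smul_zero]
  rw [h1, integral_indicator measurableSet_Ioi, integral_Ioi_eq_expSubst hc']
  congr 1
  ext r
  rw [smul_comm, smul_expPull_expSubst hc', smul_eq_mul, mul_comm]
  congr 2
  simp only [expSubst]
  push_cast
  field_simp

/-- The Jacobian `2y` meets the squared density factor `(2y)⁻²`; what remains is `(2y)⁻¹ = e^{2r} /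
(2c)`, hence the weight `e^{2r}`. -/
theorem lintegral_enorm_expPull {c : ℝ} (hc : 0 < c) (F : ℝ → ℂ) :
    ∫⁻ y, ‖expPull c F y‖ₑ ^ 2 =
      ENNReal.ofReal (1 / (2 * c)) * ∫⁻ r, ENNReal.ofReal (exp (2 * r)) * ‖F r‖ₑ ^ 2 := by
  have h1 : (fun y => ‖expPull c F y‖ₑ ^ 2) =
      (Set.Ioi 0).indicator fun y => ‖expPull c F y‖ₑ ^ 2 := by
    ext v
    by_cases hv : v ∈ Set.Ioi (0 : ℝ)
    · rw [Set.indicator_of_mem hv]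
    · rw [Set.indicator_of_notMem hv, expPull, Set.indicator_of_notMem hv]
      simp
  rw [h1, lintegral_indicator measurableSet_Ioi, lintegral_Ioi_eq_expSubst hc,
    ← lintegral_const_mul' _ _ (by simp)]
  congr 1
  ext r
  have hp := expSubst_pos hc r
  rw [expPull_expSubst hc, enorm_smul, mul_pow, ← mul_assoc, ← mul_assoc,
    Real.enorm_of_nonneg (by positivity), ← ENNReal.ofReal_pow (by positivity),
    ← ENNReal.ofReal_mul (by positivity), ← ENNReal.ofReal_mul (by positivity)]
  congr 2
  rw [expSubst, show -2 * r = -(2 * r) by ring, exp_neg]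
  field_simp

theorem aestronglyMeasurable_expMul {F : ℝ → ℂ} (hF : AEStronglyMeasurable F) (w : ℂ) (c : ℝ) :
    AEStronglyMeasurable fun r => F r * Complex.exp (w * (expSubst c r : ℂ)) := by
  refine hF.mul (Continuous.aestronglyMeasurable ?_)
  unfold expSubst
  fun_prop

/-- Plancherel's theorem, in exponential coordinates. -/
theorem lintegral_enorm_integral_exp {c : ℝ} (hc : 0 < c) {F : ℝ → ℂ} (hF : Integrable F)
    (h2 : ∫⁻ r, ENNReal.ofReal (exp (2 * r)) * ‖F r‖ₑ ^ 2 < ⊤) :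
    ∫⁻ p : ℝ, ‖∫ r, F r * Complex.exp (Complex.I * (p : ℂ) * (expSubst c r : ℂ))‖ₑ ^ 2 =
      ENNReal.ofReal (π / c) * ∫⁻ r, ENNReal.ofReal (exp (2 * r)) * ‖F r‖ₑ ^ 2 := by
  have hc' : 0 < c / (2 * π) := by positivity
  have hG := integrable_expPull hc' hF
  have hG2 : MemLp (expPull (c / (2 * π)) F) 2 := by
    rw [memLp_two_iff_lintegral hG.aestronglyMeasurable, lintegral_enorm_expPull hc']
    exact ENNReal.mul_lt_top (by simp) h2
  have h := congrArg (fun t => t ^ 2) (eLpNorm_fourier_eq hG hG2)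
  simp only [eLpNorm_two_sq, lintegral_enorm_expPull hc', fourier_expPull hc] at h
  -- `fourier_expPull` produces the integral at `-p`; reflecting `p` does not change the norm.
  rw [lintegral_neg_eq_self (fun p : ℝ =>
    ‖∫ r, F r * Complex.exp (Complex.I * (p : ℂ) * (expSubst c r : ℂ))‖ₑ ^ 2)] at h
  rw [h]
  congr 2
  field_simp

theorem ae_eq_zero_of_integral_exp_eq_zero {c : ℝ} (hc : 0 < c) {F : ℝ → ℂ} (hF : Integrable F)
    (h : ∀ p : ℝ, ∫ r, F r * Complex.exp (Complex.I * (p : ℂ) * (expSubst c r : ℂ)) = 0) :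
    F =ᵐ[volume] 0 := by
  have hc' : 0 < c / (2 * π) := by positivity
  have hG := ae_eq_zero_of_fourier_eq_zero (integrable_expPull hc' hF)
    fun p => by rw [fourier_expPull hc, h]
  -- The `L²` identity carries almost everywhere vanishing back through the substitution, since both
  -- the constant and the weight `e^{2r}` are positive.
  have h0 : ∫⁻ y, ‖expPull (c / (2 * π)) F y‖ₑ ^ 2 = 0 := by
    rw [lintegral_congr_ae (g := 0) (by filter_upwards [hG] with y hy; simp [hy])]
    simp
  rw [lintegral_enorm_expPull hc', mul_eq_zero, lintegral_eq_zero_iff'] at h0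
  · rcases h0 with h0 | h0
    · rw [ENNReal.ofReal_eq_zero] at h0
      have : 0 < 1 / (2 * (c / (2 * π))) := by positivity
      linarith
    · filter_upwards [h0] with r hr
      have := exp_pos (2 * r)
      simpa [this.not_ge] using hr
  · exact (by fun_prop : Measurable fun r => ENNReal.ofReal (exp (2 * r))).aemeasurable.mul
      (hF.aestronglyMeasurable.enorm.pow_const 2)

end Fourier

/-! ### The weighted `L²` space -/

/-- The measure `e^{2la} da` on the line. -/
abbrev weightedMeasure (l : ℝ) : Measure ℝ :=
  (volume : Measure ℝ).withDensity fun a => ENNReal.ofReal (Real.exp (2 * l * a))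

/-- The density never vanishes, so the null sets are those of Lebesgue measure. All later almost
everywhere statements can therefore be made for `volume`. -/
theorem ae_weightedMeasure_iff (l : ℝ) {p : ℝ → Prop} :
    (∀ᵐ a ∂(weightedMeasure l), p a) ↔ ∀ᵐ a : ℝ, p a := by
  rw [ae_withDensity_iff (by fun_prop)]
  simp [Real.exp_pos]

theorem absolutelyContinuous_weightedMeasure (l : ℝ) : volume ≪ weightedMeasure l :=
  Measure.AbsolutelyContinuous.mk fun s _ h => by
    rw [← compl_compl s, ← mem_ae_iff] at h ⊢
    exact (ae_weightedMeasure_iff l).1 h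

theorem lintegral_weightedMeasure (l : ℝ) (f : ℝ → ENNReal) :
    ∫⁻ a, f a ∂(weightedMeasure l) = ∫⁻ a, ENNReal.ofReal (Real.exp (2 * l * a)) * f a := by
  rw [lintegral_withDensity_eq_lintegral_mul_non_measurable _ (by fun_prop) (by simp)]
  rfl

theorem aestronglyMeasurable_weightedMeasure_iff (l : ℝ) {f : ℝ → ℂ} :
    AEStronglyMeasurable f (weightedMeasure l) ↔ AEStronglyMeasurable f :=
  ⟨fun h => h.mono_ac (absolutelyContinuous_weightedMeasure l),
    fun h => h.mono_ac (withDensity_absolutelyContinuous _ _)⟩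

theorem lintegral_enorm_exp_mul (l : ℝ) (f : ℝ → ℂ) :
    ∫⁻ a, ‖(Real.exp (l * a) : ℂ) * f a‖ₑ ^ 2 = ∫⁻ a, ‖f a‖ₑ ^ 2 ∂(weightedMeasure l) := by
  rw [lintegral_weightedMeasure]
  congr 1
  ext a
  rw [enorm_mul, mul_pow, ← ofReal_norm, Complex.norm_real,
    Real.norm_of_nonneg (Real.exp_pos _).le, ← ENNReal.ofReal_pow (Real.exp_pos _).le,
    ← Real.exp_nat_mul]
  congr 3
  push_cast
  ring

/-- Multiplication by `e^{la}` is an isometry from the weighted to the unweighted space; this brings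
Cauchy–Schwarz on the line into play. -/
theorem memLp_exp_mul_iff (l : ℝ) {f : ℝ → ℂ} (hf : AEStronglyMeasurable f) :
    MemLp (fun a => (Real.exp (l * a) : ℂ) * f a) 2 ↔ MemLp f 2 (weightedMeasure l) := by
  rw [memLp_two_iff_lintegral ((aestronglyMeasurable_weightedMeasure_iff l).2 hf),
    memLp_two_iff_lintegral, lintegral_enorm_exp_mul]
  exact (by fun_prop : Continuous fun a : ℝ => (Real.exp (l * a) : ℂ)).aestronglyMeasurable.mul hf

theorem WeightedL2.aestronglyMeasurable {l : ℝ} (u : WeightedL2 l) :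
    AEStronglyMeasurable (u : ℝ → ℂ) :=
  (aestronglyMeasurable_weightedMeasure_iff l).1 (Lp.aestronglyMeasurable u)

theorem WeightedL2.memLp_exp_mul {l : ℝ} (u : WeightedL2 l) :
    MemLp (fun a => (Real.exp (l * a) : ℂ) * u a) 2 :=
  (memLp_exp_mul_iff l u.aestronglyMeasurable).2 (Lp.memLp u)

theorem WeightedL2.ae_eq_iff {l : ℝ} {f g : ℝ → ℂ} :
    f =ᵐ[weightedMeasure l] g ↔ f =ᵐ[volume] g :=
  ae_weightedMeasure_iff l

theorem WeightedL2.enorm_sq {l : ℝ} (u : WeightedL2 l) :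
    ‖u‖ₑ ^ 2 = ∫⁻ a, ‖u a‖ₑ ^ 2 ∂(weightedMeasure l) := by
  rw [Lp.enorm_def, eLpNorm_two_sq]

/-! ### Gamma integrals in exponential coordinates -/

theorem gamma_integrand_expSubst {c : ℝ} (hc : 0 < c) (a : ℝ) (w : ℂ) (r : ℝ) :
    (2 * expSubst c r) • ((expSubst c r : ℂ) ^ ((a : ℂ) - 1) *
      Complex.exp (-(w * (expSubst c r : ℂ)))) =
      ((2 * c ^ a : ℝ) : ℂ) * ((Real.exp (-2 * a * r) : ℂ) *
        Complex.exp (-(w * (expSubst c r : ℂ)))) := by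
  have hp := expSubst_pos hc r
  have h1 : (expSubst c r : ℂ) ^ ((a : ℂ) - 1) = ((expSubst c r ^ (a - 1) : ℝ) : ℂ) := by
    rw [Complex.ofReal_cpow hp.le]
    push_cast
    rfl
  have h2 : expSubst c r * expSubst c r ^ (a - 1) = c ^ a * Real.exp (-2 * a * r) := by
    rw [Real.rpow_sub hp, Real.rpow_one, mul_div_cancel₀ _ hp.ne', expSubst,
      Real.mul_rpow hc.le (Real.exp_pos _).le, ← Real.exp_mul]
    congr 2
    ring
  rw [h1, Complex.real_smul, ← mul_assoc, ← mul_assoc, ← Complex.ofReal_mul, ← Complex.ofReal_mul]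
  congr 2
  rw [mul_assoc, h2]
  ring

theorem norm_cexp_neg_mul_ofReal (w : ℂ) (x : ℝ) :
    ‖Complex.exp (-(w * (x : ℂ)))‖ = Real.exp (-(w.re * x)) := by
  rw [Complex.norm_exp]
  simp

/-- Differentiation under the integral sign near `w₀`, on `Re w > Re w₀ / 2`. The derivative brings
down a factor `expSubst c r`; one quarter of the decay rate `Re w₀` absorbs it, at the cost of the
constant `4 / Re w₀`, and another quarter is left for integrability. -/
theorem differentiableOn_integral_mul_cexp {c : ℝ} (hc : 0 < c) {F : ℝ → ℂ}
    (hm : AEStronglyMeasurable F)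
    (hF : ∀ y : ℝ, 0 < y → Integrable fun r => (Real.exp (-(y * expSubst c r)) : ℂ) * F r) :
    DifferentiableOn ℂ (fun w : ℂ => ∫ r, Complex.exp (-(w * (expSubst c r : ℂ))) * F r)
      {w | 0 < w.re} := by
  intro w₀ hw₀
  simp only [Set.mem_ofPred_eq] at hw₀
  have hcont : Continuous fun r => (expSubst c r : ℂ) := by
    unfold expSubst
    fun_prop
  have hmeas : ∀ w : ℂ, AEStronglyMeasurable fun r =>
      Complex.exp (-(w * (expSubst c r : ℂ))) * F r := fun w =>
    (by fun_prop : Continuous fun r =>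
      Complex.exp (-(w * (expSubst c r : ℂ)))).aestronglyMeasurable.mul hm
  have hs : {w : ℂ | w₀.re / 2 < w.re} ∈ nhds w₀ :=
    (isOpen_lt continuous_const Complex.continuous_re).mem_nhds (by
      simp only [Set.mem_ofPred_eq]
      linarith)
  have hint : Integrable fun r => Complex.exp (-(w₀ * (expSubst c r : ℂ))) * F r := by
    refine (hF _ hw₀).norm.mono' (hmeas w₀) (Filter.Eventually.of_forall fun r => ?_)
    rw [norm_mul, norm_mul, norm_cexp_neg_mul_ofReal, Complex.norm_real, Real.norm_eq_abs,
      Real.abs_exp]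
  have h := hasDerivAt_integral_of_dominated_loc_of_deriv_le (μ := volume)
    (F := fun w r => Complex.exp (-(w * (expSubst c r : ℂ))) * F r)
    (F' := fun w r => Complex.exp (-(w * (expSubst c r : ℂ))) * (-(expSubst c r : ℂ)) * F r)
    (x₀ := w₀) (bound := fun r => 4 / w₀.re *
      ‖(Real.exp (-(w₀.re / 4 * expSubst c r)) : ℂ) * F r‖) hs
    (Filter.Eventually.of_forall hmeas) hint
    ((by fun_prop : Continuous fun r => Complex.exp (-(w₀ * (expSubst c r : ℂ))) *
      (-(expSubst c r : ℂ))).aestronglyMeasurable.mul hm)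
    (Filter.Eventually.of_forall fun r w hw => ?_)
    ((hF _ (by positivity)).norm.const_mul _)
    (Filter.Eventually.of_forall fun r w hw => ?_)
  · exact h.2.differentiableAt.differentiableWithinAt
  · simp only [Set.mem_ofPred_eq] at hw
    have hp := expSubst_pos hc r
    rw [norm_mul, norm_mul, norm_mul, norm_cexp_neg_mul_ofReal, norm_neg, Complex.norm_real,
      Complex.norm_real, Real.norm_of_nonneg hp.le, Real.norm_eq_abs, Real.abs_exp, ← mul_assoc]
    refine mul_le_mul_of_nonneg_right ?_ (norm_nonneg _)
    have h1 : w₀.re / 4 * expSubst c r ≤ Real.exp (w₀.re / 4 * expSubst c r) := by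
      have := Real.add_one_le_exp (w₀.re / 4 * expSubst c r)
      linarith
    have h2 : Real.exp (-(w.re * expSubst c r)) ≤ Real.exp (-(w₀.re / 4 * expSubst c r)) *
        Real.exp (-(w₀.re / 4 * expSubst c r)) := by
      rw [← Real.exp_add]
      refine Real.exp_le_exp.2 ?_
      nlinarith
    have h3 : expSubst c r * Real.exp (-(w₀.re / 4 * expSubst c r)) ≤ 4 / w₀.re := by
      rw [Real.exp_neg, ← div_eq_mul_inv, div_le_iff₀ (Real.exp_pos _), div_mul_eq_mul_div,
        le_div_iff₀ hw₀]
      linarith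
    calc Real.exp (-(w.re * expSubst c r)) * expSubst c r
        ≤ Real.exp (-(w₀.re / 4 * expSubst c r)) * Real.exp (-(w₀.re / 4 * expSubst c r)) *
          expSubst c r := mul_le_mul_of_nonneg_right h2 hp.le
      _ = expSubst c r * Real.exp (-(w₀.re / 4 * expSubst c r)) *
          Real.exp (-(w₀.re / 4 * expSubst c r)) := by ring
      _ ≤ _ := mul_le_mul_of_nonneg_right h3 (Real.exp_pos _).le
  · have h1 : HasDerivAt (fun w : ℂ => -(w * (expSubst c r : ℂ))) (-(expSubst c r : ℂ)) w := by
      simpa using ((hasDerivAt_id w).mul_const (expSubst c r : ℂ)).fun_neg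
    exact h1.cexp.mul_const _

theorem integral_exp_gamma_ofReal {c : ℝ} (hc : 0 < c) {a : ℝ} (ha : 0 < a) {y : ℝ}
    (hy : 0 < y) :
    ((2 * c ^ a : ℝ) : ℂ) * ∫ r : ℝ, (Real.exp (-2 * a * r) : ℂ) *
      Complex.exp (-((y : ℂ) * (expSubst c r : ℂ))) = (1 / (y : ℂ)) ^ (a : ℂ) * Real.Gamma a := by
  have h := Complex.integral_cpow_mul_exp_neg_mul_Ioi (a := (a : ℂ)) (r := y) (by simpa) hy
  rw [integral_Ioi_eq_expSubst hc] at h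
  simp only [gamma_integrand_expSubst hc] at h
  rw [integral_const_mul] at h
  rw [h, Complex.Gamma_ofReal]

theorem integrable_exp_gamma {c : ℝ} (hc : 0 < c) {a : ℝ} (ha : 0 < a) {w : ℂ} (hw : 0 < w.re) :
    Integrable fun r : ℝ => (Real.exp (-2 * a * r) : ℂ) *
      Complex.exp (-(w * (expSubst c r : ℂ))) := by
  have h0 : Integrable fun r : ℝ => (Real.exp (-2 * a * r) : ℂ) *
      Complex.exp (-((w.re : ℂ) * (expSubst c r : ℂ))) := by
    -- Integrability is read off from the value: a non-integrable function would have integral 0,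
    -- whereas the Gamma integral is nonzero.
    by_contra h
    have h1 := integral_exp_gamma_ofReal hc ha hw
    rw [integral_undef h, mul_zero] at h1
    have hw0 : 1 / (w.re : ℂ) ≠ 0 := one_div_ne_zero (Complex.ofReal_ne_zero.2 hw.ne')
    have := mul_ne_zero ((Complex.cpow_ne_zero_iff_of_exponent_ne_zero
      (y := (a : ℂ)) (by exact_mod_cast ha.ne')).2 hw0)
      (Complex.ofReal_ne_zero.2 (Real.Gamma_pos_of_pos ha).ne')
    exact this h1.symm
  refine h0.norm.mono' (Continuous.aestronglyMeasurable ?_) (Filter.Eventually.of_forall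
    fun r => ?_)
  · unfold expSubst
    fun_prop
  · rw [norm_mul, norm_mul, norm_cexp_neg_mul_ofReal, norm_cexp_neg_mul_ofReal, Complex.ofReal_re]

/-- Analytic continuation from the positive real axis. Since `1/w` stays in the right half-plane,
the principal power is holomorphic there, and both sides agree at real points accumulating at 1. -/
theorem integral_exp_gamma {c : ℝ} (hc : 0 < c) {a : ℝ} (ha : 0 < a) {w : ℂ} (hw : 0 < w.re) :
    ((2 * c ^ a : ℝ) : ℂ) * ∫ r : ℝ, (Real.exp (-2 * a * r) : ℂ) *
      Complex.exp (-(w * (expSubst c r : ℂ))) = (1 / w) ^ (a : ℂ) * (Real.Gamma a : ℂ) := by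
  have hopen : IsOpen {w : ℂ | 0 < w.re} := isOpen_lt continuous_const Complex.continuous_re
  have h1 : AnalyticOnNhd ℂ (fun w : ℂ => ((2 * c ^ a : ℝ) : ℂ) *
      ∫ r : ℝ, (Real.exp (-2 * a * r) : ℂ) * Complex.exp (-(w * (expSubst c r : ℂ))))
      {w | 0 < w.re} := by
    refine DifferentiableOn.analyticOnNhd (DifferentiableOn.const_mul ?_ _) hopen
    simp only [mul_comm (Complex.ofReal (Real.exp _))]
    refine differentiableOn_integral_mul_cexp hc
      (by fun_prop : Continuous fun r : ℝ =>
        (Real.exp (-2 * a * r) : ℂ)).aestronglyMeasurable fun y hy => ?_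
    refine (integrable_exp_gamma hc ha (w := (y : ℂ)) (by simpa)).congr
      (Filter.Eventually.of_forall fun r => ?_)
    simp only
    rw [mul_comm]
    push_cast
    rfl
  have h2 : AnalyticOnNhd ℂ (fun w : ℂ => (1 / w) ^ (a : ℂ) * (Real.Gamma a : ℂ))
      {w | 0 < w.re} := by
    refine DifferentiableOn.analyticOnNhd (DifferentiableOn.mul_const ?_ _) hopen
    intro w hw
    simp only [Set.mem_ofPred_eq] at hw
    have hw0 : w ≠ 0 := by
      rintro rfl
      simp at hw
    refine ((differentiableAt_const _).div differentiableAt_id hw0).differentiableWithinAt.cpow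
      (differentiableWithinAt_const _) (Or.inl ?_)
    change 0 < (1 / w).re
    rw [one_div, Complex.inv_re]
    have := Complex.normSq_pos.2 hw0
    positivity
  have hconv : IsPreconnected {w : ℂ | 0 < w.re} :=
    (convex_halfSpace_re_gt 0).isPreconnected
  refine h1.eqOn_of_preconnected_of_frequently_eq h2 hconv (z₀ := 1) (by simp) ?_ hw
  have ht : Filter.Tendsto (fun n : ℕ => ((1 + 1 / ((n : ℝ) + 1) : ℝ) : ℂ)) Filter.atTop
      (nhdsWithin 1 {1}ᶜ) := by
    refine tendsto_nhdsWithin_iff.2 ⟨?_, Filter.Eventually.of_forall fun n => ?_⟩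
    · have := (tendsto_one_div_add_atTop_nhds_zero_nat (𝕜 := ℝ)).const_add 1
      rw [add_zero] at this
      have h3 := (Complex.continuous_ofReal.tendsto 1).comp this
      rwa [Complex.ofReal_one] at h3
    · rw [Set.mem_compl_singleton_iff]
      intro h3
      have h4 : (1 + 1 / ((n : ℝ) + 1) : ℝ) = 1 := by exact_mod_cast h3
      have : 0 < 1 / ((n : ℝ) + 1) := by positivity
      linarith
  refine ht.frequently (Filter.Frequently.of_forall fun n => ?_)
  exact integral_exp_gamma_ofReal hc ha (by positivity)

/-- Squaring the modulus gives the Gamma integrand with both parameters doubled. -/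
theorem memLp_two_exp_gamma {c : ℝ} (hc : 0 < c) {a : ℝ} (ha : 0 < a) {y : ℝ} (hy : 0 < y) :
    MemLp (fun r : ℝ => (Real.exp (-2 * a * r) : ℂ) * (Real.exp (-(y * expSubst c r)) : ℂ)) 2 := by
  have hm : Continuous fun r : ℝ =>
      (Real.exp (-2 * a * r) : ℂ) * (Real.exp (-(y * expSubst c r)) : ℂ) := by
    unfold expSubst
    fun_prop
  rw [memLp_two_iff_integrable_sq_norm hm.aestronglyMeasurable]
  have h := (integrable_exp_gamma hc (a := 2 * a) (by positivity) (w := ((2 * y : ℝ) : ℂ))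
    (by rw [Complex.ofReal_re]; positivity)).norm
  refine h.congr (Filter.Eventually.of_forall fun r => ?_)
  simp only [norm_mul, Complex.norm_exp, Complex.norm_real, Real.norm_eq_abs, Real.abs_exp,
    Complex.neg_re, Complex.re_ofReal_mul, Complex.ofReal_re]
  rw [mul_pow, ← Real.exp_nat_mul, ← Real.exp_nat_mul]
  push_cast
  congr 2 <;> ring

/-- Cauchy–Schwarz after splitting `e^{(l-2a)r} = e^{-2ar} e^{lr}`. This is the absolute convergence
of the Laplace-type integral. -/
theorem WeightedL2.integrable_exp_mul {l : ℝ} (u : WeightedL2 l) {c : ℝ} (hc : 0 < c) {a : ℝ}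
    (ha : 0 < a) {y : ℝ} (hy : 0 < y) :
    Integrable fun r : ℝ => (Real.exp ((l - 2 * a) * r) : ℂ) *
      (Real.exp (-(y * expSubst c r)) : ℂ) * u r := by
  refine ((memLp_two_exp_gamma hc ha hy).integrable_mul u.memLp_exp_mul).congr
    (Filter.Eventually.of_forall fun r => ?_)
  simp only [Pi.mul_apply]
  rw [show (l - 2 * a) * r = -2 * a * r + l * r by ring, Real.exp_add]
  push_cast
  ring

theorem lintegral_rpow_mul_exp {a b : ℝ} (ha : 0 < a) (hb : 0 < b) :
    ∫⁻ y in Set.Ioi 0, ENNReal.ofReal (y ^ (a - 1)) * ENNReal.ofReal (Real.exp (-(b * y))) =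
      ENNReal.ofReal (b ^ (-a) * Real.Gamma a) := by
  have h := Real.integral_rpow_mul_exp_neg_mul_Ioi ha hb
  have hne : (1 / b) ^ a * Real.Gamma a ≠ 0 := by
    have := Real.Gamma_pos_of_pos ha
    positivity
  have hi : IntegrableOn (fun t : ℝ => t ^ (a - 1) * Real.exp (-(b * t))) (Set.Ioi 0) := by
    by_contra hn
    rw [integral_undef hn] at h
    exact hne h.symm
  rw [show b ^ (-a) = (1 / b) ^ a by rw [one_div, Real.inv_rpow hb.le, Real.rpow_neg hb.le], ← h,
    ofReal_integral_eq_lintegral_ofReal hi]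
  · refine setLIntegral_congr_fun measurableSet_Ioi fun y hy => ?_
    rw [ENNReal.ofReal_mul (Real.rpow_nonneg (le_of_lt hy) _)]
  · filter_upwards [ae_restrict_mem measurableSet_Ioi] with y hy
    exact mul_nonneg (Real.rpow_nonneg (le_of_lt hy) _) (Real.exp_pos _).le

/-! ### Integration over the upper half-plane -/

theorem lintegral_comap_coe (f : ℍ → ENNReal) :
    ∫⁻ z, f z ∂((volume : Measure ℂ).comap UpperHalfPlane.coe) =
      ∫⁻ z in {z : ℂ | 0 < z.im}, f (UpperHalfPlane.ofComplex z) := by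
  have h := UpperHalfPlane.measurableEmbedding_coe.lintegral_map
    (μ := (volume : Measure ℂ).comap UpperHalfPlane.coe)
    (fun z => f (UpperHalfPlane.ofComplex z))
  rw [UpperHalfPlane.measurableEmbedding_coe.map_comap, UpperHalfPlane.range_coe] at h
  simp only [UpperHalfPlane.ofComplex_apply] at h
  exact h.symm

theorem measurable_ofComplex_comp {f : ℍ → ENNReal} (hf : Measurable f) :
    Measurable ({z : ℂ | 0 < z.im}.indicator fun z => f (UpperHalfPlane.ofComplex z)) := by
  have h := UpperHalfPlane.measurableEmbedding_coe.measurable_extend hf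
    (measurable_const (a := (0 : ENNReal)))
  convert h using 1
  ext z
  by_cases hz : 0 < z.im
  · rw [Set.indicator_of_mem (show z ∈ {z : ℂ | 0 < z.im} from hz)]
    lift z to ℍ using hz
    rw [UpperHalfPlane.ofComplex_apply, UpperHalfPlane.coe_injective.extend_apply]
  · rw [Set.indicator_of_notMem (show z ∉ {z : ℂ | 0 < z.im} from hz),
      Function.extend_apply']
    rintro ⟨w, rfl⟩
    exact hz w.im_pos

theorem measurable_im_rpow (s : ℝ) :
    Measurable fun z : ℍ => ENNReal.ofReal (z.im ^ s) := by
  have := UpperHalfPlane.continuous_im.measurable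
  fun_prop

theorem lintegral_bergmanMeasure {s : ℝ} {f : ℍ → ENNReal} (hf : Measurable f) :
    ∫⁻ z, f z ∂(bergmanMeasure s) = ∫⁻ y in Set.Ioi 0, ENNReal.ofReal (y ^ (2 * s - 2)) *
      ∫⁻ p : ℝ, f (UpperHalfPlane.ofComplex (⟨p, y⟩ : ℂ)) := by
  have hm := (measurable_im_rpow (2 * s - 2)).mul hf
  rw [bergmanMeasure, lintegral_withDensity_eq_lintegral_mul _ (measurable_im_rpow _) hf,
    lintegral_comap_coe, ← lintegral_indicator UpperHalfPlane.isOpen_upperHalfPlaneSet.measurableSet,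
    ← (Complex.volume_preserving_equiv_real_prod.symm).lintegral_comp
      (measurable_ofComplex_comp hm), Measure.volume_eq_prod,
    lintegral_prod_symm' _ (by exact ((measurable_ofComplex_comp hm).comp
      Complex.measurableEquivRealProd.symm.measurable)), ← lintegral_indicator measurableSet_Ioi]
  congr 1
  ext y
  by_cases hy : 0 < y
  · rw [Set.indicator_of_mem (Set.mem_Ioi.2 hy), ← lintegral_const_mul' _ _ (by simp)]
    congr 1
    ext p
    rw [Complex.measurableEquivRealProd_symm_apply, Set.indicator_of_mem (by exact hy)]
    simp [UpperHalfPlane.ofComplex_apply_of_im_pos (z := (⟨p, y⟩ : ℂ)) hy]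
  · rw [Set.indicator_of_notMem (by exact hy)]
    convert lintegral_zero with p
    rw [Complex.measurableEquivRealProd_symm_apply, Set.indicator_of_notMem (by exact hy)]

/-! ### The Laplace-type map -/

theorem one_lt_dsParam {θ : ℝ} (hθ : 0 < θ) : 1 < dsParam θ := by
  rw [dsParam, lt_div_iff₀ hθ]
  linarith

/-- The modulus part of the Laplace-type integrand, at height `y`. -/
def laplaceWeight (θ l : ℝ) (u : ℝ → ℂ) (y r : ℝ) : ℂ :=
  (Real.exp ((l - 2 * dsParam θ) * r) : ℂ) * (Real.exp (-(y * expSubst θ⁻¹ r)) : ℂ) * u r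

/-- With `w = -iz` the upper half-plane becomes `Re w > 0`, where the Gamma formulas apply. -/
theorem laplaceIntegrand_eq_cexp (θ l : ℝ) (u : ℝ → ℂ) (z : ℍ) (r : ℝ) :
    laplaceIntegrand θ l u z r = Complex.exp (-((-Complex.I * z) * (expSubst θ⁻¹ r : ℂ))) *
      ((Real.exp ((l - 2 * dsParam θ) * r) : ℂ) * u r) := by
  rw [laplaceIntegrand, mul_comm (Complex.ofReal _), mul_assoc]
  congr 2
  simp only [expSubst]
  push_cast
  ring

/-- The oscillating factor is isolated so that, on a horizontal line, the transform becomes a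
Fourier integral in `Re z` with a density depending only on the height. -/
theorem laplaceIntegrand_eq_weight (θ l : ℝ) (u : ℝ → ℂ) (z : ℍ) (r : ℝ) :
    laplaceIntegrand θ l u z r = laplaceWeight θ l u z.im r *
      Complex.exp (Complex.I * (z.re : ℂ) * (expSubst θ⁻¹ r : ℂ)) := by
  have h : Complex.exp (-((-Complex.I * z) * (expSubst θ⁻¹ r : ℂ))) =
      (Real.exp (-(z.im * expSubst θ⁻¹ r)) : ℂ) *
        Complex.exp (Complex.I * (z.re : ℂ) * (expSubst θ⁻¹ r : ℂ)) := by
    rw [Complex.ofReal_exp, ← Complex.exp_add]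
    congr 1
    push_cast
    linear_combination (-Complex.I * (expSubst θ⁻¹ r : ℂ)) * z.re_add_im +
      (z.im : ℂ) * (expSubst θ⁻¹ r : ℂ) * Complex.I_mul_I
  rw [laplaceIntegrand_eq_cexp, laplaceWeight, h]
  ring

theorem norm_laplaceIntegrand (θ l : ℝ) (u : ℝ → ℂ) (z : ℍ) (r : ℝ) :
    ‖laplaceIntegrand θ l u z r‖ = ‖laplaceWeight θ l u z.im r‖ := by
  rw [laplaceIntegrand_eq_weight, norm_mul, Complex.norm_exp]
  simp

section

variable {θ l : ℝ}

theorem aestronglyMeasurable_laplaceWeight {u : ℝ → ℂ} (hu : AEStronglyMeasurable u) (y : ℝ) :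
    AEStronglyMeasurable (laplaceWeight θ l u y) := by
  refine (Continuous.aestronglyMeasurable ?_).mul hu
  unfold expSubst
  fun_prop

theorem aestronglyMeasurable_laplaceIntegrand {u : ℝ → ℂ} (hu : AEStronglyMeasurable u) (z : ℍ) :
    AEStronglyMeasurable (laplaceIntegrand θ l u z) := by
  have : laplaceIntegrand θ l u z = fun r => laplaceWeight θ l u z.im r *
      Complex.exp (Complex.I * (z.re : ℂ) * (expSubst θ⁻¹ r : ℂ)) :=
    funext (laplaceIntegrand_eq_weight θ l u z)
  rw [this]
  exact aestronglyMeasurable_expMul (aestronglyMeasurable_laplaceWeight hu _) _ _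

theorem integrable_laplaceWeight (hθ : 0 < θ) (u : WeightedL2 l) {y : ℝ} (hy : 0 < y) :
    Integrable (laplaceWeight θ l u y) :=
  u.integrable_exp_mul (inv_pos.2 hθ) (by linarith [one_lt_dsParam hθ]) hy

theorem integrable_laplaceIntegrand (hθ : 0 < θ) (u : WeightedL2 l) (z : ℍ) :
    Integrable (laplaceIntegrand θ l u z) :=
  (integrable_laplaceWeight hθ u z.im_pos).norm.mono'
    (aestronglyMeasurable_laplaceIntegrand u.aestronglyMeasurable z)
    (Filter.Eventually.of_forall fun r => (norm_laplaceIntegrand θ l u z r).le)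

/-- The Laplace-type transform. -/
def laplaceTransform (θ l : ℝ) (u : ℝ → ℂ) (z : ℍ) : ℂ :=
  ∫ q, laplaceIntegrand θ l u z q

theorem laplaceIntegrand_congr {u v : ℝ → ℂ} (h : u =ᵐ[volume] v) (z : ℍ) :
    laplaceIntegrand θ l u z =ᵐ[volume] laplaceIntegrand θ l v z := by
  filter_upwards [h] with r hr
  simp only [laplaceIntegrand, hr]

theorem laplaceTransform_congr {u v : ℝ → ℂ} (h : u =ᵐ[volume] v) (z : ℍ) :
    laplaceTransform θ l u z = laplaceTransform θ l v z :=
  integral_congr_ae (laplaceIntegrand_congr h z)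

theorem mdifferentiable_laplaceTransform (hθ : 0 < θ) (u : WeightedL2 l) :
    MDifferentiable 𝓘(ℂ) 𝓘(ℂ) (laplaceTransform θ l u) := by
  rw [UpperHalfPlane.mdifferentiable_iff]
  have h1 := differentiableOn_integral_mul_cexp (inv_pos.2 hθ)
    (F := fun r => (Real.exp ((l - 2 * dsParam θ) * r) : ℂ) * u r)
    ((by fun_prop : Continuous fun r : ℝ =>
      (Real.exp ((l - 2 * dsParam θ) * r) : ℂ)).aestronglyMeasurable.mul u.aestronglyMeasurable)
    fun y hy => (integrable_laplaceWeight hθ u hy).congr (Filter.Eventually.of_forall fun r => by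
      simp only [laplaceWeight]
      ring)
  have h2 : DifferentiableOn ℂ (fun z : ℂ => -Complex.I * z) {z | 0 < z.im} :=
    (differentiable_id.const_mul _).differentiableOn
  refine (h1.comp h2 fun z hz => ?_).congr fun z hz => ?_
  · simpa using hz
  · lift z to ℍ using hz
    simp only [Function.comp_apply, UpperHalfPlane.ofComplex_apply, laplaceTransform,
      laplaceIntegrand_eq_cexp]

/-- This is `t ≤ e^t` at `t = bx/a`, raised to the power `a`; the sharp constant is not needed. -/
theorem rpow_mul_exp_neg_le {a b x : ℝ} (ha : 0 < a) (hb : 0 < b) (hx : 0 < x) :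
    x ^ a * Real.exp (-(b * x)) ≤ (a / b) ^ a := by
  have h1 : b * x / a ≤ Real.exp (b * x / a) := by
    have := Real.add_one_le_exp (b * x / a)
    linarith
  have h2 : (b * x / a) ^ a ≤ Real.exp (b * x) := by
    refine (Real.rpow_le_rpow (by positivity) h1 ha.le).trans_eq ?_
    rw [← Real.exp_mul, div_mul_cancel₀ _ ha.ne']
  rw [Real.exp_neg, ← div_eq_mul_inv, div_le_iff₀ (Real.exp_pos _)]
  calc x ^ a = (a / b) ^ a * (b * x / a) ^ a := by
        rw [← Real.mul_rpow (by positivity) (by positivity)]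
        congr 1
        field_simp
    _ ≤ _ := mul_le_mul_of_nonneg_left h2 (by positivity)

theorem enorm_ofReal_exp (x : ℝ) : ‖(Real.exp x : ℂ)‖ₑ = ENNReal.ofReal (Real.exp x) := by
  rw [← ofReal_norm, Complex.norm_real, Real.norm_eq_abs, Real.abs_exp]

theorem enorm_laplaceWeight_sq (u : ℝ → ℂ) (y r : ℝ) :
    ‖laplaceWeight θ l u y r‖ₑ ^ 2 = ENNReal.ofReal (Real.exp (2 * ((l - 2 * dsParam θ) * r))) *
      ENNReal.ofReal (Real.exp (-(2 * expSubst θ⁻¹ r * y))) * ‖u r‖ₑ ^ 2 := by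
  rw [laplaceWeight, enorm_mul, enorm_mul, enorm_ofReal_exp, enorm_ofReal_exp, mul_pow, mul_pow,
    ← ENNReal.ofReal_pow (Real.exp_pos _).le, ← ENNReal.ofReal_pow (Real.exp_pos _).le,
    ← Real.exp_nat_mul, ← Real.exp_nat_mul]
  congr 5
  push_cast
  ring

theorem exp_eq_expSubst_rpow (hθ : 0 < θ) (a r : ℝ) :
    Real.exp (-2 * a * r) = θ ^ a * expSubst θ⁻¹ r ^ a := by
  rw [expSubst, Real.mul_rpow (inv_pos.2 hθ).le (Real.exp_pos _).le, ← Real.exp_mul,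
    Real.inv_rpow hθ.le, ← mul_assoc, mul_inv_cancel₀ (by positivity), one_mul]
  congr 1
  ring

/-- Finiteness needed to apply Plancherel at height `y`. Relative to `e^{2lr} |u|²` the weight is a
power of `expSubst θ⁻¹ r` times a decaying exponential of it, hence bounded for each fixed `y > 0`.
-/
theorem lintegral_laplaceWeight_lt_top (hθ : 0 < θ) (u : WeightedL2 l) {y : ℝ} (hy : 0 < y) :
    ∫⁻ r, ENNReal.ofReal (Real.exp (2 * r)) * ‖laplaceWeight θ l u y r‖ₑ ^ 2 < ⊤ := by
  have hs := one_lt_dsParam hθ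
  set s := dsParam θ with hsdef
  have hu : ∫⁻ a, ‖u a‖ₑ ^ 2 ∂(weightedMeasure l) < ⊤ := by
    rw [← u.enorm_sq]
    simp
  rw [lintegral_weightedMeasure] at hu
  refine lt_of_le_of_lt (lintegral_mono (g := fun r =>
    ENNReal.ofReal (θ ^ (2 * s - 1) * ((2 * s - 1) / (2 * y)) ^ (2 * s - 1)) *
      (ENNReal.ofReal (Real.exp (2 * l * r)) * ‖u r‖ₑ ^ 2)) fun r => ?_) ?_
  · rw [enorm_laplaceWeight_sq, ← hsdef]
    simp only [← mul_assoc]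
    refine mul_le_mul' ?_ le_rfl
    rw [← ENNReal.ofReal_mul (Real.exp_pos _).le, ← ENNReal.ofReal_mul (by positivity),
      ← ENNReal.ofReal_mul (by
        have : 0 < 2 * s - 1 := by linarith
        positivity)]
    refine ENNReal.ofReal_le_ofReal ?_
    have h1 : Real.exp (2 * r) * Real.exp (2 * (l - 2 * s) * r) =
        Real.exp (-2 * (2 * s - 1) * r) * Real.exp (2 * l * r) := by
      rw [← Real.exp_add, ← Real.exp_add]
      congr 1
      ring
    rw [h1, exp_eq_expSubst_rpow hθ]
    have h2 := rpow_mul_exp_neg_le (a := 2 * s - 1) (b := 2 * y) (by linarith) (by positivity)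
      (expSubst_pos (inv_pos.2 hθ) r)
    rw [show 2 * y * expSubst θ⁻¹ r = 2 * expSubst θ⁻¹ r * y by ring] at h2
    calc _ = θ ^ (2 * s - 1) * (expSubst θ⁻¹ r ^ (2 * s - 1) *
          Real.exp (-(2 * expSubst θ⁻¹ r * y))) * Real.exp (2 * l * r) := by ring
      _ ≤ _ := by gcongr
  · rw [lintegral_const_mul' _ _ ENNReal.ofReal_ne_top]
    exact ENNReal.mul_lt_top ENNReal.ofReal_lt_top hu

/-- The constant by which the Laplace-type map scales squared norms. -/
def laplaceConst (θ : ℝ) : ℝ :=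
  2 * Real.pi * Real.Gamma (2 * dsParam θ - 1) * (θ / 2) ^ (2 * dsParam θ)

theorem laplaceConst_pos (hθ : 0 < θ) : 0 < laplaceConst θ := by
  have := Real.Gamma_pos_of_pos (s := 2 * dsParam θ - 1) (by linarith [one_lt_dsParam hθ])
  have := Real.pi_pos
  unfold laplaceConst
  positivity

/-- The origin of the constant. Plancherel contributes `πθ`, and the height integral contributes
`Γ(2s-1) (2E)^{-(2s-1)}` with `E = e^{-2r}/θ`. The power of `E` cancels `e^{-2(2s-1)r}` and leaves
`(θ/2)^{2s-1}`. -/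
theorem lintegral_laplaceWeight_height (hθ : 0 < θ) (u : ℝ → ℂ) (r : ℝ) :
    ∫⁻ y in Set.Ioi 0, ENNReal.ofReal (y ^ (2 * dsParam θ - 2)) *
      (ENNReal.ofReal (Real.pi / θ⁻¹) *
        (ENNReal.ofReal (Real.exp (2 * r)) * ‖laplaceWeight θ l u y r‖ₑ ^ 2)) =
    ENNReal.ofReal (laplaceConst θ) * (ENNReal.ofReal (Real.exp (2 * l * r)) * ‖u r‖ₑ ^ 2) := by
  have hs := one_lt_dsParam hθ
  have hx := expSubst_pos (inv_pos.2 hθ) r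
  set s := dsParam θ with hsdef
  have h1 : ∀ y, ENNReal.ofReal (y ^ (2 * s - 2)) * (ENNReal.ofReal (Real.pi / θ⁻¹) *
        (ENNReal.ofReal (Real.exp (2 * r)) * ‖laplaceWeight θ l u y r‖ₑ ^ 2)) =
      ENNReal.ofReal (y ^ ((2 * s - 1) - 1)) *
        ENNReal.ofReal (Real.exp (-(2 * expSubst θ⁻¹ r * y))) *
      (ENNReal.ofReal (Real.pi / θ⁻¹) * ENNReal.ofReal (Real.exp (2 * r)) *
        ENNReal.ofReal (Real.exp (2 * ((l - 2 * s) * r))) * ‖u r‖ₑ ^ 2) := fun y => by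
    rw [enorm_laplaceWeight_sq, ← hsdef, show 2 * s - 1 - 1 = 2 * s - 2 by ring]
    ring
  simp only [h1]
  rw [lintegral_mul_const' _ _ (by finiteness),
    lintegral_rpow_mul_exp (by linarith) (by positivity)]
  have hG := Real.Gamma_pos_of_pos (s := 2 * s - 1) (by linarith)
  have hpi := Real.pi_pos
  simp only [← mul_assoc]
  congr 1
  rw [← ENNReal.ofReal_mul (by positivity), ← ENNReal.ofReal_mul (by positivity),
    ← ENNReal.ofReal_mul (by positivity), ← ENNReal.ofReal_mul (laplaceConst_pos hθ).le]
  congr 1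
  have h2 : Real.exp (2 * r) * Real.exp (2 * (l - 2 * s) * r) =
      Real.exp (-2 * (2 * s - 1) * r) * Real.exp (2 * l * r) := by
    rw [← Real.exp_add, ← Real.exp_add]
    congr 1
    ring
  have h3 : (2 * expSubst θ⁻¹ r) ^ (-(2 * s - 1)) * Real.exp (-2 * (2 * s - 1) * r) =
      (θ / 2) ^ (2 * s - 1) := by
    rw [exp_eq_expSubst_rpow hθ, Real.mul_rpow (by norm_num) hx.le, Real.rpow_neg hx.le,
      Real.rpow_neg (by norm_num), Real.div_rpow hθ.le (by norm_num)]
    have : expSubst θ⁻¹ r ^ (2 * s - 1) ≠ 0 := by positivity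
    generalize expSubst θ⁻¹ r ^ (2 * s - 1) = x at this ⊢
    field_simp
  have h4 : (θ / 2) ^ (2 * s) = (θ / 2) ^ (2 * s - 1) * (θ / 2) := by
    rw [Real.rpow_sub (by positivity), Real.rpow_one, div_mul_cancel₀ _ (by positivity)]
  rw [laplaceConst, ← hsdef, h4, ← h3, div_inv_eq_mul]
  generalize Real.exp (2 * (l - 2 * s) * r) = e at h2 ⊢
  linear_combination ((2 * expSubst θ⁻¹ r) ^ (-(2 * s - 1)) * Real.Gamma (2 * s - 1) *
    (Real.pi * θ)) * h2

/-- Plancherel on every horizontal line, then Tonelli: the height is integrated first, with `r`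
fixed. -/
theorem lintegral_laplaceTransform (hθ : 0 < θ) (u : WeightedL2 l) :
    ∫⁻ z, ‖laplaceTransform θ l u z‖ₑ ^ 2 ∂(bergmanMeasure (dsParam θ)) =
      ENNReal.ofReal (laplaceConst θ) * ‖u‖ₑ ^ 2 := by
  have hcont := (mdifferentiable_laplaceTransform hθ u).continuous
  rw [lintegral_bergmanMeasure (hcont.measurable.enorm.pow_const 2)]
  have h1 : ∀ y ∈ Set.Ioi (0 : ℝ), ENNReal.ofReal (y ^ (2 * dsParam θ - 2)) *
      ∫⁻ p : ℝ, ‖laplaceTransform θ l u (UpperHalfPlane.ofComplex (⟨p, y⟩ : ℂ))‖ₑ ^ 2 =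
      ∫⁻ r, ENNReal.ofReal (y ^ (2 * dsParam θ - 2)) * (ENNReal.ofReal (Real.pi / θ⁻¹) *
        (ENNReal.ofReal (Real.exp (2 * r)) * ‖laplaceWeight θ l u y r‖ₑ ^ 2)) := fun y hy => by
    rw [lintegral_const_mul' _ _ ENNReal.ofReal_ne_top,
      lintegral_const_mul' _ _ ENNReal.ofReal_ne_top,
      ← lintegral_enorm_integral_exp (inv_pos.2 hθ) (integrable_laplaceWeight hθ u hy)
        (lintegral_laplaceWeight_lt_top hθ u hy)]
    congr 2
    ext p
    rw [UpperHalfPlane.ofComplex_apply_of_im_pos (z := (⟨p, y⟩ : ℂ)) hy, laplaceTransform]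
    simp only [laplaceIntegrand_eq_weight]
    rfl
  rw [setLIntegral_congr_fun measurableSet_Ioi h1, lintegral_lintegral_swap]
  · simp only [lintegral_laplaceWeight_height hθ]
    rw [lintegral_const_mul' _ _ ENNReal.ofReal_ne_top, u.enorm_sq, lintegral_weightedMeasure]
  · have hu := (Lp.stronglyMeasurable u).measurable
    refine Measurable.aemeasurable ?_
    unfold laplaceWeight expSubst
    fun_prop

end

/-! ### The Laplace-type map as a map into the weighted Bergman space -/

section

variable {θ l : ℝ}

theorem memLp_laplaceTransform (hθ : 0 < θ) (u : WeightedL2 l) :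
    MemLp (laplaceTransform θ l u) 2 (bergmanMeasure (dsParam θ)) := by
  rw [memLp_two_iff_lintegral
    (mdifferentiable_laplaceTransform hθ u).continuous.aestronglyMeasurable,
    lintegral_laplaceTransform hθ]
  finiteness

theorem laplaceTransform_add (hθ : 0 < θ) (u v : WeightedL2 l) (z : ℍ) :
    laplaceTransform θ l (u + v : WeightedL2 l) z =
      laplaceTransform θ l u z + laplaceTransform θ l v z := by
  rw [laplaceTransform_congr (WeightedL2.ae_eq_iff.1 (Lp.coeFn_add u v)), laplaceTransform,
    laplaceTransform, laplaceTransform, ← integral_add (integrable_laplaceIntegrand hθ u z)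
      (integrable_laplaceIntegrand hθ v z)]
  simp only [laplaceIntegrand, Pi.add_apply, mul_add]

theorem laplaceTransform_smul (c : ℂ) (u : WeightedL2 l) (z : ℍ) :
    laplaceTransform θ l (c • u : WeightedL2 l) z = c * laplaceTransform θ l u z := by
  rw [laplaceTransform_congr (WeightedL2.ae_eq_iff.1 (Lp.coeFn_smul c u)), laplaceTransform,
    laplaceTransform, ← integral_const_mul]
  simp only [laplaceIntegrand, Pi.smul_apply, smul_eq_mul]
  congr 1
  ext q
  ring

/-- The Laplace-type map, as a linear map into the weighted Bergman space. -/
def laplaceMap (hθ : 0 < θ) (l : ℝ) : WeightedL2 l →ₗ[ℂ] bergmanSpace (dsParam θ) where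
  toFun u := ⟨laplaceTransform θ l u, mdifferentiable_laplaceTransform hθ u,
    memLp_laplaceTransform hθ u⟩
  map_add' u v := by
    ext z
    exact laplaceTransform_add hθ u v z
  map_smul' c u := by
    ext z
    exact laplaceTransform_smul c u z

@[simp] theorem coe_laplaceMap (hθ : 0 < θ) (u : WeightedL2 l) :
    (laplaceMap hθ l u : ℍ → ℂ) = laplaceTransform θ l u := rfl

/-- The weighted Bergman space in `L²`. -/
def bergmanToLp (s : ℝ) : bergmanSpace s →ₗ[ℂ] Lp ℂ 2 (bergmanMeasure s) where
  toFun h := MemLp.toLp (h : ℍ → ℂ) h.2.2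
  map_add' _ _ := rfl
  map_smul' _ _ := rfl

theorem coeFn_bergmanToLp {s : ℝ} (h : bergmanSpace s) :
    (bergmanToLp s h : ℍ → ℂ) =ᵐ[bergmanMeasure s] (h : ℍ → ℂ) :=
  MemLp.coeFn_toLp h.2.2

theorem bergmanInner_eq {s : ℝ} (h₁ h₂ : bergmanSpace s) :
    bergmanInner s (h₁ : ℍ → ℂ) (h₂ : ℍ → ℂ) = ⟪bergmanToLp s h₁, bergmanToLp s h₂⟫_ℂ := by
  rw [L2.inner_def, bergmanInner]
  refine integral_congr_ae ?_
  filter_upwards [coeFn_bergmanToLp h₁, coeFn_bergmanToLp h₂] with z h1 h2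
  rw [h1, h2, RCLike.inner_apply, mul_comm]

theorem norm_bergmanToLp_sq {s : ℝ} (h : bergmanSpace s) :
    ENNReal.ofReal (‖bergmanToLp s h‖ ^ 2) = ∫⁻ z, ‖(h : ℍ → ℂ) z‖ₑ ^ 2 ∂(bergmanMeasure s) := by
  rw [ENNReal.ofReal_pow (norm_nonneg _), ofReal_norm, Lp.enorm_def, eLpNorm_two_sq]
  refine lintegral_congr_ae ?_
  filter_upwards [coeFn_bergmanToLp h] with z h1
  rw [h1]

theorem norm_laplaceMap_sq (hθ : 0 < θ) (u : WeightedL2 l) :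
    ‖bergmanToLp _ (laplaceMap hθ l u)‖ ^ 2 = laplaceConst θ * ‖u‖ ^ 2 := by
  have h := norm_bergmanToLp_sq (laplaceMap hθ l u)
  have hC := (laplaceConst_pos hθ).le
  rw [coe_laplaceMap, lintegral_laplaceTransform hθ, ← ofReal_norm,
    ← ENNReal.ofReal_pow (norm_nonneg _), ← ENNReal.ofReal_mul hC,
    ENNReal.ofReal_eq_ofReal_iff (by positivity) (by positivity)] at h
  exact h

theorem laplaceMap_injective (hθ : 0 < θ) : Function.Injective (laplaceMap hθ l) := by
  rw [injective_iff_map_eq_zero]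
  intro u hu
  have h := norm_laplaceMap_sq hθ u
  rw [hu, map_zero, norm_zero] at h
  have hC := laplaceConst_pos hθ
  have h2 : ‖u‖ ^ 2 = 0 := by nlinarith
  simpa using h2

/-- Polarization. -/
theorem inner_map_of_norm_sq_eq {E F : Type*} [NormedAddCommGroup E] [InnerProductSpace ℂ E]
    [NormedAddCommGroup F] [InnerProductSpace ℂ F] (L : E →ₗ[ℂ] F) (C : ℝ)
    (h : ∀ u, ‖L u‖ ^ 2 = C * ‖u‖ ^ 2) (u v : E) : ⟪L u, L v⟫_ℂ = (C : ℂ) * ⟪u, v⟫_ℂ := by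
  have h' : ∀ w, (‖L w‖ : ℂ) ^ 2 = (C : ℂ) * (‖w‖ : ℂ) ^ 2 := fun w => by exact_mod_cast h w
  rw [inner_eq_sum_norm_sq_div_four, inner_eq_sum_norm_sq_div_four u v, ← map_add, ← map_sub,
    ← map_smul, ← map_add, ← map_sub]
  simp only [RCLike.ofReal_eq_complex_ofReal, h']
  ring

theorem bergmanInner_laplaceMap (hθ : 0 < θ) (u v : WeightedL2 l) :
    bergmanInner (dsParam θ) (laplaceMap hθ l u : ℍ → ℂ) (laplaceMap hθ l v : ℍ → ℂ) =
      (laplaceConst θ : ℂ) * ⟪u, v⟫_ℂ := by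
  rw [bergmanInner_eq]
  exact inner_map_of_norm_sq_eq (bergmanToLp _ ∘ₗ laplaceMap hθ l) (laplaceConst θ)
    (norm_laplaceMap_sq hθ) u v

end

/-! ### The projective holomorphic discrete series -/

/-- The automorphy factor `c z + d`. -/
def autFactor (γ : SL(2, ℝ)) (z : ℍ) : ℂ := ((γ 1 0 : ℝ) : ℂ) * z + ((γ 1 1 : ℝ) : ℂ)

theorem autFactor_eq_denom (γ : SL(2, ℝ)) (z : ℍ) :
    autFactor γ z = UpperHalfPlane.denom (γ : GL (Fin 2) ℝ) z := rfl

theorem sl_smul_eq (γ : SL(2, ℝ)) (z : ℍ) : γ • z = (γ : GL (Fin 2) ℝ) • z := rfl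

theorem discreteSeries_apply (s : ℝ) (g : SL(2, ℝ)) (h : ℍ → ℂ) (z : ℍ) :
    discreteSeries s g h z = autFactor g⁻¹ z ^ ((-2 * s : ℝ) : ℂ) * h (g⁻¹ • z) := rfl

theorem autFactor_ne_zero (γ : SL(2, ℝ)) (z : ℍ) : autFactor γ z ≠ 0 :=
  UpperHalfPlane.denom_ne_zero (γ : GL (Fin 2) ℝ) z

theorem autFactor_mul (γ δ : SL(2, ℝ)) (z : ℍ) :
    autFactor (γ * δ) z = autFactor γ (δ • z) * autFactor δ z := by
  have h := UpperHalfPlane.specialLinearGroup_apply δ z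
  have hd := autFactor_ne_zero δ z
  have h2 : ((δ • z : ℍ) : ℂ) = (((δ 0 0 : ℝ) : ℂ) * z + ((δ 0 1 : ℝ) : ℂ)) / autFactor δ z := by
    rw [h]
    rfl
  rw [autFactor, autFactor, add_mul, mul_assoc, h2, div_mul_cancel₀ _ hd, autFactor,
    Matrix.SpecialLinearGroup.coe_mul, Matrix.mul_apply, Matrix.mul_apply, Fin.sum_univ_two,
    Fin.sum_univ_two]
  push_cast
  ring

theorem im_smul_eq_div_norm_sq (γ : SL(2, ℝ)) (z : ℍ) :
    (γ • z).im = z.im / ‖autFactor γ z‖ ^ 2 := by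
  rw [sl_smul_eq, UpperHalfPlane.im_smul_eq_div_normSq, Complex.normSq_eq_norm_sq]
  simp [autFactor_eq_denom]

theorem continuous_sl_smul (γ : SL(2, ℝ)) : Continuous fun z : ℍ => γ • z :=
  continuous_const_smul γ

/-- For `c = 0` the factor is a constant, possibly negative and so on the branch cut; for `c ≠ 0`
its imaginary part never vanishes. In both cases the principal logarithm is continuous along the
factor and its powers are holomorphic. -/
theorem autFactor_eq_or_mem_slitPlane (γ : SL(2, ℝ)) :
    (∀ z, autFactor γ z = ((γ 1 1 : ℝ) : ℂ)) ∨ ∀ z, autFactor γ z ∈ Complex.slitPlane := by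
  by_cases h : γ 1 0 = 0
  · left
    intro z
    simp [autFactor, h]
  · right
    intro z
    rw [Complex.mem_slitPlane_iff]
    right
    simp [autFactor, h, z.im_ne_zero]

theorem continuous_autFactor (γ : SL(2, ℝ)) : Continuous (autFactor γ) := by
  have := UpperHalfPlane.continuous_coe
  unfold autFactor
  fun_prop

theorem continuous_log_autFactor (γ : SL(2, ℝ)) :
    Continuous fun z => Complex.log (autFactor γ z) := by
  rcases autFactor_eq_or_mem_slitPlane γ with h | h
  · simp only [h]
    exact continuous_const
  · exact (continuous_autFactor γ).clog h

theorem mdifferentiable_autFactor_cpow (γ : SL(2, ℝ)) (a : ℂ) :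
    MDifferentiable 𝓘(ℂ) 𝓘(ℂ) fun z => autFactor γ z ^ a := by
  rcases autFactor_eq_or_mem_slitPlane γ with h | h
  · simp only [h]
    exact fun _ => mdifferentiableAt_const
  · rw [UpperHalfPlane.mdifferentiable_iff]
    have h1 : DifferentiableOn ℂ (fun z : ℂ => (((γ 1 0 : ℝ) : ℂ) * z + ((γ 1 1 : ℝ) : ℂ)) ^ a)
        {z | 0 < z.im} := by
      refine DifferentiableOn.cpow_const
        ((differentiable_id.const_mul _).add_const _).differentiableOn fun z hz => ?_
      lift z to ℍ using hz
      exact h z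
    refine h1.congr fun z hz => ?_
    lift z to ℍ using hz
    simp only [Function.comp_apply, UpperHalfPlane.ofComplex_apply]
    rfl

/-- The automorphy factors form a cocycle, and their principal powers form one up to a phase. -/
theorem exists_autFactor_cpow_mul (γ δ : SL(2, ℝ)) (a : ℝ) :
    ∃ c : ℂ, ‖c‖ = 1 ∧ ∀ z : ℍ, autFactor γ (δ • z) ^ (a : ℂ) * autFactor δ z ^ (a : ℂ) =
      c * autFactor (γ * δ) z ^ (a : ℂ) := by
  set L : ℍ → ℂ := fun z => Complex.log (autFactor γ (δ • z)) + Complex.log (autFactor δ z) -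
    Complex.log (autFactor (γ * δ) z) with hL
  have hcont : Continuous L :=
    (((continuous_log_autFactor γ).comp (continuous_sl_smul δ)).add
      (continuous_log_autFactor δ)).sub (continuous_log_autFactor _)
  have hexp : ∀ z, Complex.exp (L z) = 1 := fun z => by
    rw [hL, Complex.exp_sub, Complex.exp_add, Complex.exp_log (autFactor_ne_zero _ _),
      Complex.exp_log (autFactor_ne_zero _ _), Complex.exp_log (autFactor_ne_zero _ _),
      autFactor_mul, div_self (mul_ne_zero (autFactor_ne_zero _ _) (autFactor_ne_zero _ _))]
  -- `L` takes values in `2πiℤ` and is continuous, so it is constant on the connected half-plane. As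
  -- `a` is real, `exp (a L)` has modulus 1.
  choose n hn using fun z => Complex.exp_eq_one_iff.1 (hexp z)
  have hn' : Continuous n := by
    rw [Int.isClosedEmbedding_coe_real.isInducing.continuous_iff]
    have : (fun k : ℤ => (k : ℝ)) ∘ n = fun z => (L z).im / (2 * Real.pi) := by
      ext z
      rw [Function.comp_apply, hn z, eq_div_iff (by positivity)]
      simp
    rw [this]
    exact (Complex.continuous_im.comp hcont).div_const _
  have hconst : ∀ z, L z = L UpperHalfPlane.I := fun z => by
    rw [hn z, hn UpperHalfPlane.I,
      PreconnectedSpace.constant inferInstance hn' (x := z) (y := UpperHalfPlane.I)]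
  refine ⟨Complex.exp (a * L UpperHalfPlane.I), ?_, fun z => ?_⟩
  · rw [hn, Complex.norm_exp]
    simp
  · rw [← hconst z, Complex.cpow_def_of_ne_zero (autFactor_ne_zero _ _),
      Complex.cpow_def_of_ne_zero (autFactor_ne_zero _ _),
      Complex.cpow_def_of_ne_zero (autFactor_ne_zero _ _), ← Complex.exp_add, ← Complex.exp_add]
    congr 1
    simp only [hL]
    ring

theorem exists_discreteSeries_mul (s : ℝ) (g g' : SL(2, ℝ)) :
    ∃ c : ℂ, ‖c‖ = 1 ∧ ∀ h : ℍ → ℂ, discreteSeries s (g * g') h =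
      c • discreteSeries s g (discreteSeries s g' h) := by
  obtain ⟨c, hc, h⟩ := exists_autFactor_cpow_mul g'⁻¹ g⁻¹ (-2 * s)
  have hc0 : c ≠ 0 := by
    rintro rfl
    simp at hc
  refine ⟨c⁻¹, by simp [hc], fun f => ?_⟩
  ext z
  simp only [discreteSeries_apply, Pi.smul_apply, smul_eq_mul]
  rw [← mul_assoc (autFactor g⁻¹ z ^ _), mul_comm (autFactor g⁻¹ z ^ _), h z, mul_inv_rev,
    mul_smul, mul_assoc, inv_mul_cancel_left₀ hc0]

/-- `volume` on `ℍ` is the invariant measure `q⁻² dp dq`, so the weight becomes `q^{2s}` and changes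
of variables under the group cost nothing. -/
theorem lintegral_bergmanMeasure_eq_volume {s : ℝ} {f : ℍ → ENNReal} (hf : Measurable f) :
    ∫⁻ z, f z ∂(bergmanMeasure s) = ∫⁻ z : ℍ, ENNReal.ofReal (z.im ^ (2 * s)) * f z := by
  have hm : Measurable fun z : ℍ => (((1 / NNReal.mk z.im z.im_pos.le : NNReal) ^ 2 : NNReal) :
      ENNReal) := by
    have : Measurable fun z : ℍ => NNReal.mk z.im z.im_pos.le :=
      UpperHalfPlane.continuous_im.measurable.subtype_mk
    fun_prop
  rw [bergmanMeasure, lintegral_withDensity_eq_lintegral_mul _ (measurable_im_rpow _) hf,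
    UpperHalfPlane.volume_def]
  refine Eq.trans ?_ (lintegral_withDensity_eq_lintegral_mul _ hm
    ((measurable_im_rpow (2 * s)).mul hf)).symm
  congr 1
  ext z
  simp only [Pi.mul_apply]
  rw [← mul_assoc]
  congr 1
  have h1 : (((1 / NNReal.mk z.im z.im_pos.le : NNReal) : ENNReal) ^ 2) =
      ENNReal.ofReal ((1 / z.im) ^ 2) := by
    rw [ENNReal.ofReal_pow (by have := z.im_pos; positivity)]
    congr 1
    rw [← ENNReal.ofReal_coe_nnreal]
    congr 1
  rw [ENNReal.coe_pow, h1, ← ENNReal.ofReal_mul (by positivity)]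
  congr 1
  rw [Real.rpow_sub z.im_pos, show (2 : ℝ) = ((2 : ℕ) : ℝ) by norm_num, Real.rpow_natCast]
  have := z.im_ne_zero
  field_simp

theorem lintegral_sl_smul (γ : SL(2, ℝ)) (f : ℍ → ENNReal) :
    ∫⁻ z : ℍ, f (γ • z) = ∫⁻ z : ℍ, f z :=
  (measurePreserving_smul (γ : GL (Fin 2) ℝ) (volume : Measure ℍ)).lintegral_comp_emb
    (measurableEmbedding_const_smul (γ : GL (Fin 2) ℝ)) f

theorem norm_autFactor_cpow (γ : SL(2, ℝ)) (z : ℍ) (a : ℝ) :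
    ‖autFactor γ z ^ (a : ℂ)‖ = ‖autFactor γ z‖ ^ a := by
  rw [Complex.norm_cpow_of_ne_zero (autFactor_ne_zero γ z)]
  simp

/-- The automorphy factor compensates exactly for the change of `Im z`; this is why the discrete
series is isometric. -/
theorem im_rpow_mul_enorm_autFactor_sq (s : ℝ) (γ : SL(2, ℝ)) (z : ℍ) :
    ENNReal.ofReal (z.im ^ (2 * s)) * ‖autFactor γ z ^ ((-2 * s : ℝ) : ℂ)‖ₑ ^ 2 =
      ENNReal.ofReal ((γ • z).im ^ (2 * s)) := by
  have hz := z.im_pos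
  have hj : 0 < ‖autFactor γ z‖ := norm_pos_iff.2 (autFactor_ne_zero γ z)
  rw [← ofReal_norm, norm_autFactor_cpow, ← ENNReal.ofReal_pow (by positivity),
    ← ENNReal.ofReal_mul (by positivity), im_smul_eq_div_norm_sq,
    Real.div_rpow hz.le (by positivity), ← Real.rpow_natCast, ← Real.rpow_natCast,
    ← Real.rpow_mul hj.le, ← Real.rpow_mul hj.le, div_eq_mul_inv, ← Real.rpow_neg hj.le]
  congr 3
  push_cast
  ring

theorem mdifferentiable_discreteSeries (s : ℝ) (g : SL(2, ℝ)) {h : ℍ → ℂ}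
    (hh : MDifferentiable 𝓘(ℂ) 𝓘(ℂ) h) : MDifferentiable 𝓘(ℂ) 𝓘(ℂ) (discreteSeries s g h) := by
  have h1 : MDifferentiable 𝓘(ℂ) 𝓘(ℂ) fun z : ℍ => g⁻¹ • z :=
    UpperHalfPlane.mdifferentiable_smul (g := ((g⁻¹ : SL(2, ℝ)) : GL (Fin 2) ℝ)) (by simp)
  exact (mdifferentiable_autFactor_cpow g⁻¹ _).mul (hh.comp h1)

theorem lintegral_discreteSeries (s : ℝ) (g : SL(2, ℝ)) {h : ℍ → ℂ}
    (hh : MDifferentiable 𝓘(ℂ) 𝓘(ℂ) h) :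
    ∫⁻ z, ‖discreteSeries s g h z‖ₑ ^ 2 ∂(bergmanMeasure s) =
      ∫⁻ z, ‖h z‖ₑ ^ 2 ∂(bergmanMeasure s) := by
  rw [lintegral_bergmanMeasure_eq_volume
      ((mdifferentiable_discreteSeries s g hh).continuous.measurable.enorm.pow_const 2),
    lintegral_bergmanMeasure_eq_volume (hh.continuous.measurable.enorm.pow_const 2),
    ← lintegral_sl_smul g⁻¹ fun z => ENNReal.ofReal (z.im ^ (2 * s)) * ‖h z‖ₑ ^ 2]
  congr 1
  ext z
  rw [discreteSeries_apply, enorm_mul, mul_pow, ← mul_assoc, im_rpow_mul_enorm_autFactor_sq]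

/-- The operators of the discrete series, as linear maps of the weighted Bergman space. -/
def discreteSeriesMap (s : ℝ) (g : SL(2, ℝ)) : bergmanSpace s →ₗ[ℂ] bergmanSpace s where
  toFun h := ⟨discreteSeries s g h, mdifferentiable_discreteSeries s g h.2.1, by
    rw [memLp_two_iff_lintegral
      (mdifferentiable_discreteSeries s g h.2.1).continuous.aestronglyMeasurable,
      lintegral_discreteSeries s g h.2.1, ← memLp_two_iff_lintegral h.2.2.1]
    exact h.2.2⟩
  map_add' h₁ h₂ := by
    ext z
    simp [discreteSeries_apply, mul_add]
  map_smul' c h := by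
    ext z
    simp only [discreteSeries_apply, Submodule.coe_smul, Pi.smul_apply, smul_eq_mul,
      RingHom.id_apply]
    ring

@[simp] theorem coe_discreteSeriesMap (s : ℝ) (g : SL(2, ℝ)) (h : bergmanSpace s) :
    (discreteSeriesMap s g h : ℍ → ℂ) = discreteSeries s g h := rfl

theorem norm_discreteSeriesMap (s : ℝ) (g : SL(2, ℝ)) (h : bergmanSpace s) :
    ‖bergmanToLp s (discreteSeriesMap s g h)‖ = ‖bergmanToLp s h‖ := by
  have h1 := norm_bergmanToLp_sq (discreteSeriesMap s g h)
  rw [coe_discreteSeriesMap, lintegral_discreteSeries s g h.2.1, ← norm_bergmanToLp_sq,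
    ENNReal.ofReal_eq_ofReal_iff (by positivity) (by positivity)] at h1
  exact (sq_eq_sq₀ (norm_nonneg _) (norm_nonneg _)).1 h1

theorem discreteSeries_one (s : ℝ) (h : ℍ → ℂ) : discreteSeries s 1 h = h := by
  ext z
  simp [discreteSeries_apply, autFactor]

theorem discreteSeriesMap_surjective (s : ℝ) (g : SL(2, ℝ)) :
    Function.Surjective (discreteSeriesMap s g) := fun h => by
  obtain ⟨c, _, hc⟩ := exists_discreteSeries_mul s g g⁻¹
  refine ⟨c • discreteSeriesMap s g⁻¹ h, ?_⟩
  rw [map_smul]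
  refine Subtype.ext ?_
  rw [Submodule.coe_smul, coe_discreteSeriesMap, coe_discreteSeriesMap, ← hc, mul_inv_cancel,
    discreteSeries_one]

/-! ### The action of `AN` -/

section

variable {θ l : ℝ}

theorem inv_toSL (x : AN) : (AN.toSL x)⁻¹ = AN.toSL x⁻¹ := (map_inv AN.toSL x).symm

theorem coe_toSL (x : AN) : ((AN.toSL x : SL(2, ℝ)) : Matrix (Fin 2) (Fin 2) ℝ) =
    !![Real.exp x.a, Real.exp x.a * x.n; 0, Real.exp (-x.a)] := rfl

theorem autFactor_toSL (x : AN) (z : ℍ) : autFactor (AN.toSL x) z = (Real.exp (-x.a) : ℂ) := by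
  simp [autFactor, coe_toSL]

theorem coe_toSL_smul (x : AN) (z : ℍ) :
    ((AN.toSL x • z : ℍ) : ℂ) = (Real.exp (2 * x.a) : ℂ) * (z + x.n) := by
  rw [UpperHalfPlane.coe_specialLinearGroup_apply]
  have h : Real.exp (2 * x.a) = Real.exp x.a * Real.exp x.a := by
    rw [← Real.exp_add]
    ring_nf
  have h0 : (Real.exp x.a : ℂ) ≠ 0 := Complex.ofReal_ne_zero.2 (Real.exp_pos _).ne'
  rw [h]
  simp [coe_toSL, Real.exp_neg]
  field_simp

theorem norm_anOperator (τ : ℝ) (x : AN) (φ : ℝ → ℂ) (a₀ : ℝ) :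
    ‖anOperator τ l x φ a₀‖ = Real.exp (-(l * x.a)) * ‖φ (a₀ - x.a)‖ := by
  rw [anOperator, norm_mul, Complex.norm_exp]
  congr 2
  rw [show Complex.I / (τ : ℂ) * ((Real.exp (2 * (x.a - a₀)) * x.n : ℝ) : ℂ) =
    ((Real.exp (2 * (x.a - a₀)) * x.n / τ : ℝ) : ℂ) * Complex.I by push_cast; ring,
    Complex.add_re, Complex.re_ofReal_mul, Complex.I_re, mul_zero, add_zero, Complex.neg_re,
    Complex.ofReal_re]

theorem aestronglyMeasurable_anOperator (τ : ℝ) (x : AN) {φ : ℝ → ℂ}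
    (hφ : AEStronglyMeasurable φ) : AEStronglyMeasurable (anOperator τ l x φ) := by
  refine (Continuous.aestronglyMeasurable (by fun_prop)).mul
    (hφ.comp_measurePreserving (measurePreserving_sub_right volume x.a))

theorem memLp_anOperator (τ : ℝ) (x : AN) (u : WeightedL2 l) :
    MemLp (anOperator τ l x u) 2 (weightedMeasure l) := by
  have hm := aestronglyMeasurable_anOperator (l := l) τ x u.aestronglyMeasurable
  rw [← memLp_exp_mul_iff l hm]
  refine (u.memLp_exp_mul.comp_measurePreserving (measurePreserving_sub_right volume x.a)).congr_norm
    ?_ (Filter.Eventually.of_forall fun a => ?_)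
  · exact (by fun_prop : Continuous fun a : ℝ => (Real.exp (l * a) : ℂ)).aestronglyMeasurable.mul hm
  · rw [Function.comp_apply, norm_mul, norm_mul, norm_anOperator, Complex.norm_real,
      Complex.norm_real, Real.norm_eq_abs, Real.norm_eq_abs, Real.abs_exp, Real.abs_exp,
      ← mul_assoc, ← Real.exp_add]
    congr 2
    ring

/-- The inverse of `(a, n)` acts by `z ↦ e^{-2a} z - n`. Translating the integration variable by `a`
turns the dilation into a shift of `u`, while the translation by `-n` becomes an oscillating factor;
its minus sign is the reason for `-θ`. -/
theorem laplaceTransform_anOperator (x : AN) (u : ℝ → ℂ) (z : ℍ) :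
    laplaceTransform θ l (anOperator (-θ) l x u) z =
      discreteSeries (dsParam θ) (AN.toSL x) (laplaceTransform θ l u) z := by
  rw [discreteSeries_apply, inv_toSL, autFactor_toSL, laplaceTransform, laplaceTransform,
    
    ← integral_sub_right_eq_self (laplaceIntegrand θ l u (AN.toSL x⁻¹ • z)) x.a, ← integral_const_mul]
  congr 1
  ext q
  have h1 : ((Real.exp (-(x⁻¹).a) : ℝ) : ℂ) ^ ((-2 * dsParam θ : ℝ) : ℂ) =
      Complex.exp ((-2 * dsParam θ * x.a : ℝ) : ℂ) := by
    rw [AN.inv_a, neg_neg, ← Complex.ofReal_cpow (Real.exp_pos _).le, ← Real.exp_mul,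
      Complex.ofReal_exp]
    congr 2
    ring
  have h2 : ((AN.toSL x⁻¹ • z : ℍ) : ℂ) = (Real.exp (-2 * x.a) : ℂ) * z - x.n := by
    rw [coe_toSL_smul, AN.inv_a, AN.inv_n, mul_add, sub_eq_add_neg]
    have h3 : Real.exp (-(2 * x.a)) * Real.exp (2 * x.a) = 1 := by
      rw [← Real.exp_add]
      simp
    congr 1
    · ring_nf
    · push_cast
      rw [mul_neg, ← mul_assoc]
      have h4 : (Real.exp (2 * -x.a) : ℂ) * (Real.exp (2 * x.a) : ℂ) = 1 := by
        rw [← Complex.ofReal_mul, ← Real.exp_add]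
        simp
      push_cast at h4
      rw [h4, one_mul]
  have h5 : (Real.exp (-2 * (q - x.a)) : ℂ) * (Real.exp (-2 * x.a) : ℂ) =
      (Real.exp (-2 * q) : ℂ) := by
    rw [← Complex.ofReal_mul, ← Real.exp_add]
    ring_nf
  rw [h1, laplaceIntegrand, laplaceIntegrand, anOperator, h2, Complex.ofReal_exp ((l - _) * q),
    Complex.ofReal_exp ((l - _) * (q - x.a)), ← mul_assoc, ← mul_assoc, ← mul_assoc,
    ← Complex.exp_add, ← Complex.exp_add, ← Complex.exp_add, ← Complex.exp_add]
  congr 2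
  rw [show 2 * (x.a - q) = -2 * (q - x.a) by ring]
  push_cast at h5 ⊢
  linear_combination (-(Complex.I / (θ : ℂ) * z)) * h5

/-- The action of `AN` on the weighted `L²` space. -/
def anElement (τ : ℝ) (x : AN) (u : WeightedL2 l) : WeightedL2 l :=
  (memLp_anOperator τ x u).toLp

theorem coeFn_anElement (τ : ℝ) (x : AN) (u : WeightedL2 l) :
    anElement τ x u =ᵐ[volume] anOperator τ l x u :=
  WeightedL2.ae_eq_iff.1 (memLp_anOperator τ x u).coeFn_toLp

theorem laplaceTransform_anElement (x : AN) (u : WeightedL2 l) :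
    laplaceTransform θ l (anElement (-θ) x u) =
      discreteSeries (dsParam θ) (AN.toSL x) (laplaceTransform θ l u) := by
  ext z
  rw [laplaceTransform_congr (coeFn_anElement (-θ) x u), laplaceTransform_anOperator]

/-! ### The reproducing kernel -/

theorem memLp_evalKernel (hθ : 0 < θ) (l : ℝ) (w : ℍ) :
    MemLp (fun q => (Real.exp (-(l + 2 * dsParam θ) * q) : ℂ) *
      Complex.exp (-((starRingEnd ℂ) (-Complex.I * w) * (expSubst θ⁻¹ q : ℂ)))) 2
      (weightedMeasure l) := by
  have hm : Continuous fun q => (Real.exp (-(l + 2 * dsParam θ) * q) : ℂ) *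
      Complex.exp (-((starRingEnd ℂ) (-Complex.I * w) * (expSubst θ⁻¹ q : ℂ))) := by
    unfold expSubst
    fun_prop
  rw [← memLp_exp_mul_iff l hm.aestronglyMeasurable]
  refine (memLp_two_exp_gamma (inv_pos.2 hθ) (a := dsParam θ) (by linarith [one_lt_dsParam hθ])
    w.im_pos).congr_norm ((by fun_prop : Continuous fun a : ℝ =>
      (Real.exp (l * a) : ℂ)).mul hm).aestronglyMeasurable (Filter.Eventually.of_forall fun q => ?_)
  simp only [norm_mul, norm_cexp_neg_mul_ofReal, Complex.norm_real, Real.norm_eq_abs, Real.abs_exp,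
    ← mul_assoc, ← Real.exp_add, Complex.conj_re]
  congr 2
  · ring
  · simp

/-- The element of the weighted `L²` space representing evaluation of the transform at `w`. -/
def evalKernel (hθ : 0 < θ) (l : ℝ) (w : ℍ) : WeightedL2 l := (memLp_evalKernel hθ l w).toLp

theorem coeFn_evalKernel (hθ : 0 < θ) (w : ℍ) : evalKernel hθ l w =ᵐ[volume] fun q =>
    (Real.exp (-(l + 2 * dsParam θ) * q) : ℂ) *
      Complex.exp (-((starRingEnd ℂ) (-Complex.I * w) * (expSubst θ⁻¹ q : ℂ))) :=
  WeightedL2.ae_eq_iff.1 (memLp_evalKernel hθ l w).coeFn_toLp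

theorem integral_weightedMeasure (l : ℝ) (f : ℝ → ℂ) :
    ∫ a, f a ∂(weightedMeasure l) = ∫ a, (Real.exp (2 * l * a) : ℂ) * f a := by
  rw [integral_withDensity_eq_integral_toReal_smul (by fun_prop) (by simp)]
  congr 1
  ext a
  rw [ENNReal.toReal_ofReal (Real.exp_pos _).le, Complex.real_smul]

theorem WeightedL2.inner_eq (u v : WeightedL2 l) :
    ⟪u, v⟫_ℂ = ∫ a, (Real.exp (2 * l * a) : ℂ) * ((starRingEnd ℂ) (u a) * v a) := by
  rw [L2.inner_def, ← integral_weightedMeasure]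
  refine integral_congr_ae (Filter.Eventually.of_forall fun a => ?_)
  exact mul_comm _ _

theorem inner_evalKernel (hθ : 0 < θ) (w : ℍ) (u : WeightedL2 l) :
    ⟪evalKernel hθ l w, u⟫_ℂ = laplaceTransform θ l u w := by
  rw [WeightedL2.inner_eq, laplaceTransform]
  refine integral_congr_ae ?_
  filter_upwards [coeFn_evalKernel hθ w] with q hq
  rw [hq, laplaceIntegrand_eq_cexp, map_mul, Complex.conj_ofReal, ← Complex.exp_conj, map_neg,
    map_mul, Complex.conj_conj, Complex.conj_ofReal, ← mul_assoc, ← mul_assoc, ← mul_assoc,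
    ← Complex.ofReal_mul, ← Real.exp_add, mul_comm (Complex.exp _)]
  congr 4
  ring

/-- The product of the two exponentials is a Gamma integrand with parameter `-i(z - conj w)`, which
has positive real part. The reproducing kernel is thus an explicit power. -/
theorem laplaceTransform_evalKernel (hθ : 0 < θ) (w z : ℍ) :
    ((2 * θ⁻¹ ^ (2 * dsParam θ) : ℝ) : ℂ) * laplaceTransform θ l (evalKernel hθ l w) z =
      (1 / (-Complex.I * z + (starRingEnd ℂ) (-Complex.I * w))) ^ ((2 * dsParam θ : ℝ) : ℂ) *
        (Real.Gamma (2 * dsParam θ) : ℂ) := by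
  rw [laplaceTransform_congr (coeFn_evalKernel hθ w), ← integral_exp_gamma (inv_pos.2 hθ)
    (by linarith [one_lt_dsParam hθ]), laplaceTransform]
  · congr 2
    ext q
    rw [laplaceIntegrand_eq_cexp, add_mul, neg_add (-Complex.I * (z : ℂ) * _), Complex.exp_add, ← mul_assoc
      (Complex.ofReal _), ← Complex.ofReal_mul, ← Real.exp_add,
      show (l - 2 * dsParam θ) * q + -(l + 2 * dsParam θ) * q = -2 * (2 * dsParam θ) * q by ring]
    ring
  · simp only [Complex.add_re, Complex.conj_re, neg_mul, Complex.neg_re, Complex.mul_re,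
      Complex.I_re, Complex.I_im, zero_mul, one_mul, zero_sub, neg_neg]
    exact add_pos z.im_pos w.im_pos

end

/-! ### Averaging over the rotation group -/

/-- The rotation by the angle `t` around `i` in the hyperbolic plane. -/
def hypRotation (t : ℝ) : SL(2, ℝ) :=
  ⟨!![Real.cos (t / 2), Real.sin (t / 2); -Real.sin (t / 2), Real.cos (t / 2)], by
    rw [Matrix.det_fin_two_of]
    linear_combination Real.cos_sq_add_sin_sq (t / 2)⟩

theorem coe_hypRotation (t : ℝ) : ((hypRotation t : SL(2, ℝ)) : Matrix (Fin 2) (Fin 2) ℝ) =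
    !![Real.cos (t / 2), Real.sin (t / 2); -Real.sin (t / 2), Real.cos (t / 2)] := rfl

theorem continuous_hypRotation : Continuous hypRotation := by
  refine Continuous.subtype_mk (continuous_matrix fun i j => ?_) _
  fin_cases i <;> fin_cases j <;> simp <;> fun_prop

/-- The Cayley coordinate `(z - i) / (z + i)`. -/
def cayley (z : ℍ) : ℂ := (z - Complex.I) / (z + Complex.I)

theorem add_I_ne_zero (z : ℍ) : (z : ℂ) + Complex.I ≠ 0 := by
  intro h
  have := congrArg Complex.im h
  simp at this
  linarith [z.im_pos]

theorem autFactor_hypRotation (t : ℝ) (z : ℍ) : autFactor (hypRotation t) z =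
    -(Real.sin (t / 2) : ℂ) * z + (Real.cos (t / 2) : ℂ) := by
  simp [autFactor, coe_hypRotation]

theorem coe_hypRotation_smul (t : ℝ) (z : ℍ) : ((hypRotation t • z : ℍ) : ℂ) =
    ((Real.cos (t / 2) : ℂ) * z + (Real.sin (t / 2) : ℂ)) / autFactor (hypRotation t) z := by
  rw [UpperHalfPlane.coe_specialLinearGroup_apply, autFactor_hypRotation]
  simp [coe_hypRotation]

theorem hypRotation_smul_add_I (t : ℝ) (z : ℍ) : ((hypRotation t • z : ℍ) : ℂ) + Complex.I =
    Complex.exp (-(((t / 2 : ℝ) : ℂ) * Complex.I)) * (z + Complex.I) /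
      autFactor (hypRotation t) z := by
  have h := autFactor_ne_zero (hypRotation t) z
  rw [coe_hypRotation_smul, eq_div_iff h, add_mul, div_mul_cancel₀ _ h, autFactor_hypRotation,
    ← neg_mul, Complex.exp_mul_I, Complex.cos_neg, Complex.sin_neg, ← Complex.ofReal_cos,
    ← Complex.ofReal_sin]
  linear_combination ((Real.sin (t / 2) : ℂ)) * Complex.I_mul_I

theorem hypRotation_smul_sub_I (t : ℝ) (z : ℍ) : ((hypRotation t • z : ℍ) : ℂ) - Complex.I =
    Complex.exp (((t / 2 : ℝ) : ℂ) * Complex.I) * (z - Complex.I) /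
      autFactor (hypRotation t) z := by
  have h := autFactor_ne_zero (hypRotation t) z
  rw [coe_hypRotation_smul, eq_div_iff h, sub_mul, div_mul_cancel₀ _ h, autFactor_hypRotation,
    Complex.exp_mul_I, ← Complex.ofReal_cos, ← Complex.ofReal_sin]
  linear_combination ((Real.sin (t / 2) : ℂ)) * Complex.I_mul_I

theorem cayley_hypRotation_smul (t : ℝ) (z : ℍ) :
    cayley (hypRotation t • z) = Complex.exp ((t : ℂ) * Complex.I) * cayley z := by
  have h := autFactor_ne_zero (hypRotation t) z
  have hz := add_I_ne_zero z
  have h2 : Complex.exp ((t : ℂ) * Complex.I) =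
      Complex.exp (((t / 2 : ℝ) : ℂ) * Complex.I) /
        Complex.exp (-(((t / 2 : ℝ) : ℂ) * Complex.I)) := by
    rw [← Complex.exp_sub]
    congr 1
    push_cast
    ring
  have h3 := Complex.exp_ne_zero (-(((t / 2 : ℝ) : ℂ) * Complex.I))
  rw [cayley, cayley, hypRotation_smul_add_I, hypRotation_smul_sub_I, h2]
  field_simp

theorem norm_cayley_lt_one (z : ℍ) : ‖cayley z‖ < 1 := by
  rw [cayley, norm_div, div_lt_one (norm_pos_iff.2 (add_I_ne_zero z))]
  refine (sq_lt_sq₀ (norm_nonneg _) (norm_nonneg _)).1 ?_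
  rw [← Complex.normSq_eq_norm_sq, ← Complex.normSq_eq_norm_sq, Complex.normSq_apply,
    Complex.normSq_apply]
  simp
  nlinarith [z.im_pos]

/-- The inverse Cayley transform. -/
def cayleySymm (w : ℂ) : ℂ := Complex.I * (1 + w) / (1 - w)

theorem cayleySymm_cayley (z : ℍ) : cayleySymm (cayley z) = z := by
  have hz := add_I_ne_zero z
  have h1 : 1 - cayley z = 2 * Complex.I / (z + Complex.I) := by
    rw [cayley]
    field_simp
    ring
  have h2 : 1 + cayley z = 2 * z / (z + Complex.I) := by
    rw [cayley]
    field_simp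
    ring
  rw [cayleySymm, h1, h2]
  field_simp

theorem one_sub_ne_zero_of_norm_lt_one {w : ℂ} (hw : ‖w‖ < 1) : 1 - w ≠ 0 := by
  intro h
  rw [sub_eq_zero] at h
  rw [← h] at hw
  simp at hw

theorem cayleySymm_im_pos {w : ℂ} (hw : ‖w‖ < 1) : 0 < (cayleySymm w).im := by
  have h0 := one_sub_ne_zero_of_norm_lt_one hw
  have hn : 0 < Complex.normSq (1 - w) := Complex.normSq_pos.2 h0
  have h1 : w.re ^ 2 + w.im ^ 2 < 1 := by
    have := (sq_lt_one_iff₀ (norm_nonneg w)).2 hw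
    rw [← Complex.normSq_eq_norm_sq, Complex.normSq_apply] at this
    nlinarith
  have h2 : (cayleySymm w).im = (1 - (w.re ^ 2 + w.im ^ 2)) / Complex.normSq (1 - w) := by
    rw [cayleySymm, Complex.div_im]
    simp
    field_simp
    ring
  rw [h2]
  exact div_pos (by linarith) hn

theorem cayleySymm_zero : cayleySymm 0 = Complex.I := by simp [cayleySymm]

/-- The mean value property on the rotation orbits. -/
theorem integral_hypRotation_smul {H : ℍ → ℂ} (hH : MDifferentiable 𝓘(ℂ) 𝓘(ℂ) H) (z : ℍ) :
    ∫ t in Set.Ioc 0 (2 * Real.pi), H (hypRotation t • z) =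
      ((2 * Real.pi : ℝ) : ℂ) * H UpperHalfPlane.I := by
  rw [UpperHalfPlane.mdifferentiable_iff] at hH
  -- In Cayley coordinates the orbit of `z` is the circle of radius `‖cayley z‖ < 1`. Rescaling
  -- makes it the unit circle, and `G` is differentiable at every point of the closed unit disc, so
  -- its circle average is `G 0 = H(i)`.
  set G : ℂ → ℂ := fun w => (H ∘ UpperHalfPlane.ofComplex) (cayleySymm (w * cayley z)) with hG
  have hz := norm_cayley_lt_one z
  have hsub : ∀ w ∈ Metric.closedBall (0 : ℂ) 1, ‖w * cayley z‖ < 1 := fun w hw => by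
    rw [mem_closedBall_zero_iff] at hw
    rw [norm_mul]
    nlinarith [norm_nonneg w, norm_nonneg (cayley z)]
  have hdiff : ∀ w ∈ Metric.closedBall (0 : ℂ) 1, DifferentiableAt ℂ G w := fun w hw => by
    have h1 := hsub w hw
    have h2 : DifferentiableAt ℂ (fun w => cayleySymm (w * cayley z)) w := by
      unfold cayleySymm
      refine DifferentiableAt.div (by fun_prop) (by fun_prop) (one_sub_ne_zero_of_norm_lt_one h1)
    exact DifferentiableAt.comp (g := H ∘ UpperHalfPlane.ofComplex) w
      ((hH _ (cayleySymm_im_pos h1)).differentiableAt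
        (UpperHalfPlane.isOpen_upperHalfPlaneSet.mem_nhds (cayleySymm_im_pos h1))) h2
  have h := circleAverage_of_differentiable_on_off_countable (f := G) (c := 0) (R := 1)
    Set.countable_empty
    (fun w hw => (hdiff w (by simpa using hw)).continuousAt.continuousWithinAt)
    (fun w hw => hdiff w (Metric.ball_subset_closedBall (by simpa using hw)))
  have h0 : G 0 = H UpperHalfPlane.I := by
    simp only [hG, zero_mul, cayleySymm_zero, Function.comp_apply]
    rw [← UpperHalfPlane.coe_I, UpperHalfPlane.ofComplex_apply]
  rw [h0, Real.circleAverage_def, intervalIntegral.integral_of_le (by positivity),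
    inv_smul_eq_iff₀ (by positivity), Complex.real_smul] at h
  rw [← h]
  congr 1
  ext t
  simp only [hG, circleMap, Complex.ofReal_one, one_mul, zero_add, ← cayley_hypRotation_smul,
    cayleySymm_cayley, Function.comp_apply, UpperHalfPlane.ofComplex_apply]

theorem integral_sl_smul (γ : SL(2, ℝ)) (f : ℍ → ℂ) :
    ∫ z : ℍ, f (γ • z) = ∫ z : ℍ, f z :=
  (measurePreserving_smul (γ : GL (Fin 2) ℝ) (volume : Measure ℍ)).integral_comp
    (measurableEmbedding_const_smul (γ : GL (Fin 2) ℝ)) f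

theorem integrable_sl_smul_iff (γ : SL(2, ℝ)) (f : ℍ → ℂ) :
    Integrable (fun z : ℍ => f (γ • z)) ↔ Integrable f :=
  (measurePreserving_smul (γ : GL (Fin 2) ℝ) (volume : Measure ℍ)).integrable_comp_emb
    (measurableEmbedding_const_smul (γ : GL (Fin 2) ℝ))

/-- A holomorphic function integrates against a rotation invariant weight to a multiple of its
value at the centre. -/
theorem integral_rotation_invariant_mul {P H : ℍ → ℂ} (hP : Continuous P)
    (hinv : ∀ t z, P (hypRotation t • z) = P z) (hH : MDifferentiable 𝓘(ℂ) 𝓘(ℂ) H)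
    (hint : Integrable fun z => P z * H z) :
    ∫ z, P z * H z = H UpperHalfPlane.I * ∫ z, P z := by
  -- Rotating `H` alone does not change the integral, because both the measure and `P` are
  -- invariant. Averaging over `t` and exchanging the integrals then replaces `H` by its mean over
  -- each orbit.
  have hrot : ∀ t, ∫ z, P z * H (hypRotation t • z) = ∫ z, P z * H z := fun t => by
    rw [← integral_sl_smul (hypRotation t) fun z => P z * H z]
    simp only [hinv]
  have hact : Continuous fun x : ℝ × ℍ => hypRotation x.1 • x.2 :=
    (continuous_hypRotation.comp continuous_fst).smul continuous_snd
  have hprod : Integrable (Function.uncurry fun (t : ℝ) (z : ℍ) => P z * H (hypRotation t • z))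
      ((volume.restrict (Set.Ioc 0 (2 * Real.pi))).prod volume) := by
    have hc : Continuous (Function.uncurry fun (t : ℝ) (z : ℍ) => P z * H (hypRotation t • z)) :=
      (hP.comp continuous_snd).mul (hH.continuous.comp hact)
    rw [integrable_prod_iff hc.aestronglyMeasurable]
    constructor
    · refine Filter.Eventually.of_forall fun t => ?_
      have := (integrable_sl_smul_iff (hypRotation t) _).2 hint
      simp only [hinv] at this
      exact this
    · have h1 : ∀ t, ∫ z, ‖P z * H (hypRotation t • z)‖ = ∫ z, ‖P z * H z‖ := fun t => by
        have h2 := (measurePreserving_smul ((hypRotation t : SL(2, ℝ)) : GL (Fin 2) ℝ)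
          (volume : Measure ℍ)).integral_comp (measurableEmbedding_const_smul _)
          fun z => ‖P z * H z‖
        rw [← h2]
        congr 1
        ext z
        rw [← sl_smul_eq, hinv]
      simp only [Function.uncurry_apply_pair, h1]
      exact integrable_const _
  have hswap := integral_integral_swap hprod
  simp only [hrot] at hswap
  have h2 : ∀ z, ∫ t in Set.Ioc 0 (2 * Real.pi), P z * H (hypRotation t • z) =
      P z * (((2 * Real.pi : ℝ) : ℂ) * H UpperHalfPlane.I) := fun z => by
    rw [integral_const_mul, integral_hypRotation_smul hH]
  simp only [h2] at hswap
  rw [integral_mul_const, integral_const] at hswap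
  have hpi : ((2 * Real.pi : ℝ) : ℂ) ≠ 0 := Complex.ofReal_ne_zero.2 (by positivity)
  simp only [measureReal_restrict_apply_univ, Real.volume_real_Ioc, sub_zero, Complex.real_smul]
    at hswap
  rw [max_eq_left (by positivity)] at hswap
  refine mul_left_cancel₀ hpi ?_
  rw [hswap]
  ring

/-! ### The reproducing property and surjectivity -/

theorem bergmanMeasure_eq_withDensity (s : ℝ) : bergmanMeasure s =
    (volume : Measure ℍ).withDensity fun z => ENNReal.ofReal (z.im ^ (2 * s)) := by
  refine Measure.ext_of_lintegral _ fun f hf => ?_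
  rw [lintegral_bergmanMeasure_eq_volume hf,
    lintegral_withDensity_eq_lintegral_mul _ (measurable_im_rpow _) hf]
  rfl

theorem bergmanInner_eq_volume (s : ℝ) (h₁ h₂ : ℍ → ℂ) : bergmanInner s h₁ h₂ =
    ∫ z : ℍ, ((z.im ^ (2 * s) : ℝ) : ℂ) * ((starRingEnd ℂ) (h₁ z) * h₂ z) := by
  rw [bergmanInner, bergmanMeasure_eq_withDensity,
    integral_withDensity_eq_integral_toReal_smul (measurable_im_rpow _) (by simp)]
  congr 1
  ext z
  rw [ENNReal.toReal_ofReal (Real.rpow_nonneg z.im_pos.le _), Complex.real_smul]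

theorem integrable_bergmanMeasure_iff (s : ℝ) (f : ℍ → ℂ) : Integrable f (bergmanMeasure s) ↔
    Integrable fun z : ℍ => ((z.im ^ (2 * s) : ℝ) : ℂ) * f z := by
  rw [bergmanMeasure_eq_withDensity,
    integrable_withDensity_iff_integrable_smul' (measurable_im_rpow _) (by simp)]
  refine integrable_congr (Filter.Eventually.of_forall fun z => ?_)
  simp only
  rw [ENNReal.toReal_ofReal (Real.rpow_nonneg z.im_pos.le _), Complex.real_smul]

section

variable {θ l : ℝ}

/-- The transform of the evaluation kernel at `i`. -/
def baseKernel (hθ : 0 < θ) (l : ℝ) (z : ℍ) : ℂ :=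
  laplaceTransform θ l (evalKernel hθ l UpperHalfPlane.I) z

theorem mdifferentiable_baseKernel (hθ : 0 < θ) (l : ℝ) :
    MDifferentiable 𝓘(ℂ) 𝓘(ℂ) (baseKernel hθ l) :=
  mdifferentiable_laplaceTransform hθ _

theorem norm_baseKernel (hθ : 0 < θ) (l : ℝ) : ∃ C : ℝ, 0 < C ∧ ∀ z : ℍ,
    ‖baseKernel hθ l z‖ = C * ‖(z : ℂ) + Complex.I‖ ^ (-(2 * dsParam θ)) := by
  have hs := one_lt_dsParam hθ
  have hG := Real.Gamma_pos_of_pos (s := 2 * dsParam θ) (by linarith)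
  have hc : 0 < 2 * θ⁻¹ ^ (2 * dsParam θ) := by positivity
  refine ⟨(2 * θ⁻¹ ^ (2 * dsParam θ))⁻¹ * Real.Gamma (2 * dsParam θ), by positivity,
    fun z => ?_⟩
  have h := congrArg (fun w => ‖w‖) (laplaceTransform_evalKernel (l := l) hθ UpperHalfPlane.I z)
  have h1 : -Complex.I * z + (starRingEnd ℂ) (-Complex.I * UpperHalfPlane.I) =
      -Complex.I * ((z : ℂ) + Complex.I) := by
    rw [UpperHalfPlane.coe_I, map_mul, map_neg, Complex.conj_I]
    ring
  have h2 : 1 / (-Complex.I * ((z : ℂ) + Complex.I)) ≠ 0 :=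
    one_div_ne_zero (mul_ne_zero (by simp) (add_I_ne_zero z))
  simp only [h1, norm_mul] at h
  rw [Complex.norm_cpow_of_ne_zero h2, Complex.norm_real, Complex.norm_real,
    Real.norm_of_nonneg hc.le, Real.norm_of_nonneg hG.le] at h
  rw [baseKernel, ← mul_right_inj' hc.ne', h, ← mul_assoc, ← mul_assoc,
    mul_inv_cancel₀ hc.ne', one_mul]
  simp only [Complex.ofReal_re, Complex.ofReal_im, mul_zero, Real.exp_zero, div_one, norm_div,
    norm_one, norm_mul, norm_neg, Complex.norm_I, one_mul]
  rw [mul_comm, one_div, Real.inv_rpow (norm_nonneg _), Real.rpow_neg (norm_nonneg _)]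

theorem baseKernel_ne_zero (hθ : 0 < θ) (l : ℝ) (z : ℍ) : baseKernel hθ l z ≠ 0 := by
  obtain ⟨C, hC, h⟩ := norm_baseKernel hθ l
  rw [← norm_pos_iff, h]
  have := norm_pos_iff.2 (add_I_ne_zero z)
  positivity

theorem norm_hypRotation_smul_add_I (t : ℝ) (z : ℍ) :
    ‖((hypRotation t • z : ℍ) : ℂ) + Complex.I‖ =
      ‖(z : ℂ) + Complex.I‖ / ‖autFactor (hypRotation t) z‖ := by
  rw [hypRotation_smul_add_I, norm_div, norm_mul, Complex.norm_exp]
  simp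

/-- Under a rotation, `Im z` and `|z + i|²` are both divided by the squared modulus of the
automorphy factor, and the weight is a constant times the power `2s` of their quotient. -/
theorem baseKernel_weight_invariant (hθ : 0 < θ) (l t : ℝ) (z : ℍ) :
    (hypRotation t • z).im ^ (2 * dsParam θ) * ‖baseKernel hθ l (hypRotation t • z)‖ ^ 2 =
      z.im ^ (2 * dsParam θ) * ‖baseKernel hθ l z‖ ^ 2 := by
  obtain ⟨C, hC, h⟩ := norm_baseKernel hθ l
  have hj := norm_pos_iff.2 (autFactor_ne_zero (hypRotation t) z)
  have hz := norm_pos_iff.2 (add_I_ne_zero z)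
  rw [h, h, norm_hypRotation_smul_add_I, im_smul_eq_div_norm_sq,
    Real.div_rpow z.im_pos.le (by positivity), Real.div_rpow hz.le hj.le,
    Real.rpow_neg hj.le, ← Real.rpow_natCast ‖autFactor (hypRotation t) z‖ 2,
    ← Real.rpow_mul hj.le, show ((2 : ℕ) : ℝ) * (2 * dsParam θ) = 2 * dsParam θ + 2 * dsParam θ by
      push_cast; ring, Real.rpow_add hj]
  have := Real.rpow_pos_of_pos hj (2 * dsParam θ)
  field_simp

/-- The reproducing property at `i`. -/
theorem bergmanInner_baseKernel (hθ : 0 < θ) (l : ℝ) (h : bergmanSpace (dsParam θ)) :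
    bergmanInner (dsParam θ) (baseKernel hθ l) (h : ℍ → ℂ) =
      (h : ℍ → ℂ) UpperHalfPlane.I / baseKernel hθ l UpperHalfPlane.I *
        bergmanInner (dsParam θ) (baseKernel hθ l) (baseKernel hθ l) := by
  have hK := mdifferentiable_baseKernel hθ l
  -- Since the kernel has no zeros, `conj K * h = |K|² * (h / K)`: a rotation invariant weight times
  -- a holomorphic function.
  have hP : ∀ f : ℂ, ∀ z : ℍ, ((z.im ^ (2 * dsParam θ) : ℝ) : ℂ) *
      ((starRingEnd ℂ) (baseKernel hθ l z) * f) =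
      ((z.im ^ (2 * dsParam θ) * ‖baseKernel hθ l z‖ ^ 2 : ℝ) : ℂ) *
        (f / baseKernel hθ l z) := fun f z => by
    have := baseKernel_ne_zero hθ l z
    rw [← Complex.normSq_eq_norm_sq, Complex.ofReal_mul, Complex.normSq_eq_conj_mul_self]
    field_simp
  have hint : Integrable (fun z => (starRingEnd ℂ) (baseKernel hθ l z) * (h : ℍ → ℂ) z)
      (bergmanMeasure (dsParam θ)) :=
    (MemLp.star (memLp_laplaceTransform hθ (evalKernel hθ l UpperHalfPlane.I))).integrable_mul h.2.2
  rw [integrable_bergmanMeasure_iff] at hint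
  rw [bergmanInner_eq_volume, bergmanInner_eq_volume]
  simp only [hP] at hint ⊢
  simp only [div_self (baseKernel_ne_zero hθ l _), mul_one]
  refine integral_rotation_invariant_mul (P := fun z : ℍ =>
    ((z.im ^ (2 * dsParam θ) * ‖baseKernel hθ l z‖ ^ 2 : ℝ) : ℂ))
    (H := fun z => (h : ℍ → ℂ) z / baseKernel hθ l z) ?_ ?_ ?_ hint
  · refine Complex.continuous_ofReal.comp (Continuous.mul ?_ (hK.continuous.norm.pow 2))
    exact UpperHalfPlane.continuous_im.rpow_const fun z => Or.inl z.im_ne_zero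
  · intro t z
    exact congrArg _ (baseKernel_weight_invariant hθ l t z)
  · rw [UpperHalfPlane.mdifferentiable_iff] at hK ⊢
    exact (UpperHalfPlane.mdifferentiable_iff.1 h.2.1).div hK
      fun z _ => baseKernel_ne_zero hθ l _

theorem bergmanInner_baseKernel_self_ne_zero (hθ : 0 < θ) (l : ℝ) :
    bergmanInner (dsParam θ) (baseKernel hθ l) (baseKernel hθ l) ≠ 0 := by
  have h := bergmanInner_laplaceMap hθ (evalKernel hθ l UpperHalfPlane.I)
    (evalKernel hθ l UpperHalfPlane.I)
  rw [inner_evalKernel] at h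
  exact h.trans_ne (mul_ne_zero (Complex.ofReal_ne_zero.2 (laplaceConst_pos hθ).ne')
    (baseKernel_ne_zero hθ l _))

theorem eval_I_eq_zero_of_orthogonal (hθ : 0 < θ) (h : bergmanSpace (dsParam θ))
    (hh : ∀ u : WeightedL2 l,
      bergmanInner (dsParam θ) (laplaceMap hθ l u : ℍ → ℂ) (h : ℍ → ℂ) = 0) :
    (h : ℍ → ℂ) UpperHalfPlane.I = 0 := by
  have h1 := hh (evalKernel hθ l UpperHalfPlane.I)
  have h2 := bergmanInner_baseKernel hθ l h
  rw [show bergmanInner (dsParam θ) (baseKernel hθ l) (h : ℍ → ℂ) = 0 from h1, eq_comm,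
    mul_eq_zero, div_eq_zero_iff] at h2
  rcases h2 with (h2 | h2) | h2
  · exact h2
  · exact absurd h2 (baseKernel_ne_zero hθ l _)
  · exact absurd h2 (bergmanInner_baseKernel_self_ne_zero hθ l)

/-! ### Transport from i to all points, and surjectivity -/

theorem bergmanInner_discreteSeries (s : ℝ) (g : SL(2, ℝ)) (h₁ h₂ : bergmanSpace s) :
    bergmanInner s (discreteSeries s g h₁) (discreteSeries s g h₂) =
      bergmanInner s (h₁ : ℍ → ℂ) (h₂ : ℍ → ℂ) := by
  rw [← coe_discreteSeriesMap, ← coe_discreteSeriesMap, bergmanInner_eq, bergmanInner_eq]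
  have h : ∀ h, ‖bergmanToLp s (discreteSeriesMap s g h)‖ ^ 2 = ‖bergmanToLp s h‖ ^ 2 :=
    fun h => by rw [norm_discreteSeriesMap]
  have hadd : ∀ h₁ h₂, RCLike.re ⟪bergmanToLp s (discreteSeriesMap s g h₁),
      bergmanToLp s (discreteSeriesMap s g h₂)⟫_ℂ =
      RCLike.re ⟪bergmanToLp s h₁, bergmanToLp s h₂⟫_ℂ := fun h₁ h₂ => by
    have h3 := h (h₁ + h₂)
    rw [map_add, map_add, map_add, @norm_add_sq ℂ, @norm_add_sq ℂ, h, h] at h3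
    linarith
  refine Complex.ext (hadd h₁ h₂) ?_
  have h4 := hadd (Complex.I • h₁) h₂
  simp only [map_smul, inner_smul_left, Complex.conj_I] at h4
  simpa using h4

/-- The element of `AN` mapping `i` to the given point. -/
def anOfPoint (w : ℍ) : AN := ⟨Real.log w.im / 2, w.re / w.im⟩

theorem anOfPoint_smul_I (w : ℍ) : AN.toSL (anOfPoint w) • UpperHalfPlane.I = w := by
  refine UpperHalfPlane.ext ?_
  rw [coe_toSL_smul, anOfPoint, UpperHalfPlane.coe_I, mul_div_cancel₀ _ (two_ne_zero' ℝ),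
    Real.exp_log w.im_pos]
  have h := Complex.ofReal_ne_zero.2 w.im_ne_zero
  rw [← UpperHalfPlane.re_add_im w]
  push_cast
  field_simp
  ring

/-- AN preserves the image of the transform, hence also orthogonality to it, and moves i to any
point. Vanishing at i therefore implies vanishing everywhere. -/
theorem eq_zero_of_orthogonal (hθ : 0 < θ) (h : bergmanSpace (dsParam θ))
    (hh : ∀ u : WeightedL2 l,
      bergmanInner (dsParam θ) (laplaceMap hθ l u : ℍ → ℂ) (h : ℍ → ℂ) = 0) : h = 0 := by
  ext w
  set x := anOfPoint w with hx
  have h1 := eval_I_eq_zero_of_orthogonal (l := l) hθ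
    (discreteSeriesMap _ (AN.toSL x)⁻¹ h) fun u => by
    obtain ⟨c, hc, hmul⟩ := exists_discreteSeries_mul (dsParam θ) (AN.toSL x)⁻¹ (AN.toSL x)
    -- Each element of the image is the translate by `x⁻¹` of another element of the image; only the
    -- explicit action of AN is available for this at this stage.
    have h2 : laplaceMap hθ l u = discreteSeriesMap (dsParam θ) (AN.toSL x)⁻¹
        (laplaceMap hθ l (c • anElement (-θ) x u)) := by
      refine Subtype.ext ?_
      rw [map_smul, map_smul, Submodule.coe_smul, coe_discreteSeriesMap, coe_laplaceMap,
        coe_laplaceMap, laplaceTransform_anElement, ← hmul, inv_mul_cancel, discreteSeries_one]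
    rw [h2, coe_discreteSeriesMap, coe_discreteSeriesMap, bergmanInner_discreteSeries, hh]
  rw [coe_discreteSeriesMap, discreteSeries_apply, inv_inv, anOfPoint_smul_I, mul_eq_zero] at h1
  refine h1.resolve_left ?_
  rw [← norm_eq_zero, norm_autFactor_cpow]
  have := norm_pos_iff.2 (autFactor_ne_zero (AN.toSL x) UpperHalfPlane.I)
  exact (Real.rpow_pos_of_pos this _).ne'

/-- The preimage is the scaled adjoint applied to `h`: its transform is the orthogonal projection of
`h` to the image, so the difference is orthogonal to the image and vanishes. Completeness of the
Bergman space is not needed. -/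
theorem laplaceMap_surjective (hθ : 0 < θ) : Function.Surjective (laplaceMap hθ l) := fun h => by
  have hC := laplaceConst_pos hθ
  let L : WeightedL2 l →L[ℂ] Lp ℂ 2 (bergmanMeasure (dsParam θ)) :=
    (bergmanToLp _ ∘ₗ laplaceMap hθ l).mkContinuous (Real.sqrt (laplaceConst θ)) fun u => by
      refine le_of_eq ((sq_eq_sq₀ (norm_nonneg _) (by positivity)).1 ?_)
      rw [mul_pow, Real.sq_sqrt hC.le]
      exact norm_laplaceMap_sq hθ u
  let v : WeightedL2 l := (laplaceConst θ : ℂ)⁻¹ • ContinuousLinearMap.adjoint L (bergmanToLp _ h)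
  refine ⟨v, ?_⟩
  rw [eq_comm, ← sub_eq_zero]
  refine eq_zero_of_orthogonal (l := l) hθ _ fun u => ?_
  rw [bergmanInner_eq, map_sub, inner_sub_right, ← bergmanInner_eq, ← bergmanInner_eq,
    bergmanInner_laplaceMap, inner_smul_right, mul_inv_cancel_left₀
      (Complex.ofReal_ne_zero.2 hC.ne'), ContinuousLinearMap.adjoint_inner_right,
    bergmanInner_eq, sub_eq_zero]
  rfl

/-- The Laplace-type map, as a linear equivalence. -/
def laplaceEquiv (hθ : 0 < θ) (l : ℝ) : WeightedL2 l ≃ₗ[ℂ] bergmanSpace (dsParam θ) :=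
  LinearEquiv.ofBijective (laplaceMap hθ l) ⟨laplaceMap_injective hθ, laplaceMap_surjective hθ⟩

end

/-! ### The unitary operators -/

section

open Filter Topology

variable {θ l : ℝ}

theorem norm_eq_of_norm_laplaceMap_eq (hθ : 0 < θ) {u v : WeightedL2 l}
    (h : ‖bergmanToLp _ (laplaceMap hθ l u)‖ = ‖bergmanToLp _ (laplaceMap hθ l v)‖) :
    ‖u‖ = ‖v‖ := by
  have h1 := norm_laplaceMap_sq hθ u
  rw [h, norm_laplaceMap_sq hθ v] at h1
  exact ((sq_eq_sq₀ (norm_nonneg _) (norm_nonneg _)).1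
    (mul_left_cancel₀ (laplaceConst_pos hθ).ne' h1)).symm

/-- The unitary operators obtained by transporting the discrete series. -/
def unitaryOp (hθ : 0 < θ) (l : ℝ) (g : SL(2, ℝ)) : WeightedL2 l ≃ₗᵢ[ℂ] WeightedL2 l :=
  LinearIsometryEquiv.ofSurjective
    ⟨((laplaceEquiv hθ l).symm : bergmanSpace (dsParam θ) →ₗ[ℂ] WeightedL2 l) ∘ₗ
      discreteSeriesMap (dsParam θ) g ∘ₗ
        (laplaceEquiv hθ l : WeightedL2 l →ₗ[ℂ] bergmanSpace (dsParam θ)), fun u => by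
      refine norm_eq_of_norm_laplaceMap_eq hθ ?_
      refine Eq.trans ?_ (norm_discreteSeriesMap (dsParam θ) g (laplaceEquiv hθ l u))
      exact congrArg (fun h => ‖bergmanToLp _ h‖) ((laplaceEquiv hθ l).apply_symm_apply _)⟩
    ((laplaceEquiv hθ l).symm.surjective.comp
      ((discreteSeriesMap_surjective (dsParam θ) g).comp (laplaceEquiv hθ l).surjective))

theorem laplaceEquiv_unitaryOp (hθ : 0 < θ) (g : SL(2, ℝ)) (u : WeightedL2 l) :
    laplaceEquiv hθ l (unitaryOp hθ l g u) =
      discreteSeriesMap (dsParam θ) g (laplaceEquiv hθ l u) :=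
  (laplaceEquiv hθ l).apply_symm_apply _

theorem laplaceTransform_unitaryOp (hθ : 0 < θ) (g : SL(2, ℝ)) (u : WeightedL2 l) :
    laplaceTransform θ l (unitaryOp hθ l g u) =
      discreteSeries (dsParam θ) g (laplaceTransform θ l u) :=
  congrArg Subtype.val (laplaceEquiv_unitaryOp hθ g u)

theorem eq_of_laplaceTransform_eq (hθ : 0 < θ) {u v : WeightedL2 l}
    (h : laplaceTransform θ l u = laplaceTransform θ l v) : u = v :=
  laplaceMap_injective hθ (Subtype.ext h)

theorem laplaceTransform_smul_eq (c : ℂ) (u : WeightedL2 l) :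
    laplaceTransform θ l (c • u : WeightedL2 l) = c • laplaceTransform θ l u :=
  funext (laplaceTransform_smul c u)

theorem exists_unitaryOp_mul (hθ : 0 < θ) (l : ℝ) (g g' : SL(2, ℝ)) :
    ∃ c : ℂ, ‖c‖ = 1 ∧ ∀ v, unitaryOp hθ l (g * g') v =
      c • unitaryOp hθ l g (unitaryOp hθ l g' v) := by
  obtain ⟨c, hc, h⟩ := exists_discreteSeries_mul (dsParam θ) g g'
  refine ⟨c, hc, fun v => eq_of_laplaceTransform_eq hθ ?_⟩
  rw [laplaceTransform_smul_eq, laplaceTransform_unitaryOp, laplaceTransform_unitaryOp,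
    laplaceTransform_unitaryOp, h]

theorem unitaryOp_one (hθ : 0 < θ) (v : WeightedL2 l) : unitaryOp hθ l 1 v = v :=
  eq_of_laplaceTransform_eq hθ (by rw [laplaceTransform_unitaryOp, discreteSeries_one])

theorem unitaryOp_toSL (hθ : 0 < θ) (x : AN) (u : WeightedL2 l) :
    unitaryOp hθ l (AN.toSL x) u = anElement (-θ) x u :=
  eq_of_laplaceTransform_eq hθ (by
    rw [laplaceTransform_unitaryOp, laplaceTransform_anElement])

/-! ### Strong continuity -/

/-- Only the identity is considered: there the automorphy factor is 1, away from the branch cut.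
Elsewhere the principal power may jump. -/
theorem tendsto_discreteSeries (s : ℝ) {h : ℍ → ℂ} (hh : Continuous h) (z : ℍ) :
    Tendsto (fun g => discreteSeries s g h z) (𝓝 1) (𝓝 (h z)) := by
  have hinv : Tendsto (fun g : SL(2, ℝ) => g⁻¹) (𝓝 1) (𝓝 1) := by
    simpa using (continuous_inv (G := SL(2, ℝ))).tendsto 1
  have h1 : Tendsto (fun g : SL(2, ℝ) => g⁻¹ • z) (𝓝 1) (𝓝 z) := by
    have h2 : Continuous fun g : SL(2, ℝ) => g • z := continuous_id.smul continuous_const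
    have h3 := (h2.tendsto 1).comp hinv
    rwa [one_smul] at h3
  have h3 : Tendsto (fun g : SL(2, ℝ) => autFactor g⁻¹ z) (𝓝 1) (𝓝 1) := by
    have h4 : Continuous fun g : SL(2, ℝ) => autFactor g z := by
      have hij : ∀ i j, Continuous fun g : SL(2, ℝ) => g i j := fun i j =>
        continuous_subtype_val.matrix_elem i j
      have := hij 1 0
      have := hij 1 1
      unfold autFactor
      fun_prop
    have h5 := (h4.tendsto 1).comp hinv
    have h6 : autFactor 1 z = 1 := by simp [autFactor]
    rwa [h6] at h5
  have h7 : Tendsto (fun g : SL(2, ℝ) => autFactor g⁻¹ z ^ ((-2 * s : ℝ) : ℂ)) (𝓝 1) (𝓝 1) := by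
    have h8 := h3.cpow (tendsto_const_nhds (x := ((-2 * s : ℝ) : ℂ))) Complex.one_mem_slitPlane
    simpa using h8
  have h9 := h7.mul ((hh.tendsto z).comp h1)
  rwa [one_mul] at h9

theorem tendsto_inner_evalKernel (hθ : 0 < θ) (z : ℍ) (u : WeightedL2 l) :
    Tendsto (fun g => ⟪evalKernel hθ l z, unitaryOp hθ l g u⟫_ℂ) (𝓝 1)
      (𝓝 ⟪evalKernel hθ l z, u⟫_ℂ) := by
  simp only [inner_evalKernel, laplaceTransform_unitaryOp]
  exact tendsto_discreteSeries _ (mdifferentiable_laplaceTransform hθ u).continuous z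

/-- A vector orthogonal to all evaluation vectors has zero transform. -/
theorem dense_span_evalKernel (hθ : 0 < θ) (l : ℝ) :
    Dense (Submodule.span ℂ (Set.range (evalKernel hθ l)) : Set (WeightedL2 l)) := by
  rw [Submodule.dense_iff_topologicalClosure_eq_top, Submodule.topologicalClosure_eq_top_iff,
    Submodule.eq_bot_iff]
  intro u hu
  refine eq_of_laplaceTransform_eq hθ (funext fun z => ?_)
  have h1 := (Submodule.mem_orthogonal _ u).1 hu (evalKernel hθ l z)
    (Submodule.subset_span ⟨z, rfl⟩)
  rw [inner_evalKernel] at h1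
  rw [h1, ← inner_evalKernel hθ, inner_zero_right]

/-- For unitary operators `‖U u - u‖² = 2‖u‖² - 2 Re ⟪u, U u⟫`, so convergence of the coefficient of
`u` with itself suffices. That coefficient is a combination of point evaluations of the transform.
-/
theorem tendsto_unitaryOp_of_mem_span (hθ : 0 < θ) {u : WeightedL2 l}
    (hu : u ∈ Submodule.span ℂ (Set.range (evalKernel hθ l))) :
    Tendsto (fun g => unitaryOp hθ l g u) (𝓝 1) (𝓝 u) := by
  have h1 : ∀ w ∈ Submodule.span ℂ (Set.range (evalKernel hθ l)),
      Tendsto (fun g => ⟪w, unitaryOp hθ l g u⟫_ℂ) (𝓝 1) (𝓝 ⟪w, u⟫_ℂ) := by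
    intro w hw
    induction hw using Submodule.span_induction with
    | mem w hw =>
      obtain ⟨z, rfl⟩ := hw
      exact tendsto_inner_evalKernel hθ z u
    | zero => simp
    | add x y _ _ hx hy =>
      simp only [inner_add_left]
      exact hx.add hy
    | smul c x _ hx =>
      simp only [inner_smul_left]
      exact hx.const_mul _
  rw [tendsto_iff_norm_sub_tendsto_zero]
  have h2 : Tendsto (fun g => ‖unitaryOp hθ l g u - u‖ ^ 2) (𝓝 1) (𝓝 0) := by
    have h3 : ∀ g, ‖unitaryOp hθ l g u - u‖ ^ 2 =
        2 * ‖u‖ ^ 2 - 2 * (⟪u, unitaryOp hθ l g u⟫_ℂ).re := fun g => by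
      rw [@norm_sub_sq ℂ, LinearIsometryEquiv.norm_map, inner_re_symm]
      simp only [RCLike.re_to_complex]
      ring
    simp only [h3]
    have h4 := ((Complex.continuous_re.tendsto _).comp (h1 u hu)).const_mul 2
    have h5 := h4.const_sub (2 * ‖u‖ ^ 2)
    have h6 : (⟪u, u⟫_ℂ).re = ‖u‖ ^ 2 := inner_self_eq_norm_sq (𝕜 := ℂ) u
    rw [h6, sub_self] at h5
    exact h5
  have h7 := (Real.continuous_sqrt.tendsto 0).comp h2
  simpa [Function.comp_def, Real.sqrt_sq] using h7

theorem tendsto_unitaryOp (hθ : 0 < θ) (u : WeightedL2 l) :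
    Tendsto (fun g => unitaryOp hθ l g u) (𝓝 1) (𝓝 u) := by
  rw [Metric.tendsto_nhds]
  intro ε hε
  obtain ⟨w, hw, hwu⟩ := Metric.dense_iff.1 (dense_span_evalKernel hθ l) u (ε / 3) (by positivity)
  have h := Metric.tendsto_nhds.1 (tendsto_unitaryOp_of_mem_span hθ hwu) (ε / 3) (by positivity)
  rw [Metric.mem_ball] at hw
  filter_upwards [h] with g hg
  have h1 : dist (unitaryOp hθ l g u) (unitaryOp hθ l g w) = dist u w :=
    (unitaryOp hθ l g).dist_map u w
  calc dist (unitaryOp hθ l g u) u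
      ≤ dist (unitaryOp hθ l g u) (unitaryOp hθ l g w) + dist (unitaryOp hθ l g w) w +
        dist w u := dist_triangle4 _ _ _ _
    _ < ε := by
        rw [h1, dist_comm u w]
        linarith

theorem tendsto_inv_mul_one (g : SL(2, ℝ)) : Tendsto (fun h => g⁻¹ * h) (𝓝 g) (𝓝 1) := by
  have h := (continuous_const_mul g⁻¹).tendsto g
  rwa [inv_mul_cancel] at h

theorem isProjectiveUnitaryRep_unitaryOp (hθ : 0 < θ) (l : ℝ) :
    IsProjectiveUnitaryRep (unitaryOp hθ l) where
  map_mul := exists_unitaryOp_mul hθ l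
  continuous_abs_coeff v w := by
    rw [continuous_iff_continuousAt]
    intro g
    -- The modulus removes the phase relating `U h` to `U g ∘ U (g⁻¹h)`, which reduces continuity at
    -- `g` to strong continuity at 1.
    have h1 : ∀ h, ‖⟪w, unitaryOp hθ l h v⟫_ℂ‖ =
        ‖⟪w, unitaryOp hθ l g (unitaryOp hθ l (g⁻¹ * h) v)⟫_ℂ‖ := fun h => by
      obtain ⟨c, hc, hmul⟩ := exists_unitaryOp_mul hθ l g (g⁻¹ * h)
      have h2 := hmul v
      rw [mul_inv_cancel_left] at h2
      rw [h2, inner_smul_right, norm_mul, hc, one_mul]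
    have h3 : Tendsto (fun h => unitaryOp hθ l g (unitaryOp hθ l (g⁻¹ * h) v)) (𝓝 g)
        (𝓝 (unitaryOp hθ l g v)) :=
      ((unitaryOp hθ l g).continuous.tendsto v).comp
        ((tendsto_unitaryOp hθ v).comp (tendsto_inv_mul_one g))
    rw [ContinuousAt]
    simp only [h1]
    rw [inv_mul_cancel, unitaryOp_one]
    exact (tendsto_const_nhds.inner h3).norm

end

/-! ### The involution and the symmetric space structure -/

section

open Filter Topology

variable {θ l : ℝ}

/-- The Weyl element, acting on the upper half-plane by `z ↦ -1/z`. -/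
def weylElement : SL(2, ℝ) := ⟨!![0, 1; -1, 0], by simp [Matrix.det_fin_two_of]⟩

theorem coe_weylElement :
    ((weylElement : SL(2, ℝ)) : Matrix (Fin 2) (Fin 2) ℝ) = !![0, 1; -1, 0] := rfl

theorem autFactor_inv_weylElement (z : ℍ) : autFactor weylElement⁻¹ z = z := by
  simp [autFactor, Matrix.SpecialLinearGroup.SL2_inv_expl, coe_weylElement]

theorem coe_inv_weylElement_smul (z : ℍ) : ((weylElement⁻¹ • z : ℍ) : ℂ) = -(z : ℂ)⁻¹ := by
  rw [UpperHalfPlane.coe_specialLinearGroup_apply]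
  simp [Matrix.SpecialLinearGroup.SL2_inv_expl, coe_weylElement, neg_div]

theorem inv_weylElement_smul_smul (z : ℍ) : weylElement⁻¹ • weylElement⁻¹ • z = z :=
  UpperHalfPlane.ext (by rw [coe_inv_weylElement_smul, coe_inv_weylElement_smul]; simp)

theorem eq_I_of_inv_weylElement_smul {z : ℍ} (h : weylElement⁻¹ • z = z) :
    z = UpperHalfPlane.I := by
  have h1 := coe_inv_weylElement_smul z
  rw [h] at h1
  have hz := z.ne_zero
  have h2 : ((z : ℂ) - Complex.I) * (z + Complex.I) = 0 := by
    have h3 : (z : ℂ) * z = -1 := by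
      nth_rewrite 2 [h1]
      rw [mul_neg, mul_inv_cancel₀ hz]
    linear_combination h3 - Complex.I_mul_I
  refine UpperHalfPlane.ext ?_
  rw [UpperHalfPlane.coe_I]
  exact sub_eq_zero.1 ((mul_eq_zero.1 h2).resolve_right (add_I_ne_zero z))

theorem inv_weylElement_smul_I : weylElement⁻¹ • UpperHalfPlane.I = UpperHalfPlane.I :=
  UpperHalfPlane.ext (by rw [coe_inv_weylElement_smul]; simp)

/-- The phase relating the Weyl element to the involution. -/
def weylPhase (s : ℝ) : ℂ := Complex.exp ((s * Real.pi : ℝ) * Complex.I)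

theorem norm_weylPhase (s : ℝ) : ‖weylPhase s‖ = 1 := Complex.norm_exp_ofReal_mul_I _

/-- Both `z` and `-1/z` lie in the upper half-plane and their arguments add up to `π`, with no
wrap-around of the principal branch. -/
theorem log_add_log_neg_inv (z : ℍ) :
    Complex.log z + Complex.log (-(z : ℂ)⁻¹) = Real.pi * Complex.I := by
  have h1 : -(z : ℂ)⁻¹ = Complex.exp (Real.pi * Complex.I - Complex.log z) := by
    rw [Complex.exp_sub, Complex.exp_log z.ne_zero, Complex.exp_pi_mul_I, neg_div, one_div]
  have h2 : 0 < Complex.arg z := by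
    have := Complex.arg_nonneg_iff.2 z.im_pos.le
    refine lt_of_le_of_ne this fun h => ?_
    have := (Complex.arg_eq_zero_iff.1 h.symm).2
    exact z.im_ne_zero this
  have h3 := Complex.arg_le_pi (z : ℂ)
  rw [h1, Complex.log_exp]
  · ring
  · simp [Complex.log_im]
    linarith
  · simpa [Complex.log_im] using z.im_pos.le

/-- The phase `e^{iπs}` is chosen for this: its square cancels the `e^{-2πis}` coming from the two
principal powers. -/
theorem weylPhase_mul_cpow (s : ℝ) (z : ℍ) :
    (weylPhase s * (z : ℂ) ^ ((-2 * s : ℝ) : ℂ)) *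
      (weylPhase s * (-(z : ℂ)⁻¹) ^ ((-2 * s : ℝ) : ℂ)) = 1 := by
  rw [Complex.cpow_def_of_ne_zero z.ne_zero,
    Complex.cpow_def_of_ne_zero (neg_ne_zero.2 (inv_ne_zero z.ne_zero)), weylPhase,
    ← Complex.exp_add, ← Complex.exp_add, ← Complex.exp_add, ← Complex.exp_zero]
  congr 1
  have h := log_add_log_neg_inv z
  push_cast
  linear_combination (-2 * (s : ℂ)) * h

/-- The unitary involution. -/
def weylInvolution (hθ : 0 < θ) (l : ℝ) : WeightedL2 l ≃ₗᵢ[ℂ] WeightedL2 l :=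
  LinearIsometryEquiv.ofSurjective
    ⟨weylPhase (dsParam θ) • ((unitaryOp hθ l weylElement).toLinearEquiv :
        WeightedL2 l →ₗ[ℂ] WeightedL2 l), fun u => by
      rw [LinearMap.smul_apply, norm_smul, norm_weylPhase, one_mul]
      exact (unitaryOp hθ l weylElement).norm_map u⟩
    fun u => by
      refine ⟨(weylPhase (dsParam θ))⁻¹ • (unitaryOp hθ l weylElement).symm u, ?_⟩
      change weylPhase (dsParam θ) • unitaryOp hθ l weylElement
        ((weylPhase (dsParam θ))⁻¹ • (unitaryOp hθ l weylElement).symm u) = u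
      rw [map_smul, smul_smul, mul_inv_cancel₀ (by
        rw [← norm_ne_zero_iff, norm_weylPhase]
        exact one_ne_zero), one_smul, LinearIsometryEquiv.apply_symm_apply]

theorem weylInvolution_apply (hθ : 0 < θ) (u : WeightedL2 l) :
    weylInvolution hθ l u = weylPhase (dsParam θ) • unitaryOp hθ l weylElement u := rfl

theorem laplaceTransform_weylInvolution (hθ : 0 < θ) (u : WeightedL2 l) (z : ℍ) :
    laplaceTransform θ l (weylInvolution hθ l u) z =
      weylPhase (dsParam θ) * (z : ℂ) ^ ((-2 * dsParam θ : ℝ) : ℂ) *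
        laplaceTransform θ l u (weylElement⁻¹ • z) := by
  rw [weylInvolution_apply, laplaceTransform_smul, laplaceTransform_unitaryOp,
    discreteSeries_apply, autFactor_inv_weylElement, mul_assoc]

theorem weylInvolution_weylInvolution (hθ : 0 < θ) (u : WeightedL2 l) :
    weylInvolution hθ l (weylInvolution hθ l u) = u := by
  refine eq_of_laplaceTransform_eq hθ (funext fun z => ?_)
  rw [laplaceTransform_weylInvolution, laplaceTransform_weylInvolution,
    inv_weylElement_smul_smul, ← mul_assoc, coe_inv_weylElement_smul, weylPhase_mul_cpow, one_mul]

/-- For determinant one, inverse transpose is conjugation by the Weyl element; hence the corrected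
Weyl operator implements the Cartan involution. -/
theorem cartanInvolution_eq (g : SL(2, ℝ)) :
    cartanInvolution g * weylElement = weylElement * g := by
  have h : cartanInvolution g = (g.transpose)⁻¹ := rfl
  rw [h, inv_mul_eq_iff_eq_mul]
  have hdet : g 0 0 * g 1 1 - g 0 1 * g 1 0 = 1 := by
    rw [← Matrix.det_fin_two]
    exact g.2
  refine Subtype.ext ?_
  rw [Matrix.SpecialLinearGroup.coe_mul, Matrix.SpecialLinearGroup.coe_mul,
    Matrix.SpecialLinearGroup.coe_transpose, coe_weylElement]
  ext i j
  fin_cases i <;> fin_cases j <;>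
    simp [Matrix.mul_apply, Matrix.vecMul, dotProduct, Fin.sum_univ_two] <;> linarith

theorem exists_unitaryOp_cartanInvolution (hθ : 0 < θ) (l : ℝ) (g : SL(2, ℝ)) :
    ∃ c : ℂ, ‖c‖ = 1 ∧ ∀ v, unitaryOp hθ l (cartanInvolution g) (weylInvolution hθ l v) =
      c • weylInvolution hθ l (unitaryOp hθ l g v) := by
  obtain ⟨c₁, hc₁, h₁⟩ := exists_unitaryOp_mul hθ l (cartanInvolution g) weylElement
  obtain ⟨c₂, hc₂, h₂⟩ := exists_unitaryOp_mul hθ l weylElement g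
  refine ⟨c₁⁻¹ * c₂, by simp [hc₁, hc₂], fun v => ?_⟩
  have hc0 : c₁ ≠ 0 := by
    rintro rfl
    simp at hc₁
  have h3 := h₁ v
  rw [cartanInvolution_eq, h₂, eq_comm, ← eq_inv_smul_iff₀ hc0] at h3
  rw [weylInvolution_apply, weylInvolution_apply, map_smul, h3, smul_smul, smul_smul, smul_smul]
  congr 1
  ring

theorem separableSpace_weightedL2 (l : ℝ) : TopologicalSpace.SeparableSpace (WeightedL2 l) := by
  have : Fact ((2 : ENNReal) ≠ ⊤) := ⟨by norm_num⟩
  have : SigmaFinite (weightedMeasure l) := SigmaFinite.withDensity_ofReal _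
  have := Lp.SecondCountableTopology (E := ℂ) (μ := weightedMeasure l) (p := 2)
  exact inferInstanceAs (TopologicalSpace.SeparableSpace (Lp ℂ 2 (weightedMeasure l)))

theorem isUnitaryRepOfSymmetricSpace (hθ : 0 < θ) (l : ℝ) :
    IsUnitaryRepOfSymmetricSpace cartanInvolution (unitaryOp hθ l) (weylInvolution hθ l) where
  complete := inferInstance
  separable := separableSpace_weightedL2 l
  isRep := isProjectiveUnitaryRep_unitaryOp hθ l
  involutive := weylInvolution_weylInvolution hθ
  intertwines g := by
    obtain ⟨c, hc, h⟩ := exists_unitaryOp_cartanInvolution hθ l g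
    refine ⟨c, hc, fun v => ?_⟩
    rw [← h, weylInvolution_weylInvolution]

/-! ### Commutation of the involution with the rotation group -/

theorem cartanInvolution_of_mem_stabilizer {k : SL(2, ℝ)}
    (hk : k ∈ MulAction.stabilizer SL(2, ℝ) UpperHalfPlane.I) : cartanInvolution k = k := by
  have h1 := congrArg UpperHalfPlane.coe (MulAction.mem_stabilizer_iff.1 hk)
  have hj := autFactor_ne_zero k UpperHalfPlane.I
  rw [UpperHalfPlane.coe_specialLinearGroup_apply, div_eq_iff (by exact hj)] at h1
  have hre := congrArg Complex.re h1
  have him := congrArg Complex.im h1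
  simp at hre him
  have h : cartanInvolution k = (k.transpose)⁻¹ := rfl
  rw [h, inv_eq_iff_mul_eq_one]
  have hdet : k 0 0 * k 1 1 - k 0 1 * k 1 0 = 1 := by
    rw [← Matrix.det_fin_two]
    exact k.2
  refine Subtype.ext ?_
  rw [Matrix.SpecialLinearGroup.coe_mul, Matrix.SpecialLinearGroup.coe_transpose]
  ext i j
  fin_cases i <;> fin_cases j <;> simp [Matrix.mul_apply, Fin.sum_univ_two, hre, him] <;>
    simp [hre, him] at hdet <;> linarith

/-- A priori the operators commute up to a phase `c`. The involution preserves the value of the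
transform at i, because `e^{iπs} i^{-2s} = 1`, and `k` fixes i. Comparing nonzero values at i, for
the evaluation vector at i, forces `c = 1`. -/
theorem weylInvolution_unitaryOp_of_mem_stabilizer (hθ : 0 < θ) {k : SL(2, ℝ)}
    (hk : k ∈ MulAction.stabilizer SL(2, ℝ) UpperHalfPlane.I) (v : WeightedL2 l) :
    weylInvolution hθ l (unitaryOp hθ l k v) = unitaryOp hθ l k (weylInvolution hθ l v) := by
  obtain ⟨c, hc, h⟩ := exists_unitaryOp_cartanInvolution hθ l k
  rw [cartanInvolution_of_mem_stabilizer hk] at h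
  have hI : ∀ u : WeightedL2 l, laplaceTransform θ l (weylInvolution hθ l u) UpperHalfPlane.I =
      laplaceTransform θ l u UpperHalfPlane.I := fun u => by
    have h1 := weylPhase_mul_cpow (dsParam θ) UpperHalfPlane.I
    rw [laplaceTransform_weylInvolution, inv_weylElement_smul_I]
    have h2 : weylPhase (dsParam θ) * (UpperHalfPlane.I : ℂ) ^ ((-2 * dsParam θ : ℝ) : ℂ) = 1 := by
      rw [UpperHalfPlane.coe_I, weylPhase, Complex.cpow_def_of_ne_zero Complex.I_ne_zero,
        Complex.log_I, ← Complex.exp_add, ← Complex.exp_zero]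
      congr 1
      push_cast
      ring
    rw [h2, one_mul]
  have hk' : k⁻¹ • UpperHalfPlane.I = UpperHalfPlane.I :=
    inv_smul_eq_iff.2 (MulAction.mem_stabilizer_iff.1 hk).symm
  have h3 := congrArg (fun u : WeightedL2 l => laplaceTransform θ l u UpperHalfPlane.I)
    (h (evalKernel hθ l UpperHalfPlane.I))
  simp only [laplaceTransform_smul, hI, laplaceTransform_unitaryOp, discreteSeries_apply,
    hk'] at h3
  have h4 : autFactor k⁻¹ UpperHalfPlane.I ^ ((-2 * dsParam θ : ℝ) : ℂ) *
      laplaceTransform θ l (evalKernel hθ l UpperHalfPlane.I) UpperHalfPlane.I ≠ 0 := by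
    refine mul_ne_zero ?_ (baseKernel_ne_zero hθ l _)
    rw [← norm_pos_iff, norm_autFactor_cpow]
    exact Real.rpow_pos_of_pos (norm_pos_iff.2 (autFactor_ne_zero _ _)) _
  have h5 : c = 1 := (mul_right_cancel₀ h4 (by rw [one_mul]; exact h3)).symm
  rw [h v, h5, one_smul]

/-! ### The symmetric space -/

/-- The operator attached to a point of the symmetric space, on representatives. -/
def symmetryOp (hθ : 0 < θ) (l : ℝ) (g : SL(2, ℝ)) : WeightedL2 l ≃L[ℂ] WeightedL2 l :=
  (((unitaryOp hθ l g).symm.trans (weylInvolution hθ l)).trans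
    (unitaryOp hθ l g)).toContinuousLinearEquiv

theorem symmetryOp_apply (hθ : 0 < θ) (g : SL(2, ℝ)) (v : WeightedL2 l) :
    symmetryOp hθ l g v =
      unitaryOp hθ l g (weylInvolution hθ l ((unitaryOp hθ l g).symm v)) := rfl

/-- The phase in `U (gh) = c U g U h` enters once directly and once through the inverse, and
cancels. So the symmetries obey an exact covariance rule although `U` is only projective. -/
theorem symmetryOp_mul (hθ : 0 < θ) (g h : SL(2, ℝ)) (v : WeightedL2 l) :
    symmetryOp hθ l (g * h) v =
      unitaryOp hθ l g (symmetryOp hθ l h ((unitaryOp hθ l g).symm v)) := by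
  obtain ⟨c, hc, hmul⟩ := exists_unitaryOp_mul hθ l g h
  obtain ⟨y, rfl⟩ := (unitaryOp hθ l (g * h)).surjective v
  rw [symmetryOp_apply, symmetryOp_apply, LinearIsometryEquiv.symm_apply_apply, hmul, hmul,
    map_smul, LinearIsometryEquiv.symm_apply_apply, map_smul, LinearIsometryEquiv.symm_apply_apply,
    map_smul, map_smul, map_smul]

theorem symmetryOp_of_mem_stabilizer (hθ : 0 < θ) {k : SL(2, ℝ)}
    (hk : k ∈ MulAction.stabilizer SL(2, ℝ) UpperHalfPlane.I) (v : WeightedL2 l) :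
    symmetryOp hθ l k v = weylInvolution hθ l v := by
  rw [symmetryOp_apply, ← weylInvolution_unitaryOp_of_mem_stabilizer hθ hk,
    LinearIsometryEquiv.apply_symm_apply]

theorem symmetryOp_mul_of_mem_stabilizer (hθ : 0 < θ) (g : SL(2, ℝ)) {k : SL(2, ℝ)}
    (hk : k ∈ MulAction.stabilizer SL(2, ℝ) UpperHalfPlane.I) :
    symmetryOp hθ l (g * k) = symmetryOp hθ l g := by
  refine ContinuousLinearEquiv.ext (funext fun v => ?_)
  rw [symmetryOp_mul, symmetryOp_of_mem_stabilizer hθ hk, symmetryOp_apply]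

theorem tendsto_symmetryOp (hθ : 0 < θ) (v : WeightedL2 l) :
    Tendsto (fun g => symmetryOp hθ l g v) (𝓝 1) (𝓝 (weylInvolution hθ l v)) := by
  have h1 := tendsto_iff_norm_sub_tendsto_zero.1 (tendsto_unitaryOp hθ v)
  have h2 := tendsto_iff_norm_sub_tendsto_zero.1 (tendsto_unitaryOp hθ (weylInvolution hθ l v))
  rw [tendsto_iff_norm_sub_tendsto_zero]
  refine squeeze_zero (fun _ => norm_nonneg _) (fun g => ?_) (by simpa using h1.add h2)
  have h3 : ‖symmetryOp hθ l g v - unitaryOp hθ l g (weylInvolution hθ l v)‖ =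
      ‖unitaryOp hθ l g v - v‖ := by
    rw [symmetryOp_apply, ← map_sub, LinearIsometryEquiv.norm_map, ← map_sub,
      LinearIsometryEquiv.norm_map, ← (unitaryOp hθ l g).norm_map, map_sub,
      LinearIsometryEquiv.apply_symm_apply, norm_sub_rev]
  calc ‖symmetryOp hθ l g v - weylInvolution hθ l v‖
      ≤ ‖symmetryOp hθ l g v - unitaryOp hθ l g (weylInvolution hθ l v)‖ +
        ‖unitaryOp hθ l g (weylInvolution hθ l v) - weylInvolution hθ l v‖ :=
        norm_sub_le_norm_sub_add_norm_sub _ _ _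
    _ = _ := by rw [h3]

theorem continuous_symmetryOp (hθ : 0 < θ) (v : WeightedL2 l) :
    Continuous fun g => symmetryOp hθ l g v := by
  rw [continuous_iff_continuousAt]
  intro g
  have h1 : ∀ h, symmetryOp hθ l h v =
      unitaryOp hθ l g (symmetryOp hθ l (g⁻¹ * h) ((unitaryOp hθ l g).symm v)) := fun h => by
    rw [← symmetryOp_mul, mul_inv_cancel_left]
  rw [ContinuousAt, symmetryOp_apply]
  simp only [h1]
  exact ((unitaryOp hθ l g).continuous.tendsto _).comp
    ((tendsto_symmetryOp hθ _).comp (tendsto_inv_mul_one g))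

/-- A transform vanishing exactly at `i`. -/
theorem exists_laplaceTransform_vanishing (hθ : 0 < θ) (l : ℝ) : ∃ u : WeightedL2 l,
    ∀ z, laplaceTransform θ l u z = cayley z * baseKernel hθ l z := by
  have hK := mdifferentiable_baseKernel hθ l
  have hc : MDifferentiable 𝓘(ℂ) 𝓘(ℂ) fun z => cayley z * baseKernel hθ l z := by
    rw [UpperHalfPlane.mdifferentiable_iff] at hK ⊢
    refine DifferentiableOn.mul (DifferentiableOn.congr (f := fun z : ℂ =>
      (z - Complex.I) / (z + Complex.I)) (DifferentiableOn.div (by fun_prop) (by fun_prop)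
        fun z hz => ?_) fun z hz => ?_) hK
    · lift z to ℍ using hz
      exact add_I_ne_zero z
    · lift z to ℍ using hz
      simp only [UpperHalfPlane.ofComplex_apply, cayley]
  obtain ⟨u, hu⟩ := laplaceMap_surjective (l := l) hθ
    ⟨fun z => cayley z * baseKernel hθ l z, hc,
      (memLp_laplaceTransform hθ (evalKernel hθ l UpperHalfPlane.I)).mono
        hc.continuous.aestronglyMeasurable (Eventually.of_forall fun z => by
          rw [norm_mul]
          exact mul_le_of_le_one_left (norm_nonneg _) (norm_cayley_lt_one z).le)⟩
  exact ⟨u, fun z => congrFun (congrArg Subtype.val hu) z⟩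

theorem cayley_eq_zero_iff (z : ℍ) : cayley z = 0 ↔ z = UpperHalfPlane.I := by
  rw [cayley, div_eq_zero_iff, or_iff_left (add_I_ne_zero z), sub_eq_zero, ← UpperHalfPlane.coe_I,
    UpperHalfPlane.coe_inj]

/-- The transform of `u` vanishes only at i, so that of `U r u` vanishes only at `r • i`. If the
symmetry at `r` is the involution, then `r • i` must be fixed by `z ↦ -1/z`, whose only fixed point
is i. -/
theorem mem_stabilizer_of_symmetryOp_eq (hθ : 0 < θ) {r : SL(2, ℝ)}
    (h : ∀ v : WeightedL2 l, symmetryOp hθ l r v = weylInvolution hθ l v) :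
    r ∈ MulAction.stabilizer SL(2, ℝ) UpperHalfPlane.I := by
  obtain ⟨u, hu⟩ := exists_laplaceTransform_vanishing hθ l
  have h1 := h (unitaryOp hθ l r u)
  rw [symmetryOp_apply, LinearIsometryEquiv.symm_apply_apply] at h1
  -- At `r • i` the left side carries the value of the transform of `u` at i, which is 0; the right
  -- side is a nonzero factor times its value at the point `r⁻¹` applied to `-1/(r • i)`.
  have h2 := congrArg (fun v : WeightedL2 l => laplaceTransform θ l v (r • UpperHalfPlane.I)) h1
  simp only [laplaceTransform_unitaryOp, discreteSeries_apply, laplaceTransform_weylInvolution,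
    inv_smul_smul, inv_weylElement_smul_I, hu] at h2
  rw [(cayley_eq_zero_iff _).2 rfl, zero_mul, mul_zero, mul_zero, eq_comm] at h2
  have hne : ∀ (γ : SL(2, ℝ)) (z : ℍ), autFactor γ z ^ ((-2 * dsParam θ : ℝ) : ℂ) ≠ 0 :=
    fun γ z => by
      rw [← norm_pos_iff, norm_autFactor_cpow]
      exact Real.rpow_pos_of_pos (norm_pos_iff.2 (autFactor_ne_zero _ _)) _
  have hph : weylPhase (dsParam θ) ≠ 0 := Complex.exp_ne_zero _
  rw [← autFactor_inv_weylElement, mul_eq_zero, or_iff_right (mul_ne_zero hph (hne _ _)),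
    mul_eq_zero, or_iff_right (hne _ _), mul_eq_zero, or_iff_left (baseKernel_ne_zero hθ l _),
    cayley_eq_zero_iff, inv_smul_eq_iff] at h2
  exact MulAction.mem_stabilizer_iff.2 (eq_I_of_inv_weylElement_smul h2)

/-- The operators attached to the points of the symmetric space. -/
def symmetryMap (hθ : 0 < θ) (l : ℝ)
    (m : SL(2, ℝ) ⧸ MulAction.stabilizer SL(2, ℝ) UpperHalfPlane.I) :
    WeightedL2 l ≃L[ℂ] WeightedL2 l :=
  Quotient.liftOn' m (symmetryOp hθ l) fun g h hgh => by
    rw [QuotientGroup.leftRel_apply] at hgh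
    rw [← symmetryOp_mul_of_mem_stabilizer hθ g hgh, mul_inv_cancel_left]

theorem symmetryMap_mk (hθ : 0 < θ) (g : SL(2, ℝ)) :
    symmetryMap hθ l (QuotientGroup.mk g) = symmetryOp hθ l g := rfl

theorem symmetryMap_injective (hθ : 0 < θ) : Function.Injective (symmetryMap hθ l) := by
  intro m n hmn
  induction m using QuotientGroup.induction_on with | H g =>
  induction n using QuotientGroup.induction_on with | H h =>
  rw [symmetryMap_mk, symmetryMap_mk] at hmn
  rw [QuotientGroup.eq]
  refine mem_stabilizer_of_symmetryOp_eq (l := l) hθ fun v => ?_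
  have h1 := congrArg (fun A : WeightedL2 l ≃L[ℂ] WeightedL2 l => A (unitaryOp hθ l g v)) hmn
  change symmetryOp hθ l g (unitaryOp hθ l g v) = symmetryOp hθ l h (unitaryOp hθ l g v) at h1
  rw [← mul_inv_cancel_left g h] at h1
  rw [symmetryOp_mul, symmetryOp_apply, LinearIsometryEquiv.symm_apply_apply] at h1
  exact ((unitaryOp hθ l g).injective h1).symm

/-! ### The homeomorphism between `AN` and the symmetric space -/

theorem AN.continuous_a : Continuous AN.a :=
  continuous_fst.comp (continuous_induced_dom (f := fun x : AN => (x.a, x.n)))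

theorem AN.continuous_n : Continuous AN.n :=
  continuous_snd.comp (continuous_induced_dom (f := fun x : AN => (x.a, x.n)))

theorem continuous_toSL : Continuous AN.toSL := by
  have := AN.continuous_a
  have := AN.continuous_n
  refine continuous_induced_rng.2 (continuous_matrix fun i j => ?_)
  fin_cases i <;> fin_cases j <;> simp <;> fun_prop

theorem continuous_anOfPoint : Continuous anOfPoint := by
  refine continuous_induced_rng.2 (Continuous.prodMk ?_ ?_)
  · exact (UpperHalfPlane.continuous_im.log fun z => z.im_ne_zero).div_const _
  · exact UpperHalfPlane.continuous_re.div UpperHalfPlane.continuous_im fun z => z.im_ne_zero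

theorem anOfPoint_toSL_smul (x : AN) : anOfPoint (AN.toSL x • UpperHalfPlane.I) = x := by
  have h := coe_toSL_smul x UpperHalfPlane.I
  have hre := congrArg Complex.re h
  have him := congrArg Complex.im h
  rw [Complex.re_ofReal_mul] at hre
  rw [Complex.im_ofReal_mul] at him
  simp at hre him
  ext
  · simp [anOfPoint, him]
  · simp [anOfPoint, hre, him, (Real.exp_pos _).ne']

/-- `AN` is homeomorphic to the hyperbolic plane. -/
def anHomeomorph : AN ≃ₜ SL(2, ℝ) ⧸ MulAction.stabilizer SL(2, ℝ) UpperHalfPlane.I where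
  toFun x := QuotientGroup.mk (AN.toSL x)
  invFun m := Quotient.liftOn' m (fun g => anOfPoint (g • UpperHalfPlane.I)) fun g h hgh => by
    rw [QuotientGroup.leftRel_apply, MulAction.mem_stabilizer_iff, mul_smul,
      inv_smul_eq_iff] at hgh
    rw [hgh]
  left_inv := anOfPoint_toSL_smul
  right_inv m := by
    induction m using QuotientGroup.induction_on with | H g =>
    refine QuotientGroup.eq.2 (MulAction.mem_stabilizer_iff.2 ?_)
    rw [mul_smul, inv_smul_eq_iff]
    exact (anOfPoint_smul_I _).symm
  continuous_toFun := continuous_quotient_mk'.comp continuous_toSL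
  continuous_invFun := by
    refine Continuous.quotient_lift (continuous_anOfPoint.comp ?_) _
    exact continuous_id.smul continuous_const

end

/-! ### Haar measure on `AN` -/

section

open Real

/-- The global coordinates of `AN`. -/
def anCoordinates : AN ≃ₜ ℝ × ℝ where
  toFun x := (x.a, x.n)
  invFun p := ⟨p.1, p.2⟩
  left_inv _ := rfl
  right_inv _ := rfl
  continuous_toFun := continuous_induced_dom
  continuous_invFun := continuous_induced_rng.2 continuous_id

/-- The left Haar measure `da dn` of `AN`. -/
def anHaar : Measure AN := (volume : Measure (ℝ × ℝ)).map anCoordinates.symm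

theorem lintegral_anHaar {f : AN → ENNReal} (hf : Measurable f) :
    ∫⁻ x, f x ∂anHaar = ∫⁻ a : ℝ, ∫⁻ n : ℝ, f ⟨a, n⟩ := by
  have hm := anCoordinates.symm.continuous.measurable
  rw [anHaar, lintegral_map hf hm, Measure.volume_eq_prod,
    lintegral_prod (fun p => f (anCoordinates.symm p)) (hf.comp hm).aemeasurable]
  rfl

/-- In these coordinates left translation is a translation followed by a shear, so Lebesgue measure
is left invariant. -/
theorem measurePreserving_anCoordinates_mul (x : AN) : MeasurePreserving
    (fun p : ℝ × ℝ => (x.a + p.1, exp (-2 * p.1) * x.n + p.2)) volume volume := by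
  have h : MeasurePreserving (fun b : ℝ => x.a + b) := measurePreserving_add_left volume x.a
  refine h.skew_product (g := fun b m => exp (-2 * b) * x.n + m) (by fun_prop)
    (Filter.Eventually.of_forall fun b => ?_)
  exact (measurePreserving_add_left volume _).map_eq

theorem isHaarMeasure_anHaar : anHaar.IsHaarMeasure where
  lt_top_of_isCompact := fun K hK => by
    rw [anHaar, Measure.map_apply anCoordinates.symm.continuous.measurable
      (hK.image anCoordinates.continuous |>.measurableSet |> fun h => by
        simpa using anCoordinates.continuous.measurable h)]
    rw [← anCoordinates.image_eq_preimage_symm]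
    exact (hK.image anCoordinates.continuous).measure_lt_top
  map_mul_left_eq_self := fun x => by
    have hm := anCoordinates.symm.continuous.measurable
    have hx : Measurable (fun y : AN => x * y) := by
      have h1 := AN.continuous_a
      have h2 := AN.continuous_n
      refine Continuous.measurable (continuous_induced_rng.2 ?_)
      exact (continuous_const.add h1).prodMk (by simp only [AN.mul_n]; fun_prop)
    rw [anHaar, Measure.map_map hx hm]
    have h := measurePreserving_anCoordinates_mul x
    nth_rewrite 2 [← h.map_eq]
    rw [Measure.map_map hm h.measurable]
    rfl
  open_pos := fun V hV hne => by
    rw [anHaar, Measure.map_apply anCoordinates.symm.continuous.measurable hV.measurableSet]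
    exact ((hV.preimage anCoordinates.symm.continuous).measure_pos _
      (hne.preimage anCoordinates.symm.surjective)).ne'

/-! ### Matrix coefficients of the restriction to `AN` -/

variable {θ l : ℝ}

/-- The density whose Fourier transform is the matrix coefficient of `(a, n)` as a function
of `n`. -/
def anCoeffDensity (l : ℝ) (φ ψ : ℝ → ℂ) (a r : ℝ) : ℂ :=
  (exp (2 * l * r - l * a) : ℂ) * ((starRingEnd ℂ) (φ r) * ψ (r - a))

theorem inner_anElement (θ : ℝ) (x : AN) (φ ψ : WeightedL2 l) :
    ⟪φ, anElement (-θ) x ψ⟫_ℂ = ∫ r, anCoeffDensity l φ ψ x.a r *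
      Complex.exp (Complex.I * ((-x.n : ℝ) : ℂ) * (expSubst (exp (2 * x.a) / θ) r : ℂ)) := by
  rw [WeightedL2.inner_eq]
  refine integral_congr_ae ?_
  filter_upwards [coeFn_anElement (-θ) x ψ] with r hr
  have h1 : (exp (2 * (x.a - r)) : ℝ) = exp (2 * x.a) * exp (-2 * r) := by
    rw [← Real.exp_add]
    congr 1
    ring
  rw [hr, anOperator, anCoeffDensity, Complex.exp_add, sub_eq_add_neg (2 * l * r), Real.exp_add,
    h1, expSubst]
  push_cast
  rw [show Complex.I / -(θ : ℂ) * (Complex.exp (2 * x.a) * Complex.exp (-2 * r) * x.n) =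
    Complex.I * -(x.n : ℂ) * (Complex.exp (2 * x.a) / θ * Complex.exp (-2 * r)) by
      rw [div_neg]; ring]
  ring

theorem integrable_anCoeffDensity (a : ℝ) (φ ψ : WeightedL2 l) :
    Integrable (anCoeffDensity l φ ψ a) := by
  have h1 := (WeightedL2.memLp_exp_mul φ).star
  -- At `n = 0` the oscillating factor is 1, so the parameter `-1` is immaterial; the density is a
  -- product of two square integrable functions.
  have h2 := WeightedL2.memLp_exp_mul (anElement (-1) ⟨a, 0⟩ ψ)
  refine (h1.integrable_mul h2).congr ?_
  filter_upwards [coeFn_anElement (-1) ⟨a, 0⟩ ψ] with r hr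
  rw [Pi.mul_apply, hr, anOperator, anCoeffDensity, Pi.star_apply, star_mul', mul_zero,
    Complex.ofReal_zero, mul_zero, add_zero,
    show 2 * l * r - l * a = l * r + l * r + -(l * a) by ring, Real.exp_add, Real.exp_add,
    RCLike.star_def, Complex.conj_ofReal]
  push_cast
  ring

theorem enorm_anCoeffDensity_sq (φ ψ : ℝ → ℂ) (a r : ℝ) :
    ‖anCoeffDensity l φ ψ a r‖ₑ ^ 2 =
      ENNReal.ofReal (exp (4 * l * r - 2 * l * a)) * (‖φ r‖ₑ ^ 2 * ‖ψ (r - a)‖ₑ ^ 2) := by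
  rw [anCoeffDensity, enorm_mul, enorm_mul, enorm_ofReal_exp, mul_pow, mul_pow, RCLike.enorm_conj,
    ← ENNReal.ofReal_pow (exp_pos _).le, ← Real.exp_nat_mul]
  congr 3
  push_cast
  ring

/-- Plancherel's factor `πθ e^{-2a}` combines with `e^{2r}` into `e^{2(r-a)}`. The substitution `b =
r - a` then decouples the integrals of `φ` and `ψ`; the extra weight on `ψ` is the admissibility
condition. -/
theorem lintegral_lintegral_anCoeffDensity (hθ : 0 < θ) (φ ψ : WeightedL2 l) :
    ∫⁻ a, ENNReal.ofReal (π / (exp (2 * a) / θ)) *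
      ∫⁻ r, ENNReal.ofReal (exp (2 * r)) * ‖anCoeffDensity l φ ψ a r‖ₑ ^ 2 =
    ENNReal.ofReal (π * θ) * (‖φ‖ₑ ^ 2 *
      ∫⁻ b, ENNReal.ofReal (exp (2 * (l + 1) * b)) * ‖ψ b‖ₑ ^ 2) := by
  have hφ : Measurable fun r => ‖φ r‖ₑ ^ 2 := (Lp.stronglyMeasurable φ).measurable.enorm.pow_const _
  have hψ : Measurable fun r => ‖ψ r‖ₑ ^ 2 := (Lp.stronglyMeasurable ψ).measurable.enorm.pow_const _
  have h1 : ∀ a, ENNReal.ofReal (π / (exp (2 * a) / θ)) *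
      ∫⁻ r, ENNReal.ofReal (exp (2 * r)) * ‖anCoeffDensity l φ ψ a r‖ₑ ^ 2 =
      ∫⁻ r, ENNReal.ofReal (π * θ) * (ENNReal.ofReal (exp (2 * l * r)) * ‖φ r‖ₑ ^ 2) *
        (ENNReal.ofReal (exp (2 * (l + 1) * (r - a))) * ‖ψ (r - a)‖ₑ ^ 2) := fun a => by
    rw [← lintegral_const_mul' _ _ (by simp)]
    congr 1
    ext r
    have h2 : ENNReal.ofReal (π / (exp (2 * a) / θ)) * ENNReal.ofReal (exp (2 * r)) *
        ENNReal.ofReal (exp (4 * l * r - 2 * l * a)) = ENNReal.ofReal (π * θ) *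
        ENNReal.ofReal (exp (2 * l * r)) * ENNReal.ofReal (exp (2 * (l + 1) * (r - a))) := by
      rw [← ENNReal.ofReal_mul (by positivity), ← ENNReal.ofReal_mul (by positivity),
        ← ENNReal.ofReal_mul (by positivity), ← ENNReal.ofReal_mul (by positivity)]
      congr 1
      rw [div_div_eq_mul_div, div_eq_mul_inv, ← Real.exp_neg, mul_assoc (π * θ), mul_assoc (π * θ),
        mul_assoc (π * θ), ← Real.exp_add, ← Real.exp_add, ← Real.exp_add]
      congr 2
      ring
    rw [enorm_anCoeffDensity_sq]
    calc _ = ENNReal.ofReal (π / (exp (2 * a) / θ)) * ENNReal.ofReal (exp (2 * r)) *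
          ENNReal.ofReal (exp (4 * l * r - 2 * l * a)) * (‖φ r‖ₑ ^ 2 * ‖ψ (r - a)‖ₑ ^ 2) := by ring
      _ = _ := by
          rw [h2]
          ring
  simp only [h1]
  rw [lintegral_lintegral_swap (by
    refine Measurable.aemeasurable ?_
    have : Measurable fun p : ℝ × ℝ => ‖ψ (p.2 - p.1)‖ₑ ^ 2 :=
      hψ.comp (measurable_snd.sub measurable_fst)
    have : Measurable fun p : ℝ × ℝ => ‖φ p.2‖ₑ ^ 2 := hφ.comp measurable_snd
    fun_prop)]
  have h3 : ∀ r, ∫⁻ a, ENNReal.ofReal (π * θ) *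
      (ENNReal.ofReal (exp (2 * l * r)) * ‖φ r‖ₑ ^ 2) *
        (ENNReal.ofReal (exp (2 * (l + 1) * (r - a))) * ‖ψ (r - a)‖ₑ ^ 2) =
      ENNReal.ofReal (π * θ) * (ENNReal.ofReal (exp (2 * l * r)) * ‖φ r‖ₑ ^ 2) *
        ∫⁻ b, ENNReal.ofReal (exp (2 * (l + 1) * b)) * ‖ψ b‖ₑ ^ 2 := fun r => by
    rw [lintegral_const_mul' _ _ (by
      refine ENNReal.mul_ne_top (by simp) (ENNReal.mul_ne_top (by simp) (by simp)))]
    congr 1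
    exact lintegral_sub_left_eq_self
      (fun b => ENNReal.ofReal (exp (2 * (l + 1) * b)) * ‖ψ b‖ₑ ^ 2) r
  simp only [h3]
  rw [lintegral_mul_const _ (by fun_prop), lintegral_const_mul _ (by fun_prop),
    WeightedL2.enorm_sq, lintegral_weightedMeasure, mul_assoc]

theorem memLp_coefficient (hθ : 0 < θ) (φ ψ : WeightedL2 l)
    (hψ : ∫⁻ b, ENNReal.ofReal (exp (2 * (l + 1) * b)) * ‖ψ b‖ₑ ^ 2 < ⊤) :
    MemLp (fun x : AN => ‖⟪φ, unitaryOp hθ l (AN.toSL x) ψ⟫_ℂ‖) 2 anHaar := by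
  have hcont : Continuous fun x : AN => ‖⟪φ, unitaryOp hθ l (AN.toSL x) ψ⟫_ℂ‖ :=
    ((isProjectiveUnitaryRep_unitaryOp hθ l).continuous_abs_coeff ψ φ).comp continuous_toSL
  rw [memLp_two_iff_lintegral hcont.aestronglyMeasurable,
    lintegral_anHaar (hcont.measurable.enorm.pow_const _)]
  have hfin := lintegral_lintegral_anCoeffDensity hθ φ ψ
  have htop : ENNReal.ofReal (π * θ) * (‖φ‖ₑ ^ 2 *
      ∫⁻ b, ENNReal.ofReal (exp (2 * (l + 1) * b)) * ‖ψ b‖ₑ ^ 2) < ⊤ :=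
    ENNReal.mul_lt_top (by simp) (ENNReal.mul_lt_top (by simp) hψ)
  rw [← hfin] at htop
  have hmeas : Measurable fun a : ℝ => ENNReal.ofReal (π / (exp (2 * a) / θ)) *
      ∫⁻ r, ENNReal.ofReal (exp (2 * r)) * ‖anCoeffDensity l φ ψ a r‖ₑ ^ 2 := by
    refine Measurable.mul (by fun_prop) (Measurable.lintegral_prod_right' (f := fun p : ℝ × ℝ =>
      ENNReal.ofReal (exp (2 * p.2)) * ‖anCoeffDensity l φ ψ p.1 p.2‖ₑ ^ 2) ?_)
    have h1 : Measurable fun p : ℝ × ℝ => ψ (p.2 - p.1) :=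
      (Lp.stronglyMeasurable ψ).measurable.comp (measurable_snd.sub measurable_fst)
    have h2 : Measurable fun p : ℝ × ℝ => (starRingEnd ℂ) (φ p.2) :=
      Complex.continuous_conj.measurable.comp
        ((Lp.stronglyMeasurable φ).measurable.comp measurable_snd)
    have h3 : Measurable fun p : ℝ × ℝ => (exp (2 * l * p.2 - l * p.1) : ℂ) := by fun_prop
    exact Measurable.mul (by fun_prop) ((h3.mul (h2.mul h1)).enorm.pow_const _)
  refine lt_of_le_of_lt (lintegral_mono_ae ?_) htop
  filter_upwards [ae_lt_top hmeas htop.ne] with a ha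
  have hpos : 0 < exp (2 * a) / θ := div_pos (exp_pos _) hθ
  -- Plancherel in `n` requires this inner integral to be finite; that holds for almost every `a`
  -- because the total is finite and the prefactor is positive.
  have h2 : ∫⁻ r, ENNReal.ofReal (exp (2 * r)) * ‖anCoeffDensity l φ ψ a r‖ₑ ^ 2 < ⊤ := by
    refine lt_of_le_of_ne le_top fun h => ?_
    rw [h, ENNReal.mul_top (by simpa using div_pos pi_pos hpos)] at ha
    exact lt_irrefl _ ha
  rw [← lintegral_enorm_integral_exp hpos (integrable_anCoeffDensity a φ ψ) h2]
  refine le_of_eq ?_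
  rw [← lintegral_neg_eq_self (μ := (volume : Measure ℝ))]
  congr 1
  ext n
  rw [unitaryOp_toSL, inner_anElement, enorm_norm, neg_neg]

/-- For each `a`, injectivity of the Fourier transform in `n` makes `φ(r) ψ(r - a)` vanish for
almost every `r`. Integrating over `a` by Tonelli gives `(∫ |φ|) (∫ |ψ|) = 0`; no admissibility is
needed. -/
theorem eq_zero_or_eq_zero_of_coefficient_eq_zero (hθ : 0 < θ) {φ ψ : WeightedL2 l}
    (h : ∀ x : AN, ⟪φ, unitaryOp hθ l (AN.toSL x) ψ⟫_ℂ = 0) : φ = 0 ∨ ψ = 0 := by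
  have h1 : ∀ a, anCoeffDensity l φ ψ a =ᵐ[volume] 0 := fun a => by
    refine ae_eq_zero_of_integral_exp_eq_zero (div_pos (exp_pos (2 * a)) hθ)
      (integrable_anCoeffDensity a φ ψ) fun p => ?_
    have h2 := h ⟨a, -p⟩
    rwa [unitaryOp_toSL, inner_anElement, neg_neg] at h2
  have hφ := (Lp.stronglyMeasurable φ).measurable.enorm
  have hψ := (Lp.stronglyMeasurable ψ).measurable.enorm
  have h3 : ∫⁻ a : ℝ, ∫⁻ r, ‖φ r‖ₑ * ‖ψ (r - a)‖ₑ = 0 := by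
    rw [← lintegral_zero (α := ℝ) (μ := volume)]
    refine lintegral_congr fun a => ?_
    rw [← lintegral_zero (α := ℝ) (μ := volume)]
    refine lintegral_congr_ae ?_
    filter_upwards [h1 a] with r hr
    rw [anCoeffDensity, Pi.zero_apply, mul_eq_zero, or_iff_right (by simp [Complex.exp_ne_zero]),
      mul_eq_zero, map_eq_zero] at hr
    rcases hr with hr | hr <;> simp [hr]
  rw [lintegral_lintegral_swap (by
    refine Measurable.aemeasurable ?_
    have h4 : Measurable fun p : ℝ × ℝ => ‖ψ (p.2 - p.1)‖ₑ :=
      hψ.comp (measurable_snd.sub measurable_fst)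
    have h5 : Measurable fun p : ℝ × ℝ => ‖φ p.2‖ₑ := hφ.comp measurable_snd
    exact h5.mul h4)] at h3
  have h6 : ∀ r, ∫⁻ a, ‖φ r‖ₑ * ‖ψ (r - a)‖ₑ = ‖φ r‖ₑ * ∫⁻ b, ‖ψ b‖ₑ := fun r => by
    rw [lintegral_const_mul' _ _ (by simp)]
    congr 1
    exact lintegral_sub_left_eq_self (fun b => ‖ψ b‖ₑ) r
  simp only [h6] at h3
  rw [lintegral_mul_const _ hφ, mul_eq_zero, lintegral_eq_zero_iff hφ,
    lintegral_eq_zero_iff hψ] at h3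
  have h7 : ∀ {u : WeightedL2 l}, (fun r => ‖u r‖ₑ) =ᵐ[volume] 0 → u = 0 := fun {u} hu => by
    rw [Lp.eq_zero_iff_ae_eq_zero, WeightedL2.ae_eq_iff]
    filter_upwards [hu] with r hr
    simpa using hr
  exact h3.imp h7 h7

/-! ### Irreducibility and an admissible vector -/

theorem unitaryOp_irreducible (hθ : 0 < θ) (W : Submodule ℂ (WeightedL2 l))
    (hW : IsClosed (W : Set (WeightedL2 l)))
    (h : ∀ x : AN, ∀ v ∈ W, unitaryOp hθ l (AN.toSL x) v ∈ W) : W = ⊥ ∨ W = ⊤ := by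
  have := hW.completeSpace_coe
  by_contra! hne
  rw [← Submodule.orthogonal_eq_bot_iff.ne] at hne
  obtain ⟨ψ, hψ, hψ0⟩ := Submodule.exists_mem_ne_zero_of_ne_bot hne.1
  obtain ⟨φ, hφ, hφ0⟩ := Submodule.exists_mem_ne_zero_of_ne_bot hne.2
  exact (eq_zero_or_eq_zero_of_coefficient_eq_zero hθ fun x =>
    Submodule.inner_left_of_mem_orthogonal (h x ψ hψ) hφ).elim hφ0 hψ0

theorem exists_admissible (l : ℝ) : ∃ ψ : WeightedL2 l, ψ ≠ 0 ∧
    ∫⁻ b, ENNReal.ofReal (exp (2 * (l + 1) * b)) * ‖ψ b‖ₑ ^ 2 < ⊤ := by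
  have hfin : ∀ c : ℝ, ∫⁻ b in Set.Icc (0 : ℝ) 1, ENNReal.ofReal (exp (c * b)) < ⊤ := fun c =>
    (Continuous.integrableOn_Icc (by fun_prop)).lintegral_lt_top
  have hs : weightedMeasure l (Set.Icc 0 1) < ⊤ := by
    rw [withDensity_apply _ measurableSet_Icc]
    exact hfin (2 * l)
  refine ⟨indicatorConstLp 2 measurableSet_Icc hs.ne (1 : ℂ), ?_, ?_⟩
  · rw [Ne, Lp.eq_zero_iff_ae_eq_zero, WeightedL2.ae_eq_iff]
    intro h0
    have h1 := (WeightedL2.ae_eq_iff.1 (indicatorConstLp_coeFn (p := 2) (hs := measurableSet_Icc)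
      (hμs := hs.ne) (c := (1 : ℂ)))).symm.trans h0
    rw [Set.indicator_ae_eq_zero, show Function.support (fun _ : ℝ => (1 : ℂ)) = Set.univ from
      Function.support_const one_ne_zero, Set.inter_univ, Real.volume_Icc] at h1
    norm_num at h1
  · refine lt_of_le_of_lt (le_of_eq ?_) (hfin (2 * (l + 1)))
    rw [← lintegral_indicator measurableSet_Icc]
    refine lintegral_congr_ae ?_
    filter_upwards [WeightedL2.ae_eq_iff.1 (indicatorConstLp_coeFn (p := 2)
      (hs := measurableSet_Icc) (hμs := hs.ne) (c := (1 : ℂ)))] with b hb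
    rw [hb]
    by_cases hb' : b ∈ Set.Icc (0 : ℝ) 1 <;> simp [hb']

end

/-! ### The Bessel function and its Laplace transform -/

section

open Real

/-- The entire function `∑ (-y)^m / (m! Γ(m + ν + 1))`. -/
def besselSeries (ν y : ℝ) : ℝ :=
  ∑' m : ℕ, (-y) ^ m / ((m.factorial : ℝ) * Real.Gamma ((m : ℝ) + ν + 1))

/-- The argument is at least 2, where Γ increases from `Γ(2) = 1`. This bounds the Bessel series
termwise by the exponential series. -/
theorem one_le_Gamma {ν : ℝ} (hν : 1 ≤ ν) (m : ℕ) : 1 ≤ Real.Gamma ((m : ℝ) + ν + 1) := by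
  have hm : (0 : ℝ) ≤ m := m.cast_nonneg
  refine Real.Gamma_two.symm.le.trans ?_
  exact Real.Gamma_strictMonoOn_Ici.monotoneOn Set.self_mem_Ici
    (by rw [Set.mem_Ici]; linarith) (by linarith)

theorem norm_besselSeries_term_le {ν : ℝ} (hν : 1 ≤ ν) (y : ℝ) (m : ℕ) :
    ‖(-y) ^ m / ((m.factorial : ℝ) * Real.Gamma ((m : ℝ) + ν + 1))‖ ≤
      |y| ^ m / (m.factorial : ℝ) := by
  have h1 := one_le_Gamma hν m
  have h2 : (0 : ℝ) < m.factorial := by positivity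
  rw [norm_div, norm_mul, norm_pow, norm_neg, Real.norm_eq_abs, Real.norm_of_nonneg h2.le,
    Real.norm_of_nonneg (zero_le_one.trans h1)]
  gcongr
  exact le_mul_of_one_le_right h2.le h1

theorem hasSum_besselSeries {ν : ℝ} (hν : 1 ≤ ν) (y : ℝ) :
    HasSum (fun m : ℕ => (-y) ^ m / ((m.factorial : ℝ) * Real.Gamma ((m : ℝ) + ν + 1)))
      (besselSeries ν y) :=
  (Summable.of_norm_bounded (Real.summable_pow_div_factorial |y|)
    (norm_besselSeries_term_le hν y)).hasSum

theorem hasSum_exp_abs (y : ℝ) : HasSum (fun m : ℕ => |y| ^ m / (m.factorial : ℝ)) (exp |y|) := by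
  rw [Real.exp_eq_exp_ℝ]
  exact NormedSpace.expSeries_div_hasSum_exp |y|

theorem norm_besselSeries_le {ν : ℝ} (hν : 1 ≤ ν) (y : ℝ) : ‖besselSeries ν y‖ ≤ exp |y| :=
  (hasSum_besselSeries hν y).norm_le_of_bounded (hasSum_exp_abs y) (norm_besselSeries_term_le hν y)

theorem measurable_besselSeries {ν : ℝ} (hν : 1 ≤ ν) : Measurable (besselSeries ν) := by
  refine measurable_of_tendsto_metrizable (f := fun (N : ℕ) y => ∑ m ∈ Finset.range N,
    (-y) ^ m / ((m.factorial : ℝ) * Real.Gamma ((m : ℝ) + ν + 1))) (fun N => by fun_prop) ?_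
  exact tendsto_pi_nhds.2 fun y => (hasSum_besselSeries hν y).tendsto_sum_nat

theorem besselJ_eq {ν x : ℝ} (hx : 0 < x) :
    besselJ ν x = (x / 2) ^ ν * besselSeries ν ((x / 2) ^ 2) := by
  rw [besselJ, besselSeries, ← tsum_mul_left]
  congr 1
  ext m
  rw [Real.rpow_add (by positivity), Real.rpow_mul (by positivity), Real.rpow_natCast,
    Real.rpow_two, neg_pow ((x / 2) ^ 2)]
  ring

theorem expSubst_pow (c : ℝ) (m : ℕ) (r : ℝ) :
    expSubst c r ^ m = c ^ m * exp (-2 * m * r) := by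
  rw [expSubst, mul_pow, ← Real.exp_nat_mul]
  congr 2
  ring

theorem integral_exp_gamma_nat {c : ℝ} (hc : 0 < c) {a : ℝ} (ha : 0 < a) {w : ℂ} (hw : 0 < w.re)
    (m : ℕ) :
    ((2 * c ^ a : ℝ) : ℂ) * ∫ r : ℝ, (exp (-2 * a * r) : ℂ) * ((expSubst c r : ℝ) : ℂ) ^ m *
      Complex.exp (-(w * (expSubst c r : ℂ))) =
      (1 / w) ^ (a : ℂ) * (1 / w) ^ m * (Real.Gamma (m + a) : ℂ) := by
  have hma : 0 < (m : ℝ) + a := by positivity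
  have h := integral_exp_gamma hc hma hw
  have hw0 : (1 : ℂ) / w ≠ 0 := one_div_ne_zero (by rintro rfl; simp at hw)
  have h1 : ∀ r : ℝ, (exp (-2 * a * r) : ℂ) * ((expSubst c r : ℝ) : ℂ) ^ m *
      Complex.exp (-(w * (expSubst c r : ℂ))) = (c : ℂ) ^ m * ((exp (-2 * (m + a) * r) : ℂ) *
      Complex.exp (-(w * (expSubst c r : ℂ)))) := fun r => by
    rw [← Complex.ofReal_pow, expSubst_pow, show -2 * ((m : ℝ) + a) * r =
      -2 * a * r + -2 * m * r by ring, Real.exp_add]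
    push_cast
    ring
  simp only [h1]
  rw [integral_const_mul, ← mul_assoc]
  have h2 : ((2 * c ^ a : ℝ) : ℂ) * (c : ℂ) ^ m = ((2 * c ^ ((m : ℝ) + a) : ℝ) : ℂ) := by
    rw [Real.rpow_add hc, Real.rpow_natCast]
    push_cast
    ring
  rw [h2, h]
  push_cast
  rw [Complex.cpow_add _ _ hw0, Complex.cpow_natCast]
  ring

/-- Termwise integration: the m-th Gamma integral produces `Γ(m + ν + 1)`, cancelling the
denominator and leaving an exponential series in `-t/w`. The interchange is dominated because the
series is at most `e^{|t|E}`, `E = expSubst c r`, while the exponential decays like `e^{-(Re w) E}`;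
this is the role of `|t| < Re w`. -/
theorem integral_besselSeries {c : ℝ} (hc : 0 < c) {ν : ℝ} (hν : 1 ≤ ν) {w : ℂ} {t : ℝ}
    (ht : |t| < w.re) :
    ((2 * c ^ (ν + 1) : ℝ) : ℂ) * ∫ r : ℝ, (exp (-2 * (ν + 1) * r) : ℂ) *
      Complex.exp (-(w * (expSubst c r : ℂ))) * (besselSeries ν (expSubst c r * t) : ℂ) =
      (1 / w) ^ ((ν + 1 : ℝ) : ℂ) * Complex.exp (-(t : ℂ) * (1 / w)) := by
  have hw : 0 < w.re := (abs_nonneg t).trans_lt ht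
  have hν1 : 0 < ν + 1 := by linarith
  have hE := expSubst_pos hc
  have hcE : Continuous fun r => expSubst c r := by unfold expSubst; fun_prop
  set F : ℕ → ℝ → ℂ := fun m r => (((-t) ^ m / (m.factorial * Real.Gamma (m + ν + 1)) : ℝ) : ℂ) *
    ((exp (-2 * (ν + 1) * r) : ℂ) * ((expSubst c r : ℝ) : ℂ) ^ m *
      Complex.exp (-(w * (expSubst c r : ℂ)))) with hF
  have hFeq : ∀ m r, F m r = (exp (-2 * (ν + 1) * r) : ℂ) *
      Complex.exp (-(w * (expSubst c r : ℂ))) * (((-(expSubst c r * t)) ^ m /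
        ((m.factorial : ℝ) * Real.Gamma ((m : ℝ) + ν + 1)) : ℝ) : ℂ) := fun m r => by
    rw [hF]
    push_cast
    rw [show -((expSubst c r : ℂ) * (t : ℂ)) = expSubst c r * (-t : ℂ) by ring, mul_pow]
    ring
  have hnorm : ∀ r, ‖(exp (-2 * (ν + 1) * r) : ℂ) * Complex.exp (-(w * (expSubst c r : ℂ)))‖ =
      exp (-2 * (ν + 1) * r) * exp (-(w.re * expSubst c r)) := fun r => by
    rw [norm_mul, Complex.norm_exp, Complex.norm_real, Real.norm_of_nonneg (exp_pos _).le,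
      Complex.neg_re, Complex.re_mul_ofReal]
  have hsum : ∀ r, HasSum (fun m => F m r) ((exp (-2 * (ν + 1) * r) : ℂ) *
      Complex.exp (-(w * (expSubst c r : ℂ))) * (besselSeries ν (expSubst c r * t) : ℂ)) :=
    fun r => by
      simp only [hFeq]
      exact (Complex.hasSum_ofReal.2 (hasSum_besselSeries hν _)).mul_left _
  have hbsum : ∀ r, HasSum (fun m : ℕ => exp (-2 * (ν + 1) * r) * exp (-(w.re * expSubst c r)) *
      (|expSubst c r * t| ^ m / (m.factorial : ℝ)))
      (exp (-2 * (ν + 1) * r) * exp (-((w.re - |t|) * expSubst c r))) := fun r => by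
    have h := (hasSum_exp_abs (expSubst c r * t)).mul_left
      (exp (-2 * (ν + 1) * r) * exp (-(w.re * expSubst c r)))
    have h' : exp (-2 * (ν + 1) * r) * exp (-(w.re * expSubst c r)) * exp |expSubst c r * t| =
        exp (-2 * (ν + 1) * r) * exp (-((w.re - |t|) * expSubst c r)) := by
      rw [mul_assoc, ← Real.exp_add, abs_mul, abs_of_pos (hE r)]
      congr 2
      ring
    rwa [h'] at h
  have key := hasSum_integral_of_dominated_convergence (μ := volume) (F := F)
    (fun m r => exp (-2 * (ν + 1) * r) * exp (-(w.re * expSubst c r)) *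
      (|expSubst c r * t| ^ m / (m.factorial : ℝ)))
    (fun m => Continuous.aestronglyMeasurable (by rw [hF]; fun_prop))
    (fun m => Filter.Eventually.of_forall fun r => by
      rw [hFeq, norm_mul, hnorm, Complex.norm_real]
      exact mul_le_mul_of_nonneg_left (norm_besselSeries_term_le hν _ m) (by positivity))
    (Filter.Eventually.of_forall fun r => (hbsum r).summable)
    (by
      simp only [fun r => (hbsum r).tsum_eq]
      have h := (integrable_exp_gamma hc hν1 (w := ((w.re - |t| : ℝ) : ℂ))
        (by rw [Complex.ofReal_re]; linarith)).norm
      refine h.congr (Filter.Eventually.of_forall fun r => ?_)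
      simp only [norm_mul, Complex.norm_exp, Complex.norm_real, Real.norm_eq_abs, Real.abs_exp,
        Complex.neg_re, Complex.re_ofReal_mul, Complex.ofReal_re])
    (Filter.Eventually.of_forall hsum)
  have hint : ∀ m, ((2 * c ^ (ν + 1) : ℝ) : ℂ) * ∫ r, F m r =
      (1 / w) ^ ((ν + 1 : ℝ) : ℂ) * ((-(t : ℂ) * (1 / w)) ^ m / (m.factorial : ℂ)) := fun m => by
    have hΓ : (Real.Gamma (m + ν + 1) : ℂ) ≠ 0 := by
      exact_mod_cast (zero_lt_one.trans_le (one_le_Gamma hν m)).ne'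
    have hfac : (m.factorial : ℂ) ≠ 0 := by exact_mod_cast m.factorial_ne_zero
    simp only [hF]
    rw [integral_const_mul, mul_left_comm, integral_exp_gamma_nat hc hν1 hw, ← add_assoc]
    push_cast
    rw [mul_pow]
    generalize (1 / w) ^ m = x
    field_simp
  have h1 := key.mul_left ((2 * c ^ (ν + 1) : ℝ) : ℂ)
  simp only [hint] at h1
  refine h1.unique (HasSum.mul_left _ ?_)
  rw [Complex.exp_eq_exp_ℂ]
  exact NormedSpace.expSeries_div_hasSum_exp _

end

/-! ### The involution on compactly supported elements -/

section

open Real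

variable {θ l : ℝ}

/-- The integrand of the Bessel transform at `r`, in the variable of the function. -/
def besselDensity (θ l : ℝ) (φ : ℝ → ℂ) (r q : ℝ) : ℂ :=
  (besselSeries (2 * dsParam θ - 1) (expSubst θ⁻¹ r * expSubst θ⁻¹ q) : ℂ) *
    ((exp ((l - 2 * dsParam θ) * q) : ℂ) * φ q)

/-- With `q = 2a - r`, the square of half the Bessel argument is the product `expSubst θ⁻¹ r *
expSubst θ⁻¹ q`, so the kernel becomes symmetric in `r` and `q` up to exponential factors. -/
theorem besselIntegrand_eq (hθ : 0 < θ) (l : ℝ) (φ : ℝ → ℂ) (r a : ℝ) :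
    besselIntegrand θ l φ r a =
      ((θ⁻¹ ^ (2 * dsParam θ - 1) * exp ((l - 2 * dsParam θ) * r) : ℝ) : ℂ) *
        besselDensity θ l φ r (2 * a - r) := by
  have hc : 0 < θ⁻¹ := inv_pos.2 hθ
  have hx : 0 < 2 / θ * exp (-2 * a) := by positivity
  have h1 : 2 / θ * exp (-2 * a) / 2 = θ⁻¹ * exp (-2 * a) := by ring
  have h2 : (θ⁻¹ * exp (-2 * a)) ^ 2 = expSubst θ⁻¹ r * expSubst θ⁻¹ (2 * a - r) := by
    rw [expSubst, expSubst, mul_mul_mul_comm, ← Real.exp_add, mul_pow, ← Real.exp_nat_mul, ← sq]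
    congr 2
    push_cast
    ring
  have h3 : (θ⁻¹ * exp (-2 * a)) ^ (2 * dsParam θ - 1) * exp (2 * (l - 1) * a) =
      θ⁻¹ ^ (2 * dsParam θ - 1) * exp ((l - 2 * dsParam θ) * r) *
        exp ((l - 2 * dsParam θ) * (2 * a - r)) := by
    rw [Real.mul_rpow hc.le (exp_pos _).le, ← Real.exp_mul, mul_assoc (θ⁻¹ ^ _),
      mul_assoc (θ⁻¹ ^ _), ← Real.exp_add, ← Real.exp_add]
    congr 2
    ring
  have h4 := congrArg Complex.ofReal h3
  rw [besselIntegrand, besselJ_eq hx, h1, h2, besselDensity]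
  simp only [Complex.ofReal_mul] at h4 ⊢
  linear_combination ((besselSeries (2 * dsParam θ - 1)
    (expSubst θ⁻¹ r * expSubst θ⁻¹ (2 * a - r)) : ℂ) * φ (2 * a - r)) * h4

theorem integrable_besselIntegrand_iff (hθ : 0 < θ) (φ : ℝ → ℂ) (r : ℝ) :
    Integrable (besselIntegrand θ l φ r) ↔ Integrable (besselDensity θ l φ r) := by
  have h1 : besselIntegrand θ l φ r = fun a =>
      ((θ⁻¹ ^ (2 * dsParam θ - 1) * exp ((l - 2 * dsParam θ) * r) : ℝ) : ℂ) *
        besselDensity θ l φ r (2 * a - r) := funext (besselIntegrand_eq hθ l φ r)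
  have h2 : 0 < θ⁻¹ ^ (2 * dsParam θ - 1) * exp ((l - 2 * dsParam θ) * r) := by positivity
  rw [h1, integrable_const_mul_iff (IsUnit.mk0 _ (by exact_mod_cast h2.ne')),
    integrable_comp_mul_left_iff (fun b => besselDensity θ l φ r (b - r)) two_ne_zero]
  refine ⟨fun h => ?_, fun h => h.comp_sub_right r⟩
  simpa using h.comp_add_right r

/-- The Jacobian of `q = 2a - r` halves the constant 4; the resulting `2 θ^{-2s}` is exactly the
normalization of the Gamma integral. -/
theorem besselTransform_eq (hθ : 0 < θ) (φ : ℝ → ℂ) (r : ℝ) :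
    besselTransform θ l φ r =
      ((2 * θ⁻¹ ^ (2 * dsParam θ) * exp (-(l + 2 * dsParam θ) * r) : ℝ) : ℂ) *
        ∫ q, besselDensity θ l φ r q := by
  rw [besselTransform]
  simp only [besselIntegrand_eq hθ]
  rw [integral_const_mul, Measure.integral_comp_mul_left (fun b => besselDensity θ l φ r (b - r)),
    integral_sub_right_eq_self (besselDensity θ l φ r), Complex.real_smul, ← mul_assoc, ← mul_assoc]
  rw [← Complex.ofReal_mul, ← Complex.ofReal_mul]
  congr 2
  rw [show (2 * dsParam θ) = 1 + (2 * dsParam θ - 1) by ring, Real.rpow_add (inv_pos.2 hθ),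
    Real.rpow_one, show -(l + (1 + (2 * dsParam θ - 1))) * r = -2 * l * r +
      (l - 2 * dsParam θ) * r by ring, Real.exp_add, abs_of_pos (by norm_num)]
  ring_nf

theorem integrable_mul_of_support {φ : WeightedL2 l} {R : ℝ} (g : ℝ → ℝ) (hg : Continuous g)
    (hR : ∀ᵐ a : ℝ, R < |a| → (φ : ℝ → ℂ) a = 0) : Integrable fun q => (g q : ℂ) * φ q := by
  have h1 : MemLp ((Set.Icc (-R) R).indicator fun q => ((g q * exp (-(l * q)) : ℝ) : ℂ)) 2 := by
    rw [memLp_indicator_iff_restrict measurableSet_Icc]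
    have hc : Continuous fun q => ((g q * exp (-(l * q)) : ℝ) : ℂ) := by fun_prop
    obtain ⟨C, hC⟩ := (isCompact_Icc (a := -R) (b := R)).exists_bound_of_continuousOn hc.continuousOn
    exact MemLp.of_bound hc.aestronglyMeasurable C
      ((ae_restrict_iff' measurableSet_Icc).2 (Filter.Eventually.of_forall hC))
  refine (h1.integrable_mul φ.memLp_exp_mul).congr ?_
  filter_upwards [hR] with q hq
  rw [Pi.mul_apply]
  by_cases hqR : q ∈ Set.Icc (-R) R
  · rw [Set.indicator_of_mem hqR, ← mul_assoc, ← Complex.ofReal_mul, mul_assoc (g q),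
      ← Real.exp_add, neg_add_cancel, Real.exp_zero, mul_one]
  · rw [hq (by rwa [Set.mem_Icc, ← abs_le, not_le] at hqR)]
    simp

theorem one_le_besselIndex (hθ : 0 < θ) : 1 ≤ 2 * dsParam θ - 1 := by
  linarith [one_lt_dsParam hθ]

theorem continuous_expSubst (c : ℝ) : Continuous (expSubst c) := by
  unfold expSubst
  fun_prop

theorem aestronglyMeasurable_besselDensity (hθ : 0 < θ) (φ : WeightedL2 l) (r : ℝ) :
    AEStronglyMeasurable (besselDensity θ l φ r) := by
  have h1 : Measurable fun q =>
      (besselSeries (2 * dsParam θ - 1) (expSubst θ⁻¹ r * expSubst θ⁻¹ q) : ℂ) :=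
    Complex.measurable_ofReal.comp ((measurable_besselSeries (one_le_besselIndex hθ)).comp
      ((continuous_expSubst θ⁻¹).measurable.const_mul _))
  exact h1.aestronglyMeasurable.mul ((by fun_prop : Continuous fun q : ℝ =>
    (exp ((l - 2 * dsParam θ) * q) : ℂ)).aestronglyMeasurable.mul φ.aestronglyMeasurable)

theorem integrable_besselDensity (hθ : 0 < θ) {φ : WeightedL2 l} {R : ℝ}
    (hR : ∀ᵐ a : ℝ, R < |a| → (φ : ℝ → ℂ) a = 0) (r : ℝ) :
    Integrable (besselDensity θ l φ r) := by
  have hE := continuous_expSubst θ⁻¹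
  have h1 := integrable_mul_of_support (fun q => exp |expSubst θ⁻¹ r * expSubst θ⁻¹ q| *
    exp ((l - 2 * dsParam θ) * q)) (by fun_prop) hR
  refine h1.mono (aestronglyMeasurable_besselDensity hθ φ r) (Filter.Eventually.of_forall fun q => ?_)
  rw [besselDensity, norm_mul, norm_mul, norm_mul, Complex.norm_real, Complex.norm_real,
    Complex.norm_real, norm_mul, Real.norm_of_nonneg (exp_pos _).le,
    Real.norm_of_nonneg (exp_pos _).le, mul_assoc]
  gcongr
  exact norm_besselSeries_le (one_le_besselIndex hθ) _

/-- The phase turns `z^{-2s}` into the principal power of `1/(-iz)`, the form in which the Laplace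
transform of the Bessel series appears. The argument of `1/(-iz)` is `π/2 - arg z`, inside the
principal range. -/
theorem weylPhase_mul_cpow_eq (s : ℝ) (z : ℍ) :
    weylPhase s * (z : ℂ) ^ ((-2 * s : ℝ) : ℂ) = (1 / (-Complex.I * z)) ^ ((2 * s : ℝ) : ℂ) := by
  have h0 : 1 / (-Complex.I * (z : ℂ)) ≠ 0 :=
    one_div_ne_zero (mul_ne_zero (neg_ne_zero.2 Complex.I_ne_zero) z.ne_zero)
  have h1 : 1 / (-Complex.I * (z : ℂ)) =
      Complex.exp (((Real.pi / 2 : ℝ) : ℂ) * Complex.I - Complex.log z) := by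
    rw [Complex.exp_sub, Complex.exp_log z.ne_zero]
    push_cast
    rw [Complex.exp_pi_div_two_mul_I, neg_mul, div_eq_div_iff
      (neg_ne_zero.2 (mul_ne_zero Complex.I_ne_zero z.ne_zero)) z.ne_zero]
    linear_combination (z : ℂ) * Complex.I_mul_I
  have h2 : 0 ≤ Complex.arg z := Complex.arg_nonneg_iff.2 z.im_pos.le
  have h3 := Complex.arg_le_pi (z : ℂ)
  have hpi := Real.pi_pos
  have h4 : Complex.log (1 / (-Complex.I * (z : ℂ))) =
      ((Real.pi / 2 : ℝ) : ℂ) * Complex.I - Complex.log z := by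
    rw [h1, Complex.log_exp]
    · rw [Complex.sub_im, Complex.im_ofReal_mul, Complex.I_im, Complex.log_im]
      linarith
    · rw [Complex.sub_im, Complex.im_ofReal_mul, Complex.I_im, Complex.log_im]
      linarith
  rw [Complex.cpow_def_of_ne_zero h0, h4, Complex.cpow_def_of_ne_zero z.ne_zero, weylPhase,
    ← Complex.exp_add]
  congr 1
  push_cast
  ring

/-- The two-variable integrand of the Laplace-type transform of the Bessel transform. -/
def besselLaplaceDensity (θ l : ℝ) (φ : ℝ → ℂ) (w : ℂ) (r q : ℝ) : ℂ :=
  (exp (-2 * (2 * dsParam θ) * r) : ℂ) * Complex.exp (-(w * (expSubst θ⁻¹ r : ℂ))) *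
    besselDensity θ l φ r q

theorem laplaceIntegrand_besselTransform (hθ : 0 < θ) (φ : ℝ → ℂ) (z : ℍ) (r : ℝ) :
    laplaceIntegrand θ l (besselTransform θ l φ) z r =
      ((2 * θ⁻¹ ^ (2 * dsParam θ) : ℝ) : ℂ) *
        ∫ q, besselLaplaceDensity θ l φ (-Complex.I * z) r q := by
  simp only [besselLaplaceDensity]
  rw [integral_const_mul, laplaceIntegrand_eq_cexp, besselTransform_eq hθ,
    show -2 * (2 * dsParam θ) * r = (l - 2 * dsParam θ) * r + -(l + 2 * dsParam θ) * r by ring,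
    Real.exp_add]
  push_cast
  ring

/-- The Bessel factor is only bounded by `e^{E(r)E(q)}`, `E = expSubst θ⁻¹`. Taking `Re w ≥ E(q) +
1` on the support of `φ` beats this growth and leaves `e^{-E(r)}`, giving an integrable product
majorant. -/
theorem integrable_besselLaplaceDensity (hθ : 0 < θ) {φ : WeightedL2 l} {R : ℝ}
    (hR : ∀ᵐ a : ℝ, R < |a| → (φ : ℝ → ℂ) a = 0) {w : ℂ}
    (hw : ∀ q, |q| ≤ R → expSubst θ⁻¹ q + 1 ≤ w.re) :
    Integrable (Function.uncurry (besselLaplaceDensity θ l φ w)) (volume.prod volume) := by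
  have hc : 0 < θ⁻¹ := inv_pos.2 hθ
  have hE := continuous_expSubst θ⁻¹
  have hEpos := expSubst_pos hc
  have hs : 0 < 2 * dsParam θ := by linarith [one_lt_dsParam hθ]
  have h1 := integrable_exp_gamma hc hs (w := 1) (by simp)
  have h2 := integrable_mul_of_support (fun q => exp ((l - 2 * dsParam θ) * q)) (by fun_prop) hR
  refine (h1.mul_prod h2).mono ?_ ?_
  · have h3 : Measurable fun p : ℝ × ℝ =>
        (besselSeries (2 * dsParam θ - 1) (expSubst θ⁻¹ p.1 * expSubst θ⁻¹ p.2) : ℂ) :=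
      Complex.measurable_ofReal.comp ((measurable_besselSeries (one_le_besselIndex hθ)).comp
        (by fun_prop))
    have h4 : Measurable fun p : ℝ × ℝ => φ p.2 :=
      (Lp.stronglyMeasurable φ).measurable.comp measurable_snd
    have h5 : Measurable fun p : ℝ × ℝ => (exp (-2 * (2 * dsParam θ) * p.1) : ℂ) *
        Complex.exp (-(w * (expSubst θ⁻¹ p.1 : ℂ))) := by fun_prop
    have h6 : Measurable fun p : ℝ × ℝ => (exp ((l - 2 * dsParam θ) * p.2) : ℂ) := by fun_prop
    exact (h5.mul (h3.mul (h6.mul h4))).aestronglyMeasurable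
  · have hR' : ∀ᵐ p : ℝ × ℝ ∂(volume.prod volume), R < |p.2| → (φ : ℝ → ℂ) p.2 = 0 :=
      Measure.quasiMeasurePreserving_snd.ae hR
    filter_upwards [hR'] with p hp
    rcases lt_or_ge R |p.2| with hpR | hpR
    · simp [Function.uncurry, besselLaplaceDensity, besselDensity, hp hpR]
    · have h7 : ‖besselSeries (2 * dsParam θ - 1) (expSubst θ⁻¹ p.1 * expSubst θ⁻¹ p.2)‖ ≤
          exp (expSubst θ⁻¹ p.1 * expSubst θ⁻¹ p.2) := by
        refine (norm_besselSeries_le (one_le_besselIndex hθ) _).trans_eq ?_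
        rw [abs_of_pos (mul_pos (hEpos _) (hEpos _))]
      have h8 : exp (-(w.re * expSubst θ⁻¹ p.1)) * exp (expSubst θ⁻¹ p.1 * expSubst θ⁻¹ p.2) ≤
          exp (-(1 * expSubst θ⁻¹ p.1)) := by
        rw [← Real.exp_add, Real.exp_le_exp]
        nlinarith [hw p.2 hpR, hEpos p.1]
      have h9 : ‖Complex.exp (-(w * (expSubst θ⁻¹ p.1 : ℂ)))‖ *
          ‖(besselSeries (2 * dsParam θ - 1) (expSubst θ⁻¹ p.1 * expSubst θ⁻¹ p.2) : ℂ)‖ ≤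
          ‖Complex.exp (-(1 * (expSubst θ⁻¹ p.1 : ℂ)))‖ := by
        rw [Complex.norm_exp, Complex.norm_exp, Complex.neg_re, Complex.neg_re,
          Complex.re_mul_ofReal, Complex.re_mul_ofReal, Complex.one_re, Complex.norm_real]
        exact (mul_le_mul_of_nonneg_left h7 (exp_pos _).le).trans h8
      simp only [Function.uncurry, besselLaplaceDensity, besselDensity, norm_mul]
      rw [mul_assoc, ← mul_assoc ‖Complex.exp _‖, ← mul_assoc]
      gcongr

theorem integral_besselLaplaceDensity (hθ : 0 < θ) (φ : ℝ → ℂ) {z : ℍ} {q : ℝ}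
    (hq : expSubst θ⁻¹ q < z.im) :
    ((2 * θ⁻¹ ^ (2 * dsParam θ) : ℝ) : ℂ) *
        ∫ r, besselLaplaceDensity θ l φ (-Complex.I * z) r q =
      weylPhase (dsParam θ) * (z : ℂ) ^ ((-2 * dsParam θ : ℝ) : ℂ) *
        laplaceIntegrand θ l φ (weylElement⁻¹ • z) q := by
  have hc : 0 < θ⁻¹ := inv_pos.2 hθ
  have hEq := expSubst_pos hc q
  have h := integral_besselSeries hc (one_le_besselIndex hθ) (w := -Complex.I * z)
    (t := expSubst θ⁻¹ q) (by rw [abs_of_pos hEq]; simpa using hq)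
  rw [sub_add_cancel] at h
  simp only [besselLaplaceDensity, besselDensity, ← mul_assoc] at h ⊢
  rw [integral_mul_const, integral_mul_const, ← mul_assoc, ← mul_assoc, h, weylPhase_mul_cpow_eq,
    laplaceIntegrand_eq_cexp, coe_inv_weylElement_smul]
  have h1 : -(expSubst θ⁻¹ q : ℂ) * (1 / (-Complex.I * z)) =
      -(-Complex.I * -(z : ℂ)⁻¹ * expSubst θ⁻¹ q) := by
    have hz := z.ne_zero
    have hI := Complex.I_ne_zero
    field_simp
    rw [Complex.I_sq]
    ring
  rw [h1]
  ring

/-- The Bessel transform is not known beforehand to lie in the weighted space, so injectivity of T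
is not available for it. Instead the transforms are compared on a single horizontal line, high
enough for Fubini, and Fourier injectivity on that line concludes. -/
theorem weylInvolution_ae_eq_of_support (hθ : 0 < θ) {φ : WeightedL2 l} {R : ℝ}
    (hR : ∀ᵐ a : ℝ, R < |a| → (φ : ℝ → ℂ) a = 0) :
    weylInvolution hθ l φ =ᵐ[volume] besselTransform θ l φ := by
  have hc : 0 < θ⁻¹ := inv_pos.2 hθ
  -- `θ⁻¹ e^{2R}` bounds `expSubst θ⁻¹` on `[-R, R]`; the extra 1 provides the remaining decay.
  set y : ℝ := θ⁻¹ * exp (2 * R) + 1 with hy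
  have hy0 : 0 < y := by positivity
  have hyq : ∀ q, |q| ≤ R → expSubst θ⁻¹ q + 1 ≤ y := fun q hq => by
    have h : exp (-2 * q) ≤ exp (2 * R) := Real.exp_le_exp.2 (by linarith [(abs_le.1 hq).1])
    rw [hy, expSubst]
    gcongr
  have hint : ∀ z : ℍ, z.im = y → Integrable (Function.uncurry
      (besselLaplaceDensity θ l φ (-Complex.I * z))) (volume.prod volume) := fun z hz =>
    integrable_besselLaplaceDensity hθ hR (by simpa [hz] using hyq)
  have hI : ∀ z : ℍ, z.im = y → Integrable (laplaceIntegrand θ l (besselTransform θ l φ) z) :=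
    fun z hz => by
      rw [funext (laplaceIntegrand_besselTransform (l := l) hθ φ z)]
      exact (hint z hz).integral_prod_left.const_mul _
  have hT : ∀ z : ℍ, z.im = y →
      laplaceTransform θ l (weylInvolution hθ l φ) z =
        laplaceTransform θ l (besselTransform θ l φ) z := fun z hz => by
    rw [laplaceTransform_weylInvolution, laplaceTransform, laplaceTransform]
    simp only [laplaceIntegrand_besselTransform hθ]
    rw [integral_const_mul, integral_integral_swap (hint z hz), ← integral_const_mul,
      ← integral_const_mul]
    refine integral_congr_ae ?_
    filter_upwards [hR] with q hq
    rcases lt_or_ge R |q| with hqR | hqR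
    · simp [besselLaplaceDensity, besselDensity, laplaceIntegrand, hq hqR]
    · exact (integral_besselLaplaceDensity hθ φ (by linarith [hyq q hqR])).symm
  have hW : Integrable (laplaceWeight θ l (besselTransform θ l φ) y) := by
    refine (hI ⟨⟨0, y⟩, hy0⟩ rfl).congr (Filter.Eventually.of_forall fun r => ?_)
    simp only [laplaceIntegrand_eq_weight]
    simp [UpperHalfPlane.re, UpperHalfPlane.im]
  have hV := integrable_laplaceWeight hθ (weylInvolution hθ l φ) hy0
  have hzero := ae_eq_zero_of_integral_exp_eq_zero hc (hV.sub hW) fun p => by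
    have h1 := hT ⟨⟨p, y⟩, hy0⟩ rfl
    have h2 := integrable_laplaceIntegrand hθ (weylInvolution hθ l φ) ⟨⟨p, y⟩, hy0⟩
    have h3 := hI ⟨⟨p, y⟩, hy0⟩ rfl
    rw [laplaceTransform, laplaceTransform, ← sub_eq_zero, ← integral_sub h2 h3] at h1
    rw [← h1]
    refine integral_congr_ae (Filter.Eventually.of_forall fun r => ?_)
    simp only [laplaceIntegrand_eq_weight, Pi.sub_apply, ← sub_mul]
    rfl
  filter_upwards [hzero] with r hr
  rw [Pi.sub_apply, Pi.zero_apply, laplaceWeight, laplaceWeight, ← mul_sub, mul_eq_zero,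
    or_iff_right (by simp [Complex.exp_ne_zero])] at hr
  exact sub_eq_zero.1 hr

end

/-! ### The involution on general elements -/

section

open Real Filter Topology

variable {θ l : ℝ}

/-- The truncation of an element to `[-N, N]`. -/
def truncation (φ : WeightedL2 l) (N : ℕ) : WeightedL2 l :=
  ((Lp.memLp φ).indicator (measurableSet_Icc (a := -(N : ℝ)) (b := N))).toLp

theorem coeFn_truncation (φ : WeightedL2 l) (N : ℕ) :
    truncation φ N =ᵐ[volume] (Set.Icc (-(N : ℝ)) N).indicator φ :=
  WeightedL2.ae_eq_iff.1 (MemLp.coeFn_toLp _)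

theorem tendsto_truncation (φ : WeightedL2 l) : Tendsto (truncation φ) atTop (𝓝 φ) := by
  rw [Lp.tendsto_Lp_iff_tendsto_eLpNorm']
  have h1 : ∀ N : ℕ, eLpNorm (truncation φ N - φ : ℝ → ℂ) 2 (weightedMeasure l) =
      (∫⁻ q, ‖(Set.Icc (-(N : ℝ)) N)ᶜ.indicator φ q‖ₑ ^ 2 ∂(weightedMeasure l)) ^ (1 / 2 : ℝ) :=
    fun N => by
      rw [← eLpNorm_two_sq, ← ENNReal.rpow_natCast, ← ENNReal.rpow_mul]
      norm_num
      refine eLpNorm_congr_norm_ae ?_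
      filter_upwards [WeightedL2.ae_eq_iff.2 (coeFn_truncation φ N)] with q hq
      rw [Pi.sub_apply, hq]
      by_cases h : q ∈ Set.Icc (-(N : ℝ)) N
      · rw [Set.indicator_of_mem h, Set.indicator_of_notMem (Set.notMem_compl_iff.2 h), sub_self]
      · rw [Set.indicator_of_notMem h, Set.indicator_of_mem (Set.mem_compl h), zero_sub, norm_neg]
  simp only [h1]
  have h2 : Tendsto (fun N : ℕ => ∫⁻ q, ‖(Set.Icc (-(N : ℝ)) N)ᶜ.indicator φ q‖ₑ ^ 2
      ∂(weightedMeasure l)) atTop (𝓝 0) := by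
    have hφ := (Lp.stronglyMeasurable φ).measurable
    rw [← lintegral_zero (α := ℝ) (μ := weightedMeasure l)]
    refine tendsto_lintegral_of_dominated_convergence (fun q => ‖φ q‖ₑ ^ 2)
      (fun N => (hφ.indicator measurableSet_Icc.compl).enorm.pow_const _)
      (fun N => Eventually.of_forall fun q => ?_) ?_ (Eventually.of_forall fun q => ?_)
    · simp only
      gcongr
      exact enorm_indicator_le_enorm_self _ _
    · rw [← WeightedL2.enorm_sq]
      exact ENNReal.pow_ne_top enorm_ne_top
    · refine tendsto_const_nhds.congr' ?_
      filter_upwards [tendsto_natCast_atTop_atTop.eventually_ge_atTop |q|] with N hN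
      have hq : q ∈ Set.Icc (-(N : ℝ)) N := abs_le.1 hN
      rw [Set.indicator_of_notMem (Set.notMem_compl_iff.2 hq)]
      simp
  have h3 := (ENNReal.continuous_rpow_const (y := (1 / 2 : ℝ))).tendsto 0
  rw [ENNReal.zero_rpow_of_pos (by norm_num)] at h3
  exact h3.comp h2

theorem besselDensity_indicator (s : Set ℝ) (φ : ℝ → ℂ) (r : ℝ) :
    besselDensity θ l (s.indicator φ) r = s.indicator (besselDensity θ l φ r) := by
  ext q
  by_cases h : q ∈ s <;> simp [besselDensity, h]

theorem tendsto_besselTransform_truncation (hθ : 0 < θ) (φ : WeightedL2 l) {r : ℝ}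
    (h : Integrable (besselIntegrand θ l φ r)) :
    Tendsto (fun N => besselTransform θ l (truncation φ N) r) atTop
      (𝓝 (besselTransform θ l φ r)) := by
  rw [integrable_besselIntegrand_iff hθ] at h
  simp only [besselTransform_eq hθ]
  refine Tendsto.const_mul _ ?_
  have h1 : ∀ N : ℕ, ∫ q, besselDensity θ l (truncation φ N) r q =
      ∫ q in Set.Icc (-(N : ℝ)) N, besselDensity θ l φ r q := fun N => by
    rw [← integral_indicator measurableSet_Icc, ← besselDensity_indicator]
    refine integral_congr_ae ?_
    filter_upwards [coeFn_truncation φ N] with q hq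
    simp only [besselDensity, hq]
  simp only [h1]
  exact (aecover_Icc (tendsto_neg_atTop_atBot.comp tendsto_natCast_atTop_atTop)
    tendsto_natCast_atTop_atTop).integral_tendsto_of_countably_generated h

/-- The images of the truncations converge in norm, hence almost everywhere along a subsequence, to
the image of `φ`. Their Bessel integrals converge pointwise to that of `φ` by absolute convergence,
so the limits agree. -/
theorem weylInvolution_ae_eq (hθ : 0 < θ) (φ : WeightedL2 l)
    (h : ∀ᵐ r : ℝ, Integrable (besselIntegrand θ l φ r)) :
    weylInvolution hθ l φ =ᵐ[volume] besselTransform θ l φ := by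
  have h1 := ((weylInvolution hθ l).continuous.tendsto φ).comp (tendsto_truncation φ)
  obtain ⟨ns, hns, h2⟩ := (tendstoInMeasure_of_tendsto_Lp h1).exists_seq_tendsto_ae
  have h3 : ∀ᵐ r : ℝ, ∀ N : ℕ, (weylInvolution hθ l (truncation φ N) : ℝ → ℂ) r =
      besselTransform θ l (truncation φ N) r := by
    refine ae_all_iff.2 fun N => weylInvolution_ae_eq_of_support hθ (R := N) ?_
    filter_upwards [coeFn_truncation φ N] with q hq hqN
    rw [hq, Set.indicator_of_notMem]
    rw [Set.mem_Icc, ← abs_le]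
    exact hqN.not_ge
  filter_upwards [(ae_weightedMeasure_iff l).1 h2, h3, h] with r hr2 hr3 hr
  refine tendsto_nhds_unique hr2 ?_
  simp only [Function.comp_apply, hr3]
  exact (tendsto_besselTransform_truncation hθ φ hr).comp hns.tendsto_atTop

end

/-- The involution is bounded, so the whole Hilbert space serves as the Fréchet space, with the
identity as embedding. -/
theorem isSquareIntegrableIrreducibleRep {θ : ℝ} (hθ : 0 < θ) (l : ℝ) :
    IsSquareIntegrableIrreducibleRep (MulAction.stabilizer SL(2, ℝ) UpperHalfPlane.I)
      AN.toSL (unitaryOp hθ l) (ContinuousLinearMap.id ℂ (WeightedL2 l))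
      (weylInvolution hθ l).toContinuousLinearEquiv where
  continuous_j := continuous_toSL
  groupType := anHomeomorph.isHomeomorph
  complete := inferInstance
  separable := separableSpace_weightedL2 l
  isRep := isProjectiveUnitaryRep_unitaryOp hθ l
  frechet_complete := inferInstance
  frechet_t2 := inferInstance
  frechet_countable := inferInstance
  dense := Function.surjective_id.denseRange
  injective := Function.injective_id
  exists_Omega := ⟨fun g => (unitaryOp hθ l g).toContinuousLinearEquiv, fun _ _ => rfl,
    fun _ hk v => weylInvolution_unitaryOp_of_mem_stabilizer hθ hk v, symmetryMap hθ l,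
    fun _ _ => rfl, fun v => isQuotientMap_quot_mk.continuous_iff.2 (continuous_symmetryOp hθ v),
    symmetryMap_injective hθ⟩
  nontrivial := by
    obtain ⟨ψ, hψ, -⟩ := exists_admissible l
    exact ⟨ψ, 0, hψ⟩
  irreducible := unitaryOp_irreducible hθ
  squareIntegrable := by
    obtain ⟨ψ, hψ, h⟩ := exists_admissible l
    exact ⟨anHaar, isHaarMeasure_anHaar, ψ, hψ, fun φ => memLp_coefficient hθ φ ψ h⟩

end

theorem mainTheorem12 (θ l : ℝ) (hθ : 0 < θ) :
    ∃ (T : WeightedL2 l ≃ₗ[ℂ] bergmanSpace (dsParam θ))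
      (U : SL(2, ℝ) → (WeightedL2 l ≃ₗᵢ[ℂ] WeightedL2 l))
      (ϑ : WeightedL2 l ≃ₗᵢ[ℂ] WeightedL2 l),
      -- the Laplace-type integral converges and defines `T`
      (∀ (u : WeightedL2 l) (z : ℍ), Integrable (laplaceIntegrand θ l u z) ∧
        (T u : ℍ → ℂ) z = ∫ q, laplaceIntegrand θ l u z q) ∧
      -- up to an explicit constant, `T` is unitary
      (∀ u v : WeightedL2 l,
        bergmanInner (dsParam θ) (T u : ℍ → ℂ) (T v : ℍ → ℂ)
          = ((2 * Real.pi * Real.Gamma (2 * dsParam θ - 1)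
              * (θ / 2) ^ (2 * dsParam θ) : ℝ) : ℂ) * ⟪u, v⟫_ℂ) ∧
      -- `U = T⁻¹ V T`, with `V` the projective holomorphic discrete series
      (∀ (g : SL(2, ℝ)) (u : WeightedL2 l),
        (T (U g u) : ℍ → ℂ) = discreteSeries (dsParam θ) g (T u : ℍ → ℂ)) ∧
      -- `T` intertwines the restriction of `V` to `AN` with the explicit action of `AN`
      (∀ (x : AN) (u : WeightedL2 l),
        U (AN.toSL x) u =ᵐ[volume] anOperator (-θ) l x u) ∧
      -- the Bessel integral converges on compactly supported elements, defines `ϑ`,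
      -- and `ϑ` is an involution
      (∀ φ : WeightedL2 l, (∃ R : ℝ, ∀ᵐ a : ℝ, R < |a| → (φ : ℝ → ℂ) a = 0) →
        ∀ a₀ : ℝ, Integrable (besselIntegrand θ l φ a₀)) ∧
      (∀ φ : WeightedL2 l, (∀ᵐ a₀ : ℝ, Integrable (besselIntegrand θ l φ a₀)) →
        ϑ φ =ᵐ[volume] besselTransform θ l φ) ∧
      (∀ φ : WeightedL2 l, ϑ (ϑ φ) = φ) ∧
      -- `(WeightedL2 l, U, ϑ)` is a square integrable irreducible unitary representation of the
      -- hyperbolic plane `SL(2, ℝ) ⧸ K`, `K` the stabilizer of `i`, as a symmetric space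
      IsUnitaryRepOfSymmetricSpace cartanInvolution U ϑ ∧
      IsSquareIntegrableIrreducibleRep (MulAction.stabilizer SL(2, ℝ) UpperHalfPlane.I)
        AN.toSL U (ContinuousLinearMap.id ℂ (WeightedL2 l)) ϑ.toContinuousLinearEquiv := by
  refine ⟨laplaceEquiv hθ l, unitaryOp hθ l, weylInvolution hθ l,
    fun u z => ⟨integrable_laplaceIntegrand hθ u z, rfl⟩, bergmanInner_laplaceMap hθ,
    laplaceTransform_unitaryOp hθ, fun x u => ?_, fun φ hφ a₀ => ?_,
    weylInvolution_ae_eq hθ, weylInvolution_weylInvolution hθ, isUnitaryRepOfSymmetricSpace hθ l,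
    isSquareIntegrableIrreducibleRep hθ l⟩
  · rw [unitaryOp_toSL]
    exact coeFn_anElement (-θ) x u
  · obtain ⟨R, hR⟩ := hφ
    exact (integrable_besselIntegrand_iff hθ φ a₀).2 (integrable_besselDensity hθ hR a₀)
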